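/- Let $(X_t)_{t\ge 1}$ be a strictly stationary sequence of random vectors in $\mathbb{R}^p$ that is strongly mixing with mixing coefficients $a_k$ satisfying $\sum_{k\ge1}k^2a_k<\infty$. Let $\mu\in\mathbb{R}^p$ and $\sigma\in(0,\infty)^p$, write $D_v$ for the diagonal matrix with diagonal $v$, and let $\hat\mu_T,\hat\sigma_T$ be random vectors with $\hat\mu_T-\mu=O_P(T^{-1/2})$ and $\hat\sigma_T-\sigma=O_P(T^{-1/2})$. Let $\Psi:\mathbb{R}^p\to\mathbb{R}^s$ be measurable and bounded. Suppose there are finitely many points $a_1,\dots,a_n$ and $\epsilon>0$, a bounded set $B$ (for instance a bounded hypersurface), finitely many hyperplanes $H_q=\{x:x_{m_q}=c_q\}$ and finitely many hyperplanes $E_q=\{x:x_{m'_q}=c'_q\}$ such that, with $N=B\cup\bigcup_q H_q\cup\bigcup_q E_q$: (1) $\Psi$ is twice continuously differentiable at every point outside $N\cup\{a_1,\dots,a_n\}$, and there are $C_1,C_2>0$ such that for all $x\notin N$ with $|x-a_l|>\epsilon$ for every $l$, and all $i\le s$, $j\le p$, $|\partial_j\Psi^{(i)}(x)\,x_j|\le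 C_1$ and $x^T\Psi^{(i)\prime\prime}(x)x\le C_2$; (2) there are $C_3,\delta>0$ such that $|\Psi'(x)|\le C_3|x-a_l|^{-(p-\delta)}$ and $|\Psi''(x)|\le C_3|x-a_l|^{-(2p-\delta)}$ for every $l$ and every $x\notin N\cup\{a_1,\dots,a_n\}$ with $|x-a_l|\le\epsilon$; (3) if $B\ne\emptyset$, then $\Psi$ is Lipschitz continuous; (4) if there are hyperplanes $H_q$, then $\Psi$ is Lipschitz continuous and there is $K>0$ such that, for each $q$, $\Psi(x)=\Psi(y)$ whenever $x,y$ differ only in the coordinate $m_q$ and $x_{m_q},y_{m_q}>K$; (5) if there are hyperplanes $E_q$ (on which $\Psi$ may be discontinuous), then $\Psi'(x)=0$ for all $x\notin\bigcup_qE_q$. If $\Psi$ is not Lipschitz continuous, assume moreover that $X_1$ has a bounded Lebesgue density on $\mathbb{R}^p$ and that each coordinate of $X_1$ has a bounded Lebesgue density on $\mathbb{R}$. Put $Y_i=\Psi(D_\sigma^{-1}(X_i-\mu))$, $Y_{i,T}=\Psi(D_{\hat\sigma_T}^{-1}(X_i-\hat\mu_T))$, $\bar Y_T=\frac1T\sum_{i=1}^TY_{i,T}$,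 $$U=\sum_{h\in\mathbb{Z}}\mathrm{Cov}(Y_i,Y_{i+h})=\mathrm{Var}(Y_1)+\sum_{h=1}^\infty\left(\mathrm{Cov}(Y_1,Y_{1+h})+\mathrm{Cov}(Y_1,Y_{1+h})^T\right),$$ and assume $\det U>0$. Let $k:\mathbb{R}\to[-1,1]$ be continuous at $0$ with only finitely many discontinuities, $k(0)=1$, $k(x)=k(-x)$, $\int|k(x)|\,dx<\infty$ and $\int\left|\int k(x)e^{-2\pi \mathrm{i}x\xi}\,dx\right|d\xi<\infty$. Let $b_T\to\infty$ and $b_T/T^{1-\eta}\to0$ for some $\eta>0$. Define $$\hat U=\frac1T\sum_{i,j=1}^T(Y_{i,T}-\bar Y_T)(Y_{j,T}-\bar Y_T)^T\,k\!\left(\frac{|i-j|}{b_T}\right).$$ Then the series defining $U$ converges absolutely and $\hat U\to U$ in probability (entrywise) as $T\to\infty$. Moreover the estimation of $\mu$ and $\sigma$ is asymptotically negligible: if $\tilde U$ is defined like $\hat U$ with $Y_i$ in place of $Y_{i,T}$, then $\hat U-\tilde U\to0$ in probability. -/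

import Mathlib

open MeasureTheory ProbabilityTheory Filter Topology
open scoped FourierTransform NNReal

namespace RobustCusum

noncomputable section

/-! ### The time series: strict stationarity and strong mixing -/

section TimeSeries

variable {Ω : Type*} [MeasurableSpace Ω] {p : ℕ}

/-- Strict stationarity: all shifted sequences have the same law on the sequence space. -/
def IsStrictlyStationary (X : ℕ → Ω → EuclideanSpace ℝ (Fin p)) (P : Measure Ω) : Prop :=
  ∀ h : ℕ, P.map (fun ω (t : ℕ) => X (t + h) ω) = P.map (fun ω (t : ℕ) => X t ω)

/-- The sigma-algebra generated by `X_0, …, X_n`. -/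
@[reducible] def pastSigma (X : ℕ → Ω → EuclideanSpace ℝ (Fin p)) (n : ℕ) : MeasurableSpace Ω :=
  ⨆ i ∈ Set.Iic n, MeasurableSpace.comap (X i) inferInstance

/-- The sigma-algebra generated by `X_n, X_{n+1}, …`. -/
@[reducible] def futureSigma (X : ℕ → Ω → EuclideanSpace ℝ (Fin p)) (n : ℕ) : MeasurableSpace Ω :=
  ⨆ i ∈ Set.Ici n, MeasurableSpace.comap (X i) inferInstance

/-- The strong mixing coefficient `a_k`: the supremum of `|P(A ∩ B) - P(A) P(B)|` over all `n`, all
events `A` of the past up to time `n` and all events `B` of the future from time `n + k` on. For a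
probability measure the supremum is over a nonempty set bounded by `1`. -/
def mixingCoeff (X : ℕ → Ω → EuclideanSpace ℝ (Fin p)) (P : Measure Ω) (k : ℕ) : ℝ :=
  sSup {r : ℝ | ∃ (n : ℕ) (A B : Set Ω), MeasurableSet[pastSigma X n] A ∧
    MeasurableSet[futureSigma X (n + k)] B ∧ r = |P.real (A ∩ B) - P.real A * P.real B|}

/-- `√T * Z_T` is bounded in probability, i.e. `Z_T = O_P(T^{-1/2})`. -/
def IsRootConsistent (Z : ℕ → Ω → EuclideanSpace ℝ (Fin p)) (P : Measure Ω) : Prop :=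
  ∀ η : ℝ, 0 < η → ∃ M : ℝ, ∀ᶠ T : ℕ in atTop,
    P.real {ω | M < Real.sqrt T * ‖Z T ω‖} ≤ η

end TimeSeries

/-! ### The transformation `Ψ` -/

section Transformation

variable {p s : ℕ}

/-- The hyperplane `{x | x_m = c}`, indexed by the pair `(m, c)`. -/
def coordHyperplane (h : Fin p × ℝ) : Set (EuclideanSpace ℝ (Fin p)) := {x | x h.1 = h.2}

/-- The union of a finite family of coordinate hyperplanes. -/
def hyperplaneUnion (H : Finset (Fin p × ℝ)) : Set (EuclideanSpace ℝ (Fin p)) :=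
  ⋃ h ∈ H, coordHyperplane h

/-- Regularity of `Ψ` with exemption set consisting of balls of radius `ε` around the finitely many
singularities in `S`, a bounded set `B` (e.g. a bounded hypersurface) and finitely many hyperplanes
`H` on which `Ψ` may fail to be differentiable, and finitely many hyperplanes `E` on which `Ψ` may
be discontinuous. The codomain carries the maximum norm. -/
structure RegularOff (Ψ : EuclideanSpace ℝ (Fin p) → Fin s → ℝ)
    (S : Finset (EuclideanSpace ℝ (Fin p))) (ε : ℝ) (B : Set (EuclideanSpace ℝ (Fin p)))
    (H E : Finset (Fin p × ℝ)) : Prop where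
  eps_pos : 0 < ε
  bounded_B : Bornology.IsBounded B
  /-- twice continuous differentiability (inside the balls only the centres are exempt) -/
  smooth : ∀ x, x ∉ (S : Set (EuclideanSpace ℝ (Fin p))) → x ∉ B → x ∉ hyperplaneUnion H →
    x ∉ hyperplaneUnion E → ContDiffAt ℝ 2 Ψ x
  /-- `|∂_j Ψ^{(i)}(x) x_j| ≤ C₁` and `xᵀ Ψ^{(i)}''(x) x ≤ C₂` off the exemption set -/
  deriv_bounds : ∃ C₁ > (0 : ℝ), ∃ C₂ > (0 : ℝ), ∀ x, (∀ a ∈ S, ε < ‖x - a‖) → x ∉ B →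
    x ∉ hyperplaneUnion H → x ∉ hyperplaneUnion E →
      (∀ (i : Fin s) (j : Fin p),
        |fderiv ℝ Ψ x (EuclideanSpace.single j 1) i * x j| ≤ C₁) ∧
      (∀ i : Fin s, iteratedFDeriv ℝ 2 Ψ x ![x, x] i ≤ C₂)
  /-- growth of the derivatives at the singularities -/
  singular : ∃ C₃ > (0 : ℝ), ∃ δ > (0 : ℝ), ∀ a ∈ S, ∀ x, ‖x - a‖ ≤ ε →
    x ∉ (S : Set (EuclideanSpace ℝ (Fin p))) → x ∉ B → x ∉ hyperplaneUnion H →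
    x ∉ hyperplaneUnion E →
      ‖fderiv ℝ Ψ x‖ ≤ C₃ * ‖x - a‖ ^ (-((p : ℝ) - δ)) ∧
      ‖iteratedFDeriv ℝ 2 Ψ x‖ ≤ C₃ * ‖x - a‖ ^ (-(2 * (p : ℝ) - δ))
  /-- a bounded set of non-differentiability is allowed if `Ψ` is Lipschitz -/
  lipschitz_of_B : B.Nonempty → ∃ L : ℝ≥0, LipschitzWith L Ψ
  /-- hyperplanes of non-differentiability are allowed if `Ψ` is Lipschitz and, in the direction
  normal to the hyperplane, constant beyond some `K` -/
  lipschitz_of_H : H.Nonempty → (∃ L : ℝ≥0, LipschitzWith L Ψ) ∧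
    ∃ K > (0 : ℝ), ∀ h ∈ H, ∀ x y : EuclideanSpace ℝ (Fin p),
      (∀ l, l ≠ h.1 → x l = y l) → K < x h.1 → K < y h.1 → Ψ x = Ψ y
  /-- hyperplanes of discontinuity are allowed if the derivative vanishes off them -/
  deriv_zero_of_E : E.Nonempty → ∀ x, x ∉ hyperplaneUnion E →
    HasFDerivAt Ψ (0 : EuclideanSpace ℝ (Fin p) →L[ℝ] (Fin s → ℝ)) x

/-- Boundedness and piecewise regularity of the (measurable) transformation `Ψ`. -/
structure IsAdmissible (Ψ : EuclideanSpace ℝ (Fin p) → Fin s → ℝ) : Prop where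
  measurable : Measurable Ψ
  bounded : ∃ C : ℝ, ∀ x, ‖Ψ x‖ < C
  regular : ∃ (S : Finset (EuclideanSpace ℝ (Fin p))) (ε : ℝ)
    (B : Set (EuclideanSpace ℝ (Fin p))) (H E : Finset (Fin p × ℝ)), RegularOff Ψ S ε B H E

end Transformation

/-! ### The kernel and the bandwidth -/

/-- The conditions on the kernel `k` and the bandwidths `b_T`. -/
structure IsKernelBandwidth (k : ℝ → ℝ) (b : ℕ → ℝ) : Prop where
  abs_le_one : ∀ x, |k x| ≤ 1
  continuousAt_zero : ContinuousAt k 0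
  finite_discontinuities : {x | ¬ ContinuousAt k x}.Finite
  map_zero : k 0 = 1
  even : ∀ x, k (-x) = k x
  integrable : Integrable k
  integrable_fourier : Integrable (𝓕 (fun x : ℝ => (k x : ℂ)))
  bandwidth_tendsto : Tendsto b atTop atTop
  bandwidth_rate : ∃ ε > (0 : ℝ), Tendsto (fun T : ℕ => b T / (T : ℝ) ^ (1 - ε)) atTop (𝓝 0)

/-! ### The estimator and its target -/

section Estimator

variable {Ω : Type*} [MeasurableSpace Ω] {p s : ℕ}

/-- Marginal standardization `D_v⁻¹ (x - m)`. -/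
def standardize (m v x : EuclideanSpace ℝ (Fin p)) : EuclideanSpace ℝ (Fin p) :=
  WithLp.toLp 2 fun j => (x j - m j) / v j

/-- The kernel estimator `T⁻¹ ∑_{i,j} (y_i - ȳ) (y_j - ȳ)ᵀ k(|i - j| / b)` from a sample
`y_0, …, y_{T-1}`. -/
def kernelEstimator (k : ℝ → ℝ) (b : ℝ) (T : ℕ) (y : ℕ → Fin s → ℝ) :
    Matrix (Fin s) (Fin s) ℝ :=
  Matrix.of fun l m => (T : ℝ)⁻¹ * ∑ i ∈ Finset.range T, ∑ j ∈ Finset.range T,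
    (y i l - (T : ℝ)⁻¹ * ∑ u ∈ Finset.range T, y u l) *
    (y j m - (T : ℝ)⁻¹ * ∑ u ∈ Finset.range T, y u m) * k (|(i : ℝ) - (j : ℝ)| / b)

/-- The lag-`h` autocovariances `Cov(Y_0^{(l)}, Y_h^{(m)})`. -/
def autocov (Y : ℕ → Ω → Fin s → ℝ) (P : Measure Ω) (h : ℕ) : Matrix (Fin s) (Fin s) ℝ :=
  Matrix.of fun l m => cov[fun ω => Y 0 ω l, fun ω => Y h ω m; P]

/-- The long run covariance matrix `∑_{h ∈ ℤ} Cov(Y_i, Y_{i+h})` of a stationary sequence: the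
lag `-h` contributes the transpose of the lag `h`. -/
def longRunCov (Y : ℕ → Ω → Fin s → ℝ) (P : Measure Ω) : Matrix (Fin s) (Fin s) ℝ :=
  Matrix.of fun l m => autocov Y P 0 l m +
    ∑' h : ℕ, (autocov Y P (h + 1) l m + autocov Y P (h + 1) m l)

end Estimator

end

end RobustCusum

/-!
Estimator and target are reduced by polarization to quadratic forms in scalar samples `ψ(Z_t)`, where
`ψ` is a sum or a difference of two components of `Ψ` and `Z_t` is the standardized observation.

*Consistency with known parameters.* The kernel need not be positive definite, its spectral density
is only integrable, and it may jump. It is therefore split as `k = κ + K_g`, where `κ` decays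
quadratically and `K_g` is the cosine transform of a function `g` of small `L¹` norm
(`IsKernelBandwidth.exists_decomposition`). Writing the form with kernel `K_g` as an integral of
`g` against a periodogram, one bounds it by the positive semidefinite form `spectralEnergy g`, whose
expectation is at most `8 ‖g‖₁` times a sum of covariance bounds, whatever the bandwidth
(`HasCovBound.integral_spectralEnergy_center_le`). The form with kernel `κ` has row sums of order
`b_T`. Fourth order cumulants at ordered times are at most `16 c⁴ a_m`, with `m` the largest of the
three gaps (`abs_cumulant_le`), so that `∑ k² a_k < ∞` makes their total `O(T)` and the variance of the
form `O(b_T / T)` (`integral_sq_quadForm_sub_le`). Together this is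
`eventually_integral_abs_quadForm_sub_le`.

*Negligibility of the estimated parameters.* Changing location and scale by `r` moves the standardized
observation by `O(r)` relative to its size. The conditions on `Ψ` turn this into a modulus of
continuity in which the discontinuity hyperplanes and the point singularities enter through functions
of the observation that are integrable under bounded densities (`IsAdmissible.exists_modulus`). Hence
the oscillation of `ψ` over such a neighbourhood of parameters is dominated by a single bounded
function of the observation with expectation `O(r^{1-τ})`, for any `τ > 0` (`exists_bracket`).

With high probability the estimated parameters lie in a cube of side `O(T^{-1/2})`. A grid of mesh
`T^{-1/2-η}` in this cube has `O(T^{1/8})` points. For a bounded function `f` with `E|f|` small, the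
autocovariances at lag `h` are at most a constant times `√(E|f|) √a_h` (`hasCovBound_of_bounded`), so the
expected spectral energy of a perturbation at a grid point is `O(T^{-3/16})`, and the sum over the grid
still tends to zero. Between grid points the bracket takes over: its fluctuations are treated in the
same way and its mean contributes `T · O(T^{-1/2-η})^2` up to the loss `τ`
(`exists_net_majorant`, `exists_perturbation_majorant`). Cauchy–Schwarz for the spectral energy carries
this over to the estimator, and the finitely many jumps of the kernel cost only the mean absolute
perturbation (`abs_quadForm_center_add_sub_le`, `eventually_measureReal_quadForm_sub_le`).
-/

namespace RobustCusum

/-! ### Covariance inequalities under strong mixing -/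

section Mixing

variable {Ω : Type*} {p : ℕ}

/-- In a covariance with a fixed `g`, a bounded `m`-measurable function may be replaced, up to the
factor `2 c`, by the indicator of the set on which `E(g - E g | m)` is nonnegative. -/
lemma exists_set_abs_cov_le {m : MeasurableSpace Ω} [m0 : MeasurableSpace Ω] (hm : m ≤ m0)
    (P : Measure Ω) [IsProbabilityMeasure P] {f g : Ω → ℝ} (hf : Measurable[m] f)
    (hg : Integrable g P) {c : ℝ} (hfc : ∀ ω, |f ω| ≤ c) :
    ∃ A, MeasurableSet[m] A ∧
      |∫ ω, f ω * g ω ∂P - (∫ ω, f ω ∂P) * ∫ ω, g ω ∂P| ≤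
        2 * c * |∫ ω in A, g ω ∂P - P.real A * ∫ ω, g ω ∂P| := by
  set e := ∫ ω, g ω ∂P with he
  set g' : Ω → ℝ := fun ω => g ω - e with hg'
  have hg'i : Integrable g' P := hg.sub (integrable_const _)
  set h : Ω → ℝ := P[g' | m] with hh
  have hhm : Measurable[m] h := (stronglyMeasurable_condExp (m := m)).measurable
  have hhi : Integrable h P := integrable_condExp
  set A : Set Ω := {ω | 0 ≤ h ω} with hA
  have hAm : MeasurableSet[m] A := hhm measurableSet_Ici
  have hfm0 : Measurable f := hf.mono hm le_rfl
  have hfi : Integrable f P := Integrable.of_bound hfm0.aestronglyMeasurable c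
    (Eventually.of_forall fun ω => by simpa using hfc ω)
  refine ⟨A, hAm, ?_⟩
  have hc : 0 ≤ c := by
    obtain ⟨ω⟩ := P.nonempty_of_neZero
    exact (abs_nonneg _).trans (hfc ω)
  have hfg : Integrable (fun ω => f ω * g' ω) P :=
    hg'i.bdd_mul hfm0.aestronglyMeasurable (Eventually.of_forall fun ω => by simpa using hfc ω)
  have hfh : Integrable (fun ω => f ω * h ω) P :=
    hhi.bdd_mul hfm0.aestronglyMeasurable (Eventually.of_forall fun ω => by simpa using hfc ω)
  have hfg0 : Integrable (fun ω => f ω * g ω) P :=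
    hg.bdd_mul hfm0.aestronglyMeasurable (Eventually.of_forall fun ω => by simpa using hfc ω)
  have h1 : ∫ ω, f ω * g ω ∂P - (∫ ω, f ω ∂P) * e = ∫ ω, f ω * g' ω ∂P := by
    have : (fun ω => f ω * g' ω) = fun ω => f ω * g ω - f ω * e := by
      funext ω; simp only [hg']; ring
    rw [this, integral_sub hfg0 (hfi.mul_const e), integral_mul_const]
  have h2 : ∫ ω, f ω * g' ω ∂P = ∫ ω, f ω * h ω ∂P := by
    rw [← integral_condExp hm (f := fun ω => f ω * g' ω)]
    exact integral_congr_ae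
      (condExp_mul_of_stronglyMeasurable_left hf.stronglyMeasurable hfg hg'i)
  have h3 : |∫ ω, f ω * h ω ∂P| ≤ c * ∫ ω, |h ω| ∂P := by
    rw [← integral_const_mul]
    refine (abs_integral_le_integral_abs).trans (integral_mono hfh.abs (hhi.abs.const_mul c) ?_)
    intro ω
    simp only [abs_mul]
    exact mul_le_mul_of_nonneg_right (hfc ω) (abs_nonneg _)
  have h4 : ∫ ω, |h ω| ∂P = 2 * ∫ ω in A, h ω ∂P - ∫ ω, h ω ∂P := by
    have : (fun ω => |h ω|) = fun ω => 2 * A.indicator h ω - h ω := by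
      funext ω
      by_cases hω : ω ∈ A
      · rw [Set.indicator_of_mem hω, abs_of_nonneg hω]; ring
      · rw [Set.indicator_of_notMem hω, abs_of_neg (not_le.1 hω)]; ring
    rw [this, integral_sub ((hhi.indicator (hm _ hAm)).const_mul 2) hhi, integral_const_mul,
      integral_indicator (hm _ hAm)]
  have h5 : ∫ ω, h ω ∂P = 0 := by
    rw [integral_condExp hm, hg', integral_sub hg (integrable_const _)]; simp [he]
  have h6 : ∫ ω in A, h ω ∂P = ∫ ω in A, g ω ∂P - P.real A * e := by
    rw [setIntegral_condExp hm hg'i hAm, hg', integral_sub hg.integrableOn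
      (integrable_const _).integrableOn]
    simp
  rw [h1, h2]
  refine h3.trans ?_
  rw [h4, h5, h6, sub_zero]
  have := le_abs_self (∫ ω in A, g ω ∂P - P.real A * e)
  nlinarith

variable {X : ℕ → Ω → EuclideanSpace ℝ (Fin p)}

lemma measurable_pastSigma {i n : ℕ} (h : i ≤ n) : Measurable[pastSigma X n] (X i) :=
  (comap_measurable (X i)).mono
    (le_iSup₂ (f := fun i (_ : i ∈ Set.Iic n) => MeasurableSpace.comap (X i) inferInstance) i h)
    le_rfl

lemma measurable_futureSigma {i n : ℕ} (h : n ≤ i) : Measurable[futureSigma X n] (X i) :=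
  (comap_measurable (X i)).mono
    (le_iSup₂ (f := fun i (_ : i ∈ Set.Ici n) => MeasurableSpace.comap (X i) inferInstance) i h)
    le_rfl

variable [MeasurableSpace Ω] {P : Measure Ω}

lemma pastSigma_le (hX : ∀ t, Measurable (X t)) (n : ℕ) :
    pastSigma X n ≤ ‹MeasurableSpace Ω› :=
  iSup₂_le fun i _ => (hX i).comap_le

lemma futureSigma_le (hX : ∀ t, Measurable (X t)) (n : ℕ) :
    futureSigma X n ≤ ‹MeasurableSpace Ω› :=
  iSup₂_le fun i _ => (hX i).comap_le

/-- Strict stationarity gives the invariance of pairwise moments under a common shift. -/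
lemma IsStrictlyStationary.integral_eq (hX : ∀ t, Measurable (X t))
    (hstat : IsStrictlyStationary X P) {F : (ℕ → EuclideanSpace ℝ (Fin p)) → ℝ}
    (hF : Measurable F) (h : ℕ) :
    ∫ ω, F (fun t => X (t + h) ω) ∂P = ∫ ω, F (fun t => X t ω) ∂P := by
  have m1 : Measurable fun ω (t : ℕ) => X (t + h) ω := measurable_pi_lambda _ fun t => hX _
  have m2 : Measurable fun ω (t : ℕ) => X t ω := measurable_pi_lambda _ fun t => hX _
  rw [← integral_map (f := F) m1.aemeasurable hF.aestronglyMeasurable, hstat h,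
    integral_map m2.aemeasurable hF.aestronglyMeasurable]

variable [IsProbabilityMeasure P]

lemma mixingCoeff_bddAbove (X : ℕ → Ω → EuclideanSpace ℝ (Fin p)) (k : ℕ) :
    BddAbove {r : ℝ | ∃ (n : ℕ) (A B : Set Ω), MeasurableSet[pastSigma X n] A ∧
    MeasurableSet[futureSigma X (n + k)] B ∧ r = |P.real (A ∩ B) - P.real A * P.real B|} := by
  refine ⟨1, ?_⟩
  rintro _ ⟨n, A, B, -, -, rfl⟩
  have h1 : P.real (A ∩ B) ≤ 1 := measureReal_le_one
  have h2 : P.real A ≤ 1 := measureReal_le_one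
  have h3 : P.real B ≤ 1 := measureReal_le_one
  have h4 : 0 ≤ P.real (A ∩ B) := measureReal_nonneg
  have h5 : 0 ≤ P.real A := measureReal_nonneg
  have h6 : 0 ≤ P.real B := measureReal_nonneg
  rw [abs_le]
  constructor <;> nlinarith

lemma abs_sub_le_mixingCoeff {n k : ℕ} {A B : Set Ω} (hA : MeasurableSet[pastSigma X n] A)
    (hB : MeasurableSet[futureSigma X (n + k)] B) :
    |P.real (A ∩ B) - P.real A * P.real B| ≤ mixingCoeff X P k :=
  le_csSup (mixingCoeff_bddAbove X k) ⟨n, A, B, hA, hB, rfl⟩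

lemma mixingCoeff_nonneg (k : ℕ) : 0 ≤ mixingCoeff X P k :=
  (abs_nonneg _).trans (abs_sub_le_mixingCoeff (n := 0) (A := ∅) (B := ∅)
    (@MeasurableSet.empty _ (pastSigma X 0)) (@MeasurableSet.empty _ (futureSigma X (0 + k))))

/-- The covariance inequality for bounded functions of the past and the future. -/
lemma abs_cov_le_mixingCoeff (hX : ∀ t, Measurable (X t)) {n k : ℕ} {f g : Ω → ℝ}
    (hf : Measurable[pastSigma X n] f) (hg : Measurable[futureSigma X (n + k)] g) {c d : ℝ}
    (hfc : ∀ ω, |f ω| ≤ c) (hgd : ∀ ω, |g ω| ≤ d) :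
    |∫ ω, f ω * g ω ∂P - (∫ ω, f ω ∂P) * ∫ ω, g ω ∂P| ≤ 4 * c * d * mixingCoeff X P k := by
  have hp := pastSigma_le hX n
  have hfu := futureSigma_le hX (n + k)
  have hgi : Integrable g P := Integrable.of_bound (hg.mono hfu le_rfl).aestronglyMeasurable d
    (Eventually.of_forall fun ω => by simpa using hgd ω)
  obtain ⟨A, hA, h1⟩ := exists_set_abs_cov_le hp P hf hgi hfc
  obtain ⟨B, hB, h2⟩ := exists_set_abs_cov_le hfu P hg
    (g := A.indicator fun _ => (1 : ℝ)) ((integrable_const _).indicator (hp _ hA)) hgd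
  have h3 := abs_sub_le_mixingCoeff (P := P) hA hB
  have e1 : ∫ ω in B, A.indicator (fun _ => (1 : ℝ)) ω ∂P = P.real (A ∩ B) := by
    rw [integral_indicator (hp _ hA), Measure.restrict_restrict (hp _ hA)]; simp
  have e2 : ∫ ω, A.indicator (fun _ => (1 : ℝ)) ω ∂P = P.real A := by
    rw [integral_indicator (hp _ hA)]; simp
  have e3 : ∫ ω, g ω * A.indicator (fun _ => (1 : ℝ)) ω ∂P = ∫ ω in A, g ω ∂P := by
    rw [← integral_indicator (hp _ hA)]
    congr 1; funext ω
    by_cases hω : ω ∈ A <;> simp [hω]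
  rw [e1, e2, e3] at h2
  obtain ⟨ω⟩ := P.nonempty_of_neZero
  have hc : 0 ≤ c := (abs_nonneg _).trans (hfc ω)
  have hd : 0 ≤ d := (abs_nonneg _).trans (hgd ω)
  calc _ ≤ 2 * c * |∫ ω in A, g ω ∂P - P.real A * ∫ ω, g ω ∂P| := h1
    _ ≤ 2 * c * (2 * d * mixingCoeff X P k) := by
        gcongr
        rw [mul_comm (P.real A)]
        refine h2.trans ?_
        gcongr
        rwa [mul_comm (P.real B)]
    _ = _ := by ring

end Mixing

/-! ### Quadratic forms with a stationary kernel -/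

section QuadForm

/-- The bilinear form `T⁻¹ ∑_{i,j} u_i v_j κ(|i - j| / b)`. -/
noncomputable def quadForm (κ : ℝ → ℝ) (b : ℝ) (T : ℕ) (u v : ℕ → ℝ) : ℝ :=
  (T : ℝ)⁻¹ * ∑ i ∈ Finset.range T, ∑ j ∈ Finset.range T,
    u i * v j * κ (|(i : ℝ) - (j : ℝ)| / b)

/-- The mean of `v_0, …, v_{T-1}`. -/
noncomputable def sampleMean (T : ℕ) (v : ℕ → ℝ) : ℝ := (T : ℝ)⁻¹ * ∑ i ∈ Finset.range T, v i

/-- The sequence centred at its sample mean. -/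
noncomputable def center (T : ℕ) (v : ℕ → ℝ) : ℕ → ℝ := fun i => v i - sampleMean T v

/-- The kernel `x ↦ ∫ g(ξ) cos(2π x ξ) dξ` with spectral density `g`. -/
noncomputable def cosKernel (g : ℝ → ℝ) (x : ℝ) : ℝ := ∫ ξ, g ξ * Real.cos (2 * Real.pi * x * ξ)

lemma natCast_dist (i j : ℕ) : |(i : ℝ) - (j : ℝ)| = (Nat.dist i j : ℝ) := by
  rcases le_total i j with h | h
  · rw [Nat.dist_eq_sub_of_le h, Nat.cast_sub h, abs_of_nonpos (by simpa using h)]; ring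
  · rw [Nat.dist_eq_sub_of_le_right h, Nat.cast_sub h, abs_of_nonneg (by simpa using h)]

/-- Every lag occurs at most twice in a row. -/
lemma sum_dist_le {β : ℕ → ℝ} (hβ : ∀ h, 0 ≤ β h) {T i : ℕ} (hi : i < T) :
    ∑ j ∈ Finset.range T, β (Nat.dist i j) ≤ 2 * ∑ h ∈ Finset.range T, β h := by
  rw [two_mul, ← Finset.sum_filter_add_sum_filter_not (Finset.range T) (fun j => j ≤ i)]
  refine add_le_add ?_ ?_
  · have : ∑ j ∈ (Finset.range T).filter (fun j => j ≤ i), β (Nat.dist i j)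
        = ∑ h ∈ ((Finset.range T).filter (fun j => j ≤ i)).image (fun j => i - j), β h := by
      rw [Finset.sum_image]
      · refine Finset.sum_congr rfl fun j hj => ?_
        rw [Nat.dist_eq_sub_of_le_right (Finset.mem_filter.1 hj).2]
      · intro x hx y hy hxy
        simp only [Finset.coe_filter, Finset.mem_range, Set.mem_ofPred_eq] at hx hy hxy
        omega
    rw [this]
    refine Finset.sum_le_sum_of_subset_of_nonneg ?_ fun _ _ _ => hβ _
    intro x hx
    simp only [Finset.mem_image, Finset.mem_filter, Finset.mem_range] at hx ⊢
    omega
  · have : ∑ j ∈ (Finset.range T).filter (fun j => ¬ j ≤ i), β (Nat.dist i j)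
        = ∑ h ∈ ((Finset.range T).filter (fun j => ¬ j ≤ i)).image (fun j => j - i), β h := by
      rw [Finset.sum_image]
      · refine Finset.sum_congr rfl fun j hj => ?_
        rw [Nat.dist_eq_sub_of_le (by have := (Finset.mem_filter.1 hj).2; omega)]
      · intro x hx y hy hxy
        simp only [Finset.coe_filter, Finset.mem_range, Set.mem_ofPred_eq] at hx hy hxy
        omega
    rw [this]
    refine Finset.sum_le_sum_of_subset_of_nonneg ?_ fun _ _ _ => hβ _
    intro x hx
    simp only [Finset.mem_image, Finset.mem_filter, Finset.mem_range] at hx ⊢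
    omega

lemma sum_dist_le_tsum {β : ℕ → ℝ} (hβ : ∀ h, 0 ≤ β h) (hs : Summable β) {T i : ℕ} (hi : i < T) :
    ∑ j ∈ Finset.range T, β (Nat.dist i j) ≤ 2 * ∑' h, β h :=
  (sum_dist_le hβ hi).trans (by gcongr; exact hs.sum_le_tsum _ fun _ _ => hβ _)

variable {κ : ℝ → ℝ} {b : ℝ} {T : ℕ}

lemma quadForm_symm (u v : ℕ → ℝ) : quadForm κ b T u v = quadForm κ b T v u := by
  unfold quadForm
  rw [Finset.sum_comm]
  simp only [abs_sub_comm, mul_comm]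

lemma quadForm_add_left (u v w : ℕ → ℝ) :
    quadForm κ b T (u + v) w = quadForm κ b T u w + quadForm κ b T v w := by
  simp only [quadForm, ← mul_add, ← Finset.sum_add_distrib, Pi.add_apply, add_mul]

lemma quadForm_smul_left (c : ℝ) (u w : ℕ → ℝ) :
    quadForm κ b T (c • u) w = c * quadForm κ b T u w := by
  simp only [quadForm, Pi.smul_apply, smul_eq_mul, Finset.mul_sum]
  refine Finset.sum_congr rfl fun i _ => Finset.sum_congr rfl fun j _ => by ring

lemma quadForm_add_right (u v w : ℕ → ℝ) :
    quadForm κ b T u (v + w) = quadForm κ b T u v + quadForm κ b T u w := by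
  rw [quadForm_symm, quadForm_add_left, quadForm_symm v, quadForm_symm w]

lemma quadForm_smul_right (c : ℝ) (u w : ℕ → ℝ) :
    quadForm κ b T u (c • w) = c * quadForm κ b T u w := by
  rw [quadForm_symm, quadForm_smul_left, quadForm_symm]

lemma quadForm_add_kernel (κ₁ κ₂ : ℝ → ℝ) (u v : ℕ → ℝ) :
    quadForm (κ₁ + κ₂) b T u v = quadForm κ₁ b T u v + quadForm κ₂ b T u v := by
  simp only [quadForm, ← mul_add, ← Finset.sum_add_distrib, Pi.add_apply]

lemma center_add (u v : ℕ → ℝ) : center T (u + v) = center T u + center T v := by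
  funext i; simp [center, sampleMean, Finset.sum_add_distrib]; ring

lemma center_smul (c : ℝ) (v : ℕ → ℝ) : center T (c • v) = c • center T v := by
  funext i; simp [center, sampleMean, ← Finset.mul_sum]; ring

/-- Centring removes additive constants. For `T = 0` the sample mean has the junk value `0`, whence the
hypothesis. -/
lemma center_add_const (hT : T ≠ 0) (v : ℕ → ℝ) (c : ℝ) :
    center T (fun i => v i + c) = center T v := by
  funext i; simp [center, sampleMean, Finset.sum_add_distrib]; field_simp; ring

/-- Polarization of the estimator. -/
lemma quadForm_center_polarization (u v : ℕ → ℝ) :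
    quadForm κ b T (center T u) (center T v) =
      (quadForm κ b T (center T (u + v)) (center T (u + v)) -
        quadForm κ b T (center T (u + (-1 : ℝ) • v)) (center T (u + (-1 : ℝ) • v))) / 4 := by
  simp only [center_add, center_smul, quadForm_add_left, quadForm_add_right, quadForm_smul_left,
    quadForm_smul_right]
  rw [quadForm_symm (center T v) (center T u)]
  ring

/-! #### Kernels given by a spectral density -/

variable {g : ℝ → ℝ}

lemma integrable_mul_cos (hg : Integrable g) (x : ℝ) :
    Integrable fun ξ => g ξ * Real.cos (2 * Real.pi * x * ξ) :=
  hg.mul_bdd (c := 1) (by fun_prop)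
    (Eventually.of_forall fun ξ => by simpa using Real.abs_cos_le_one _)

lemma abs_cosKernel_le (g : ℝ → ℝ) (hg : Integrable g) (x : ℝ) :
    |cosKernel g x| ≤ ∫ ξ, |g ξ| := by
  refine (abs_integral_le_integral_abs).trans (integral_mono (integrable_mul_cos hg x).abs
    hg.abs fun ξ => ?_)
  simp only [abs_mul]
  exact mul_le_of_le_one_right (abs_nonneg _) (Real.abs_cos_le_one _)

lemma cosKernel_sub {g₁ g₂ : ℝ → ℝ} (h₁ : Integrable g₁) (h₂ : Integrable g₂) (x : ℝ) :
    cosKernel (g₁ - g₂) x = cosKernel g₁ x - cosKernel g₂ x := by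
  simp only [cosKernel, Pi.sub_apply, sub_mul]
  exact integral_sub (integrable_mul_cos h₁ x) (integrable_mul_cos h₂ x)

/-- The integrand of the spectral representation of `quadForm (cosKernel g)`: the real part of the
product of the finite Fourier transforms of `u` and `v`. -/
noncomputable def crossSpectrum (b : ℝ) (T : ℕ) (u v : ℕ → ℝ) (ξ : ℝ) : ℝ :=
  (∑ i ∈ Finset.range T, u i * Real.cos (2 * Real.pi * (i / b) * ξ)) *
    (∑ j ∈ Finset.range T, v j * Real.cos (2 * Real.pi * (j / b) * ξ)) +
  (∑ i ∈ Finset.range T, u i * Real.sin (2 * Real.pi * (i / b) * ξ)) *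
    (∑ j ∈ Finset.range T, v j * Real.sin (2 * Real.pi * (j / b) * ξ))

lemma crossSpectrum_eq (u v : ℕ → ℝ) (ξ : ℝ) :
    crossSpectrum b T u v ξ = ∑ i ∈ Finset.range T, ∑ j ∈ Finset.range T,
      u i * v j * Real.cos (2 * Real.pi * (|(i : ℝ) - (j : ℝ)| / b) * ξ) := by
  rw [crossSpectrum, Finset.sum_mul_sum, Finset.sum_mul_sum, ← Finset.sum_add_distrib]
  refine Finset.sum_congr rfl fun i _ => ?_
  rw [← Finset.sum_add_distrib]
  refine Finset.sum_congr rfl fun j _ => ?_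
  have : Real.cos (2 * Real.pi * (|(i : ℝ) - (j : ℝ)| / b) * ξ) =
      Real.cos (2 * Real.pi * (i / b) * ξ - 2 * Real.pi * (j / b) * ξ) := by
    rcases abs_choice ((i : ℝ) - j) with h | h
    · rw [h]; congr 1; ring
    · rw [h, ← Real.cos_neg]; congr 1; ring
  rw [this, Real.cos_sub]
  ring

lemma integrable_crossSpectrum (hg : Integrable g) (u v : ℕ → ℝ) :
    Integrable fun ξ => g ξ * crossSpectrum b T u v ξ := by
  simp only [crossSpectrum_eq, Finset.mul_sum]
  refine integrable_finsetSum _ fun i _ => integrable_finsetSum _ fun j _ => ?_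
  have := (integrable_mul_cos hg (|(i : ℝ) - (j : ℝ)| / b)).const_mul (u i * v j)
  refine this.congr (Eventually.of_forall fun ξ => ?_)
  simp only; ring

lemma quadForm_cosKernel (hg : Integrable g) (u v : ℕ → ℝ) :
    quadForm (cosKernel g) b T u v = (T : ℝ)⁻¹ * ∫ ξ, g ξ * crossSpectrum b T u v ξ := by
  simp only [crossSpectrum_eq, Finset.mul_sum, quadForm]
  rw [integral_finsetSum]
  · rw [Finset.mul_sum]
    refine Finset.sum_congr rfl fun i _ => ?_
    rw [integral_finsetSum]
    · rw [Finset.mul_sum]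
      refine Finset.sum_congr rfl fun j _ => ?_
      rw [cosKernel, ← integral_const_mul]
      congr 1
      refine integral_congr_ae (Eventually.of_forall fun ξ => ?_)
      simp only; ring
    · intro j _
      have := (integrable_mul_cos hg (|(i : ℝ) - (j : ℝ)| / b)).const_mul (u i * v j)
      refine this.congr (Eventually.of_forall fun ξ => ?_)
      simp only; ring
  · intro i _
    refine integrable_finsetSum _ fun j _ => ?_
    have := (integrable_mul_cos hg (|(i : ℝ) - (j : ℝ)| / b)).const_mul (u i * v j)
    refine this.congr (Eventually.of_forall fun ξ => ?_)
    simp only; ring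

/-- The positive semidefinite majorant of the quadratic form with spectral density `g`. -/
noncomputable def spectralEnergy (g : ℝ → ℝ) (b : ℝ) (T : ℕ) (v : ℕ → ℝ) : ℝ :=
  quadForm (cosKernel fun ξ => |g ξ|) b T v v

lemma crossSpectrum_self_nonneg (v : ℕ → ℝ) (ξ : ℝ) : 0 ≤ crossSpectrum b T v v ξ := by
  unfold crossSpectrum; exact add_nonneg (mul_self_nonneg _) (mul_self_nonneg _)

lemma spectralEnergy_nonneg (hg : Integrable g) (v : ℕ → ℝ) : 0 ≤ spectralEnergy g b T v := by
  rw [spectralEnergy, quadForm_cosKernel hg.abs]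
  exact mul_nonneg (by positivity) (integral_nonneg fun ξ =>
    mul_nonneg (abs_nonneg _) (crossSpectrum_self_nonneg _ _))

/-- The Cauchy–Schwarz inequality in the spectral domain, with a free weight `t`. -/
lemma abs_two_mul_quadForm_cosKernel_le (hg : Integrable g) (u v : ℕ → ℝ) {t : ℝ} (ht : 0 < t) :
    |2 * quadForm (cosKernel g) b T u v| ≤
      t * spectralEnergy g b T u + t⁻¹ * spectralEnergy g b T v := by
  have h : ∀ ξ, |2 * (g ξ * crossSpectrum b T u v ξ)| ≤
      t * (|g ξ| * crossSpectrum b T u u ξ) + t⁻¹ * (|g ξ| * crossSpectrum b T v v ξ) := by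
    intro ξ
    rw [mul_left_comm, abs_mul, mul_left_comm t, mul_left_comm t⁻¹, ← mul_add]
    refine mul_le_mul_of_nonneg_left ?_ (abs_nonneg _)
    unfold crossSpectrum
    set a := ∑ i ∈ Finset.range T, u i * Real.cos (2 * Real.pi * (i / b) * ξ)
    set a' := ∑ i ∈ Finset.range T, u i * Real.sin (2 * Real.pi * (i / b) * ξ)
    set c := ∑ i ∈ Finset.range T, v i * Real.cos (2 * Real.pi * (i / b) * ξ)
    set c' := ∑ i ∈ Finset.range T, v i * Real.sin (2 * Real.pi * (i / b) * ξ)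
    have key : ∀ x y : ℝ, |2 * (x * y)| ≤ t * (x * x) + t⁻¹ * (y * y) := by
      intro x y
      have h1 : 0 ≤ t⁻¹ * (t * x - y) ^ 2 := by positivity
      have h2 : 0 ≤ t⁻¹ * (t * x + y) ^ 2 := by positivity
      have e1 : t⁻¹ * (t * x - y) ^ 2 = t * (x * x) + t⁻¹ * (y * y) - 2 * (x * y) := by
        field_simp; ring
      have e2 : t⁻¹ * (t * x + y) ^ 2 = t * (x * x) + t⁻¹ * (y * y) + 2 * (x * y) := by
        field_simp; ring
      rw [abs_le]; constructor <;> linarith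
    have h1 := key a c
    have h2 := key a' c'
    have h3 := abs_add_le (2 * (a * c)) (2 * (a' * c'))
    rw [mul_add]
    linarith
  simp only [spectralEnergy]
  rw [quadForm_cosKernel hg, quadForm_cosKernel hg.abs, quadForm_cosKernel hg.abs]
  have i0 := integrable_crossSpectrum (b := b) (T := T) hg u v
  have i1 := integrable_crossSpectrum (b := b) (T := T) hg.abs u u
  have i2 := integrable_crossSpectrum (b := b) (T := T) hg.abs v v
  have : |∫ ξ, 2 * (g ξ * crossSpectrum b T u v ξ)| ≤
      t * (∫ ξ, |g ξ| * crossSpectrum b T u u ξ) + t⁻¹ * ∫ ξ, |g ξ| * crossSpectrum b T v v ξ := by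
    rw [← integral_const_mul, ← integral_const_mul, ← integral_add (i1.const_mul t)
      (i2.const_mul t⁻¹)]
    exact (abs_integral_le_integral_abs).trans (integral_mono (i0.const_mul 2).abs
      ((i1.const_mul t).add (i2.const_mul t⁻¹)) h)
  rw [integral_const_mul] at this
  have hT : (0 : ℝ) ≤ (T : ℝ)⁻¹ := by positivity
  calc _ = (T : ℝ)⁻¹ * |2 * ∫ ξ, g ξ * crossSpectrum b T u v ξ| := by
        rw [mul_left_comm, abs_mul, abs_of_nonneg hT]
    _ ≤ _ := mul_le_mul_of_nonneg_left this hT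
    _ = _ := by ring

lemma abs_quadForm_cosKernel_self_le (hg : Integrable g) (v : ℕ → ℝ) :
    |quadForm (cosKernel g) b T v v| ≤ spectralEnergy g b T v := by
  have := abs_two_mul_quadForm_cosKernel_le (b := b) (T := T) hg v v one_pos
  rw [abs_mul, abs_two] at this
  linarith

lemma spectralEnergy_add_le (hg : Integrable g) (u v : ℕ → ℝ) :
    spectralEnergy g b T (u + v) ≤ 2 * spectralEnergy g b T u + 2 * spectralEnergy g b T v := by
  have h := abs_two_mul_quadForm_cosKernel_le (b := b) (T := T) hg.abs u v one_pos
  have h' := (abs_le.1 h).2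
  simp only [spectralEnergy, abs_abs] at h' ⊢
  rw [quadForm_add_left, quadForm_add_right, quadForm_add_right, quadForm_symm v u]
  linarith

lemma spectralEnergy_le_sq_sum (hg : Integrable g) (v : ℕ → ℝ) :
    spectralEnergy g b T v ≤
      (∫ ξ, |g ξ|) * ((T : ℝ)⁻¹ * (∑ i ∈ Finset.range T, |v i|) ^ 2) := by
  unfold spectralEnergy quadForm
  rw [mul_left_comm, sq, Finset.sum_mul_sum]
  refine mul_le_mul_of_nonneg_left ?_ (by positivity : (0 : ℝ) ≤ (T : ℝ)⁻¹)
  rw [Finset.mul_sum]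
  refine Finset.sum_le_sum fun i _ => ?_
  rw [Finset.mul_sum]
  refine Finset.sum_le_sum fun j _ => ?_
  refine (le_abs_self _).trans ?_
  rw [abs_mul, abs_mul, mul_comm]
  refine mul_le_mul_of_nonneg_right ?_ (by positivity)
  simpa using abs_cosKernel_le _ hg.abs _

lemma sum_abs_center_le (v : ℕ → ℝ) :
    ∑ i ∈ Finset.range T, |center T v i| ≤ 2 * ∑ i ∈ Finset.range T, |v i| := by
  rcases Nat.eq_zero_or_pos T with rfl | hT
  · simp
  have hT' : (T : ℝ) ≠ 0 := by positivity
  have h1 : |sampleMean T v| ≤ (T : ℝ)⁻¹ * ∑ i ∈ Finset.range T, |v i| := by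
    rw [sampleMean, abs_mul, abs_of_nonneg (by positivity : (0 : ℝ) ≤ (T : ℝ)⁻¹)]
    gcongr
    exact Finset.abs_sum_le_sum_abs _ _
  calc _ ≤ ∑ i ∈ Finset.range T, (|v i| + (T : ℝ)⁻¹ * ∑ i ∈ Finset.range T, |v i|) :=
        Finset.sum_le_sum fun i _ => (abs_sub _ _).trans (by gcongr)
    _ = _ := by
        rw [Finset.sum_add_distrib, Finset.sum_const, Finset.card_range, nsmul_eq_mul,
          mul_inv_cancel_left₀ hT', two_mul]

/-! #### Row sums -/

/-- If the kernel decays quadratically, its row sums are of the order of the bandwidth. -/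
lemma sum_kernel_le {C : ℝ} (hC : 0 ≤ C) (hκ : ∀ x, |κ x| ≤ C / (1 + x ^ 2)) (hb : 2 ≤ b) {i : ℕ}
    (hi : i < T) :
    ∑ j ∈ Finset.range T, |κ (|(i : ℝ) - (j : ℝ)| / b)| ≤ 8 * C * b := by
  have key : ∀ n : ℕ, ∑ h ∈ Finset.range n, C / (1 + ((h : ℝ) / b) ^ 2) ≤
      2 * C * b ^ 2 * (1 / (b - 1) - 1 / (b - 1 + n)) := by
    intro n
    induction n with
    | zero => simp
    | succ n ih =>
      rw [Finset.sum_range_succ]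
      have hn : (0 : ℝ) ≤ n := n.cast_nonneg
      have h1 : C / (1 + ((n : ℝ) / b) ^ 2) ≤
          2 * C * b ^ 2 * (1 / (b - 1 + n) - 1 / (b - 1 + (n + 1 : ℕ))) := by
        have p1 : 0 < b - 1 + n := by linarith
        have p2 : 0 < b - 1 + (n + 1 : ℝ) := by linarith
        have p3 : 0 < b := by linarith
        have e1 : C / (1 + ((n : ℝ) / b) ^ 2) = C * b ^ 2 * (1 / (b ^ 2 + n ^ 2)) := by
          field_simp
        have e2 : 2 * C * b ^ 2 * (1 / (b - 1 + n) - 1 / (b - 1 + (n + 1 : ℕ))) =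
            C * b ^ 2 * (2 / ((b - 1 + n) * (b - 1 + (n + 1)))) := by
          push_cast; field_simp; ring
        rw [e1, e2]
        refine mul_le_mul_of_nonneg_left ?_ (by positivity)
        rw [div_le_div_iff₀ (by positivity) (by positivity)]
        nlinarith [sq_nonneg (b - n)]
      linarith
  have h0 : ∀ n : ℕ, ∑ h ∈ Finset.range n, C / (1 + ((h : ℝ) / b) ^ 2) ≤ 4 * C * b := by
    intro n
    refine (key n).trans ?_
    have hn : (0 : ℝ) ≤ n := n.cast_nonneg
    have p1 : 0 < b - 1 := by linarith
    have h2 : 0 ≤ 1 / (b - 1 + n) := by positivity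
    calc 2 * C * b ^ 2 * (1 / (b - 1) - 1 / (b - 1 + n)) ≤ 2 * C * b ^ 2 * (1 / (b - 1)) := by
          gcongr; linarith
      _ ≤ 2 * C * b ^ 2 * (2 / b) := by
          gcongr 2 * C * b ^ 2 * ?_
          rw [div_le_div_iff₀ p1 (by linarith)]; linarith
      _ = 4 * C * b := by field_simp; ring
  calc _ ≤ ∑ j ∈ Finset.range T, C / (1 + ((Nat.dist i j : ℝ) / b) ^ 2) := by
        refine Finset.sum_le_sum fun j _ => ?_
        rw [natCast_dist]; exact hκ _
    _ ≤ 2 * ∑ h ∈ Finset.range T, C / (1 + ((h : ℝ) / b) ^ 2) :=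
        sum_dist_le (β := fun h => C / (1 + ((h : ℝ) / b) ^ 2)) (fun h => by positivity) hi
    _ ≤ _ := by linarith [h0 T]

end QuadForm

/-! ### Second moments of quadratic forms -/

section SecondMoments

variable {Ω : Type*} [MeasurableSpace Ω] {P : Measure Ω}

/-- A uniformly bounded process whose second moments `E u_i u_j` are dominated by a summable function
`β` of the lag. -/
structure HasCovBound (P : Measure Ω) (u : ℕ → Ω → ℝ) (β : ℕ → ℝ) : Prop where
  measurable : ∀ i, Measurable (u i)
  bounded : ∃ c, ∀ i ω, |u i ω| ≤ c
  nonneg : ∀ h, 0 ≤ β h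
  summable : Summable β
  abs_integral_le : ∀ i j, |∫ ω, u i ω * u j ω ∂P| ≤ β (Nat.dist i j)

lemma integrable_mul_of_bounded [IsFiniteMeasure P] {u v : ℕ → Ω → ℝ} (hu : ∀ i, Measurable (u i))
    (hv : ∀ i, Measurable (v i)) (hub : ∃ c, ∀ i ω, |u i ω| ≤ c) (hvb : ∃ c, ∀ i ω, |v i ω| ≤ c)
    (i j : ℕ) : Integrable (fun ω => u i ω * v j ω) P := by
  obtain ⟨c, hc⟩ := hub
  obtain ⟨d, hd⟩ := hvb
  refine Integrable.of_bound ((hu i).mul (hv j)).aestronglyMeasurable (c * d)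
    (Eventually.of_forall fun ω => ?_)
  rw [Real.norm_eq_abs, abs_mul]
  exact mul_le_mul (hc i ω) (hd j ω) (abs_nonneg _) ((abs_nonneg _).trans (hc i ω))

lemma integrable_quadForm [IsFiniteMeasure P] {u v : ℕ → Ω → ℝ} (hu : ∀ i, Measurable (u i))
    (hv : ∀ i, Measurable (v i)) (hub : ∃ c, ∀ i ω, |u i ω| ≤ c) (hvb : ∃ c, ∀ i ω, |v i ω| ≤ c)
    (κ : ℝ → ℝ) (b : ℝ) (T : ℕ) :
    Integrable (fun ω => quadForm κ b T (fun i => u i ω) (fun i => v i ω)) P := by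
  refine Integrable.const_mul (integrable_finsetSum _ fun i _ => integrable_finsetSum _ fun j _ => ?_) _
  exact (integrable_mul_of_bounded hu hv hub hvb i j).mul_const _

lemma measurable_center {u : ℕ → Ω → ℝ} (hu : ∀ i, Measurable (u i)) (T : ℕ) (i : ℕ) :
    Measurable fun ω => center T (fun i => u i ω) i :=
  (hu i).sub (measurable_const.mul (Finset.measurable_sum _ fun j _ => hu j))

lemma abs_sampleMean_le {v : ℕ → ℝ} {c : ℝ} (hv : ∀ i, |v i| ≤ c) (T : ℕ) :
    |sampleMean T v| ≤ c := by
  have hc : 0 ≤ c := (abs_nonneg _).trans (hv 0)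
  rcases Nat.eq_zero_or_pos T with rfl | hT
  · simpa [sampleMean] using hc
  have hT' : (T : ℝ) ≠ 0 := by positivity
  rw [sampleMean, abs_mul, abs_of_nonneg (by positivity : (0 : ℝ) ≤ (T : ℝ)⁻¹)]
  calc _ ≤ (T : ℝ)⁻¹ * ∑ i ∈ Finset.range T, c := by
        gcongr
        exact (Finset.abs_sum_le_sum_abs _ _).trans (Finset.sum_le_sum fun i _ => hv i)
    _ = c := by simp [hT']

lemma abs_center_le {v : ℕ → ℝ} {c : ℝ} (hv : ∀ i, |v i| ≤ c) (T i : ℕ) :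
    |center T v i| ≤ 2 * c := by
  have := abs_sub (v i) (sampleMean T v)
  have h2 := hv i
  have h3 := abs_sampleMean_le hv T
  rw [center]; linarith

lemma bounded_center {Ω : Type*} {u : ℕ → Ω → ℝ} (hub : ∃ c, ∀ i ω, |u i ω| ≤ c) (T : ℕ) :
    ∃ c, ∀ i ω, |center T (fun i => u i ω) i| ≤ c := by
  obtain ⟨c, hc⟩ := hub
  exact ⟨2 * c, fun i ω => abs_center_le (fun i => hc i ω) T i⟩

namespace HasCovBound

variable {u : ℕ → Ω → ℝ} {β : ℕ → ℝ}

lemma tsum_nonneg (h : HasCovBound P u β) : 0 ≤ ∑' k, β k := _root_.tsum_nonneg h.nonneg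

lemma integrable_mul [IsFiniteMeasure P] (h : HasCovBound P u β) (i j : ℕ) :
    Integrable (fun ω => u i ω * u j ω) P :=
  integrable_mul_of_bounded h.measurable h.measurable h.bounded h.bounded i j

lemma sum_abs_row_le (h : HasCovBound P u β) {T i : ℕ} (hi : i < T) :
    ∑ j ∈ Finset.range T, |∫ ω, u i ω * u j ω ∂P| ≤ 2 * ∑' k, β k :=
  (Finset.sum_le_sum fun j _ => h.abs_integral_le i j).trans
    (sum_dist_le_tsum h.nonneg h.summable hi)

lemma sum_abs_le (h : HasCovBound P u β) (T : ℕ) :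
    ∑ i ∈ Finset.range T, ∑ j ∈ Finset.range T, |∫ ω, u i ω * u j ω ∂P| ≤
      T * (2 * ∑' k, β k) := by
  calc _ ≤ ∑ i ∈ Finset.range T, (2 * ∑' k, β k) :=
        Finset.sum_le_sum fun i hi => h.sum_abs_row_le (Finset.mem_range.1 hi)
    _ = _ := by simp

variable [IsFiniteMeasure P]

lemma integral_sq_sum_le (h : HasCovBound P u β) {a : ℕ → ℝ} {c : ℝ} (T : ℕ)
    (ha : ∀ i < T, |a i| ≤ c) :
    ∫ ω, (∑ i ∈ Finset.range T, a i * u i ω) ^ 2 ∂P ≤ c ^ 2 * (T * (2 * ∑' k, β k)) := by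
  have e : ∀ ω, (∑ i ∈ Finset.range T, a i * u i ω) ^ 2 =
      ∑ i ∈ Finset.range T, ∑ j ∈ Finset.range T, (a i * a j) * (u i ω * u j ω) := by
    intro ω
    rw [sq, Finset.sum_mul_sum]
    exact Finset.sum_congr rfl fun i _ => Finset.sum_congr rfl fun j _ => by ring
  simp only [e]
  rw [integral_finsetSum _ fun i _ => integrable_finsetSum _ fun j _ =>
    (h.integrable_mul i j).const_mul _]
  refine le_trans ?_ (mul_le_mul_of_nonneg_left (h.sum_abs_le T) (sq_nonneg c))
  rw [Finset.mul_sum]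
  refine Finset.sum_le_sum fun i hi => ?_
  rw [integral_finsetSum _ fun j _ => (h.integrable_mul i j).const_mul _, Finset.mul_sum]
  refine Finset.sum_le_sum fun j hj => ?_
  rw [integral_const_mul]
  refine (le_abs_self _).trans ?_
  rw [abs_mul, abs_mul, sq]
  have h1 := ha i (Finset.mem_range.1 hi)
  have h2 := ha j (Finset.mem_range.1 hj)
  have : 0 ≤ c := (abs_nonneg _).trans h1
  gcongr

lemma integral_sq_sampleMean_le (h : HasCovBound P u β) {T : ℕ} (hT : T ≠ 0) :
    T * ∫ ω, sampleMean T (fun i => u i ω) ^ 2 ∂P ≤ 2 * ∑' k, β k := by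
  have hT' : (T : ℝ) ≠ 0 := by exact_mod_cast hT
  have := h.integral_sq_sum_le (a := fun _ => 1) (c := 1) T (by simp)
  simp only [one_mul, one_pow] at this
  simp only [sampleMean, mul_pow]
  rw [integral_const_mul]
  calc _ = (T : ℝ)⁻¹ * ∫ ω, (∑ i ∈ Finset.range T, u i ω) ^ 2 ∂P := by field_simp
    _ ≤ (T : ℝ)⁻¹ * (T * (2 * ∑' k, β k)) := by gcongr
    _ = _ := by field_simp

lemma abs_integral_quadForm_le (h : HasCovBound P u β) {κ : ℝ → ℝ} {K : ℝ} (hκ : ∀ x, |κ x| ≤ K)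
    (b : ℝ) {T : ℕ} (hT : T ≠ 0) :
    |∫ ω, quadForm κ b T (fun i => u i ω) (fun i => u i ω) ∂P| ≤ K * (2 * ∑' k, β k) := by
  have hT' : (T : ℝ) ≠ 0 := by exact_mod_cast hT
  unfold quadForm
  rw [integral_const_mul, integral_finsetSum _ fun i _ => integrable_finsetSum _ fun j _ =>
    (h.integrable_mul i j).mul_const _, abs_mul, abs_of_nonneg (by positivity : (0 : ℝ) ≤ (T : ℝ)⁻¹)]
  have : |∑ i ∈ Finset.range T, ∫ ω, ∑ j ∈ Finset.range T,
      u i ω * u j ω * κ (|(i : ℝ) - (j : ℝ)| / b) ∂P| ≤ K * (T * (2 * ∑' k, β k)) := by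
    refine le_trans ?_ (mul_le_mul_of_nonneg_left (h.sum_abs_le T)
      ((abs_nonneg _).trans (hκ 0)))
    refine (Finset.abs_sum_le_sum_abs _ _).trans ?_
    rw [Finset.mul_sum]
    refine Finset.sum_le_sum fun i hi => ?_
    rw [integral_finsetSum _ fun j _ => (h.integrable_mul i j).mul_const _, Finset.mul_sum]
    refine (Finset.abs_sum_le_sum_abs _ _).trans (Finset.sum_le_sum fun j hj => ?_)
    rw [integral_mul_const, abs_mul, mul_comm]
    exact mul_le_mul_of_nonneg_right (hκ _) (abs_nonneg _)
  calc _ ≤ (T : ℝ)⁻¹ * (K * (T * (2 * ∑' k, β k))) := by gcongr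
    _ = _ := by field_simp

/-- The expected spectral energy of the centred process is bounded, uniformly in the bandwidth and
the sample size. -/
lemma integral_spectralEnergy_center_le (h : HasCovBound P u β) {g : ℝ → ℝ} (hg : Integrable g)
    (b : ℝ) {T : ℕ} (hT : T ≠ 0) :
    ∫ ω, spectralEnergy g b T (center T fun i => u i ω) ∂P ≤
      8 * (∫ ξ, |g ξ|) * ∑' k, β k := by
  have hT' : (T : ℝ) ≠ 0 := by exact_mod_cast hT
  have hK : 0 ≤ ∫ ξ, |g ξ| := integral_nonneg fun _ => abs_nonneg _
  have h1 : ∀ ω, spectralEnergy g b T (center T fun i => u i ω) ≤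
      2 * spectralEnergy g b T (fun i => u i ω) +
      2 * ((∫ ξ, |g ξ|) * (T * sampleMean T (fun i => u i ω) ^ 2)) := by
    intro ω
    have e : (center T fun i => u i ω) =
        (fun i => u i ω) + fun _ => - sampleMean T (fun i => u i ω) := by
      funext i; simp [center, sub_eq_add_neg]
    rw [e]
    refine (spectralEnergy_add_le hg _ _).trans ?_
    have h2 := spectralEnergy_le_sq_sum (b := b) (T := T) hg
      (fun _ => - sampleMean T (fun i => u i ω))
    simp only [abs_neg, Finset.sum_const, Finset.card_range, nsmul_eq_mul, mul_pow, sq_abs] at h2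
    have e2 : (T : ℝ)⁻¹ * ((T : ℝ) ^ 2 * sampleMean T (fun i => u i ω) ^ 2) =
        T * sampleMean T (fun i => u i ω) ^ 2 := by field_simp
    rw [e2] at h2
    linarith
  have i1 : Integrable (fun ω => spectralEnergy g b T (fun i => u i ω)) P :=
    integrable_quadForm h.measurable h.measurable h.bounded h.bounded _ b T
  have i2 : Integrable (fun ω => sampleMean T (fun i => u i ω) ^ 2) P := by
    obtain ⟨c, hc⟩ := h.bounded
    refine Integrable.of_bound (C := c ^ 2) ?_ (Eventually.of_forall fun ω => ?_)
    · exact ((measurable_const.mul (Finset.measurable_sum _ fun j _ =>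
        h.measurable j)).pow_const 2).aestronglyMeasurable
    · rw [norm_pow, Real.norm_eq_abs]
      exact pow_le_pow_left₀ (abs_nonneg _) (abs_sampleMean_le (fun i => hc i ω) T) 2
  have i3 : Integrable (fun ω => spectralEnergy g b T (center T fun i => u i ω)) P :=
    integrable_quadForm (measurable_center h.measurable T) (measurable_center h.measurable T)
      (bounded_center h.bounded T) (bounded_center h.bounded T) _ b T
  have h3 := integral_mono i3 ((i1.const_mul 2).add (((i2.const_mul _).const_mul _).const_mul 2)) h1
  simp only [Pi.add_apply] at h3
  rw [integral_add (i1.const_mul 2) (((i2.const_mul _).const_mul _).const_mul 2),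
    integral_const_mul, integral_const_mul, integral_const_mul, integral_const_mul] at h3
  have h4 := h.integral_sq_sampleMean_le hT
  have h5 := (le_abs_self _).trans (h.abs_integral_quadForm_le
    (κ := cosKernel fun ξ => |g ξ|) (K := ∫ ξ, |g ξ|)
    (fun x => by simpa using abs_cosKernel_le _ hg.abs x) b hT)
  have h6 := mul_le_mul_of_nonneg_left h4 hK
  unfold spectralEnergy at h3 ⊢
  linarith

/-- Centring at the sample mean is negligible when the row sums of the kernel matrix are `o(T)`. -/
lemma integral_abs_quadForm_center_sub_le (h : HasCovBound P u β) {κ : ℝ → ℝ} {b : ℝ} {T : ℕ}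
    {R : ℝ} (hR : 0 < R)
    (hrow : ∀ i < T, ∑ j ∈ Finset.range T, |κ (|(i : ℝ) - (j : ℝ)| / b)| ≤ R) :
    ∫ ω, |quadForm κ b T (center T fun i => u i ω) (center T fun i => u i ω) -
      quadForm κ b T (fun i => u i ω) (fun i => u i ω)| ∂P ≤ 6 * (∑' k, β k) * (R / T) := by
  rcases eq_or_ne T 0 with rfl | hT
  · simp [quadForm]
  have hT' : (T : ℝ) ≠ 0 := by exact_mod_cast hT
  have hTp : (0 : ℝ) < T := by positivity
  set r : ℕ → ℝ := fun i => ∑ j ∈ Finset.range T, κ (|(i : ℝ) - (j : ℝ)| / b) with hr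
  have hrR : ∀ i < T, |r i| ≤ R := fun i hi => (Finset.abs_sum_le_sum_abs _ _).trans (hrow i hi)
  have e1 : ∀ v : ℕ → ℝ, quadForm κ b T v (fun _ => 1) =
      (T : ℝ)⁻¹ * ∑ i ∈ Finset.range T, r i * v i := by
    intro v
    unfold quadForm
    congr 1
    refine Finset.sum_congr rfl fun i _ => ?_
    rw [hr]; simp only [mul_one]
    rw [← Finset.mul_sum, mul_comm]
  have h1 : ∀ v : ℕ → ℝ, |quadForm κ b T (center T v) (center T v) - quadForm κ b T v v| ≤
      2 * R * sampleMean T v ^ 2 + R⁻¹ * ((T : ℝ)⁻¹ ^ 2 * (∑ i ∈ Finset.range T, r i * v i) ^ 2) := by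
    intro v
    set m := sampleMean T v with hm
    have e : center T v = v + (-m) • (fun _ => (1 : ℝ)) := by
      funext i; simp [center, sub_eq_add_neg, hm]
    have e2 : quadForm κ b T (center T v) (center T v) - quadForm κ b T v v =
        -2 * m * quadForm κ b T v (fun _ => 1) + m ^ 2 * quadForm κ b T (fun _ => 1) (fun _ => 1) := by
      rw [e]
      simp only [quadForm_add_left, quadForm_add_right, quadForm_smul_left, quadForm_smul_right]
      rw [quadForm_symm (fun _ => (1 : ℝ)) v]
      ring
    have h3 : |quadForm κ b T (fun _ => 1) (fun _ => 1)| ≤ R := by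
      rw [e1, abs_mul, abs_of_nonneg (by positivity : (0 : ℝ) ≤ (T : ℝ)⁻¹)]
      calc _ ≤ (T : ℝ)⁻¹ * ∑ i ∈ Finset.range T, R := by
            gcongr
            refine (Finset.abs_sum_le_sum_abs _ _).trans (Finset.sum_le_sum fun i hi => ?_)
            simpa using hrR i (Finset.mem_range.1 hi)
        _ = R := by simp [hT']
    rw [e2, ← mul_pow, ← e1]
    set q := quadForm κ b T v (fun _ => 1)
    have h4 : |(-2) * m * q| ≤ R * m ^ 2 + R⁻¹ * q ^ 2 := by
      have a1 : 0 ≤ R⁻¹ * (R * m - q) ^ 2 := by positivity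
      have a2 : 0 ≤ R⁻¹ * (R * m + q) ^ 2 := by positivity
      have b1 : R⁻¹ * (R * m - q) ^ 2 = R * m ^ 2 + R⁻¹ * q ^ 2 - 2 * m * q := by field_simp; ring
      have b2 : R⁻¹ * (R * m + q) ^ 2 = R * m ^ 2 + R⁻¹ * q ^ 2 + 2 * m * q := by field_simp; ring
      rw [abs_le]; constructor <;> linarith
    have h5 : |m ^ 2 * quadForm κ b T (fun _ => 1) (fun _ => 1)| ≤ m ^ 2 * R := by
      rw [abs_mul, abs_of_nonneg (sq_nonneg m)]; gcongr
    have := abs_add_le (-2 * m * q) (m ^ 2 * quadForm κ b T (fun _ => 1) (fun _ => 1))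
    linarith
  obtain ⟨c, hc⟩ := h.bounded
  have i2 : Integrable (fun ω => sampleMean T (fun i => u i ω) ^ 2) P := by
    refine Integrable.of_bound (C := c ^ 2) ?_ (Eventually.of_forall fun ω => ?_)
    · exact ((measurable_const.mul (Finset.measurable_sum _ fun j _ =>
        h.measurable j)).pow_const 2).aestronglyMeasurable
    · rw [norm_pow, Real.norm_eq_abs]
      exact pow_le_pow_left₀ (abs_nonneg _) (abs_sampleMean_le (fun i => hc i ω) T) 2
  have i4 : Integrable (fun ω => (∑ i ∈ Finset.range T, r i * u i ω) ^ 2) P := by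
    have : (fun ω => (∑ i ∈ Finset.range T, r i * u i ω) ^ 2) = fun ω =>
      ∑ i ∈ Finset.range T, ∑ j ∈ Finset.range T, (r i * r j) * (u i ω * u j ω) := by
      funext ω
      rw [sq, Finset.sum_mul_sum]
      exact Finset.sum_congr rfl fun i _ => Finset.sum_congr rfl fun j _ => by ring
    rw [this]
    exact integrable_finsetSum _ fun i _ => integrable_finsetSum _ fun j _ =>
      (h.integrable_mul i j).const_mul _
  have i3 : Integrable (fun ω => quadForm κ b T (center T fun i => u i ω)
      (center T fun i => u i ω)) P :=
    integrable_quadForm (measurable_center h.measurable T) (measurable_center h.measurable T)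
      (bounded_center h.bounded T) (bounded_center h.bounded T) _ b T
  have i1 : Integrable (fun ω => quadForm κ b T (fun i => u i ω) (fun i => u i ω)) P :=
    integrable_quadForm h.measurable h.measurable h.bounded h.bounded _ b T
  have h2 := integral_mono (i3.sub i1).abs ((i2.const_mul (2 * R)).add
    ((i4.const_mul _).const_mul R⁻¹)) (fun ω => h1 fun i => u i ω)
  simp only [Pi.add_apply] at h2
  rw [integral_add (i2.const_mul (2 * R)) ((i4.const_mul _).const_mul R⁻¹),
    integral_const_mul, integral_const_mul, integral_const_mul] at h2
  refine h2.trans ?_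
  have h5 := h.integral_sq_sampleMean_le hT
  have h6 := h.integral_sq_sum_le T hrR
  have h7 : ∫ ω, sampleMean T (fun i => u i ω) ^ 2 ∂P ≤ (2 * ∑' k, β k) / T := by
    rw [le_div_iff₀ hTp]; linarith
  calc _ ≤ 2 * R * ((2 * ∑' k, β k) / T) +
        R⁻¹ * ((T : ℝ)⁻¹ ^ 2 * (R ^ 2 * (T * (2 * ∑' k, β k)))) := by gcongr
    _ = _ := by field_simp; ring

end HasCovBound

end SecondMoments

/-! ### Bounded functions of a strongly mixing sequence -/

section BoundedFunctions

variable {Ω : Type*} [MeasurableSpace Ω] {P : Measure Ω} {p : ℕ}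
  {X : ℕ → Ω → EuclideanSpace ℝ (Fin p)}

lemma integral_comp_eq (hX : ∀ t, Measurable (X t)) (hstat : IsStrictlyStationary X P)
    {f : EuclideanSpace ℝ (Fin p) → ℝ} (hf : Measurable f) (i : ℕ) :
    ∫ ω, f (X i ω) ∂P = ∫ ω, f (X 0 ω) ∂P := by
  have := hstat.integral_eq (F := fun x => f (x 0)) hX (hf.comp (measurable_pi_apply 0)) i
  simpa using this

lemma integral_mul_comp_eq (hX : ∀ t, Measurable (X t)) (hstat : IsStrictlyStationary X P)
    {f : EuclideanSpace ℝ (Fin p) → ℝ} (hf : Measurable f) (i j : ℕ) :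
    ∫ ω, f (X i ω) * f (X j ω) ∂P = ∫ ω, f (X 0 ω) * f (X (Nat.dist i j) ω) ∂P := by
  have key : ∀ i j : ℕ, i ≤ j →
      ∫ ω, f (X i ω) * f (X j ω) ∂P = ∫ ω, f (X 0 ω) * f (X (Nat.dist i j) ω) ∂P := by
    intro i j hij
    have := hstat.integral_eq (F := fun x => f (x 0) * f (x (j - i))) hX
      ((hf.comp (measurable_pi_apply 0)).mul (hf.comp (measurable_pi_apply _))) i
    rw [Nat.dist_eq_sub_of_le hij]
    simpa [Nat.sub_add_cancel hij] using this
  rcases le_total i j with h | h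
  · exact key i j h
  · rw [Nat.dist_comm, ← key j i h]; simp only [mul_comm]

variable [IsProbabilityMeasure P]

lemma summable_mixingCoeff
    (hmix : Summable fun k : ℕ => (k : ℝ) ^ 2 * mixingCoeff X P k) :
    Summable (mixingCoeff X P) := by
  rw [← summable_nat_add_iff 1] at hmix ⊢
  refine hmix.of_nonneg_of_le (fun k => mixingCoeff_nonneg _) fun k => ?_
  have := mixingCoeff_nonneg (X := X) (P := P) (k + 1)
  refine le_mul_of_one_le_left this ?_
  have : (0 : ℝ) ≤ k := k.cast_nonneg
  push_cast
  nlinarith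

/-- `√a_k ≤ (k² a_k + k⁻²) / 2`, so `∑ √a_k` converges as well. -/
lemma summable_sqrt_mixingCoeff
    (hmix : Summable fun k : ℕ => (k : ℝ) ^ 2 * mixingCoeff X P k) :
    Summable fun k => Real.sqrt (mixingCoeff X P k) := by
  have h2 : Summable fun k : ℕ => 1 / (k : ℝ) ^ 2 := Real.summable_one_div_nat_pow.2 (by norm_num)
  rw [← summable_nat_add_iff 1] at hmix h2 ⊢
  refine ((hmix.add h2).mul_left (1 / 2)).of_nonneg_of_le (fun k => Real.sqrt_nonneg _) fun k => ?_
  have ha := mixingCoeff_nonneg (X := X) (P := P) (k + 1)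
  set a := mixingCoeff X P (k + 1)
  have hk : (0 : ℝ) < ((k + 1 : ℕ) : ℝ) := by positivity
  set n : ℝ := ((k + 1 : ℕ) : ℝ)
  have h3 := sq_nonneg (n * Real.sqrt a - 1 / n)
  have h4 : (n * Real.sqrt a - 1 / n) ^ 2 = n ^ 2 * Real.sqrt a ^ 2 + 1 / n ^ 2 - 2 * Real.sqrt a := by
    field_simp; ring
  rw [h4, Real.sq_sqrt ha] at h3
  linarith

/-- For a bounded function `f` with small `L¹` norm `q`, the autocovariances of `f(X_t)` are bounded
by `min (2 c q) (4 c² a_h)`, hence by the geometric mean of the two. -/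
lemma hasCovBound_of_bounded (hX : ∀ t, Measurable (X t)) (hstat : IsStrictlyStationary X P)
    (hmix : Summable fun k : ℕ => (k : ℝ) ^ 2 * mixingCoeff X P k)
    {f : EuclideanSpace ℝ (Fin p) → ℝ} (hf : Measurable f) {c q : ℝ} (hc : ∀ x, |f x| ≤ c)
    (hq : ∫ ω, |f (X 0 ω)| ∂P ≤ q) :
    HasCovBound P (fun i ω => f (X i ω) - ∫ ω, f (X 0 ω) ∂P)
      (fun h => Real.sqrt (8 * c ^ 3 * q) * Real.sqrt (mixingCoeff X P h)) := by
  have hc0 : 0 ≤ c := (abs_nonneg _).trans (hc 0)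
  have hq0 : 0 ≤ q := (integral_nonneg fun _ => abs_nonneg _).trans hq
  have hfm : ∀ i, Measurable fun ω => f (X i ω) := fun i => hf.comp (hX i)
  have hfi : ∀ i, Integrable (fun ω => f (X i ω)) P := fun i =>
    Integrable.of_bound (hfm i).aestronglyMeasurable c
      (Eventually.of_forall fun ω => by simpa using hc _)
  set e := ∫ ω, f (X 0 ω) ∂P with he
  have hee : |e| ≤ q := (abs_integral_le_integral_abs).trans hq
  have hec : |e| ≤ c := by
    refine (abs_integral_le_integral_abs).trans ((integral_mono (hfi 0).abs
      (integrable_const c) fun ω => hc _).trans ?_)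
    simp
  refine ⟨fun i => (hfm i).sub_const _, ⟨2 * c, fun i ω => ?_⟩, fun h => by positivity,
    (summable_sqrt_mixingCoeff hmix).mul_left _, ?_⟩
  · have := abs_sub (f (X i ω)) e
    have := hc (X i ω)
    linarith
  have hfe : ∀ i, ∫ ω, f (X i ω) ∂P = e := fun i => integral_comp_eq hX hstat hf i
  have hprod : ∀ i j, Integrable (fun ω => f (X i ω) * f (X j ω)) P := fun i j =>
    integrable_mul_of_bounded (u := fun i ω => f (X i ω)) (v := fun i ω => f (X i ω)) hfm hfm
      ⟨c, fun i ω => hc _⟩ ⟨c, fun i ω => hc _⟩ i j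
  have hcov : ∀ i j, ∫ ω, (f (X i ω) - e) * (f (X j ω) - e) ∂P =
      ∫ ω, f (X i ω) * f (X j ω) ∂P - e * e := by
    intro i j
    have e1 : (fun ω => (f (X i ω) - e) * (f (X j ω) - e)) = fun ω =>
        f (X i ω) * f (X j ω) - (e * f (X i ω) + e * f (X j ω) - e * e) := by funext ω; ring
    have i1 : Integrable (fun ω => e * f (X i ω) + e * f (X j ω)) P :=
      ((hfi i).const_mul e).add ((hfi j).const_mul e)
    have i2 : Integrable (fun ω => e * f (X i ω) + e * f (X j ω) - e * e) P :=
      i1.sub (integrable_const _)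
    rw [e1, integral_sub (hprod i j) i2, integral_sub i1 (integrable_const _), integral_add ((hfi i).const_mul e) ((hfi j).const_mul e),
      integral_const_mul, integral_const_mul, hfe, hfe]
    simp
  have main : ∀ i j, i ≤ j → |∫ ω, (f (X i ω) - e) * (f (X j ω) - e) ∂P| ≤
      Real.sqrt (8 * c ^ 3 * q) * Real.sqrt (mixingCoeff X P (Nat.dist i j)) := by
    intro i j hij
    rw [hcov, Nat.dist_eq_sub_of_le hij]
    set x := |∫ ω, f (X i ω) * f (X j ω) ∂P - e * e| with hx
    have ha := mixingCoeff_nonneg (X := X) (P := P) (j - i)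
    have b1 : x ≤ 4 * c * c * mixingCoeff X P (j - i) := by
      have := abs_cov_le_mixingCoeff (P := P) hX (n := i) (k := j - i) (f := fun ω => f (X i ω))
        (g := fun ω => f (X j ω)) (hf.comp (measurable_pastSigma le_rfl))
        (hf.comp (measurable_futureSigma (by omega))) (fun ω => hc _) (fun ω => hc _)
      simpa only [hfe] using this
    have b2 : x ≤ 2 * c * q := by
      have h1 : |∫ ω, f (X i ω) * f (X j ω) ∂P| ≤ c * q := by
        refine (abs_integral_le_integral_abs).trans ?_
        have h2 : ∫ ω, |f (X i ω)| ∂P ≤ q := by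
          rw [integral_comp_eq (f := fun x => |f x|) hX hstat hf.abs i]; exact hq
        calc _ ≤ ∫ ω, c * |f (X i ω)| ∂P := by
              refine integral_mono (hprod i j).abs ((hfi i).abs.const_mul c) fun ω => ?_
              simp only [abs_mul]
              rw [mul_comm]
              exact mul_le_mul_of_nonneg_right (hc _) (abs_nonneg _)
          _ ≤ _ := by rw [integral_const_mul]; gcongr
      have h2 : |e * e| ≤ c * q := by
        rw [abs_mul]; exact mul_le_mul hec hee (abs_nonneg _) hc0
      have := abs_sub (∫ ω, f (X i ω) * f (X j ω) ∂P) (e * e)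
      linarith
    have hx0 : 0 ≤ x := abs_nonneg _
    rw [← Real.sqrt_mul (by positivity)]
    refine Real.le_sqrt_of_sq_le ?_
    calc x ^ 2 = x * x := sq x
      _ ≤ (4 * c * c * mixingCoeff X P (j - i)) * (2 * c * q) :=
        mul_le_mul b1 b2 hx0 (by positivity)
      _ = _ := by ring
  intro i j
  rcases le_total i j with h | h
  · exact main i j h
  · rw [Nat.dist_comm]
    simpa only [mul_comm] using main j i h

end BoundedFunctions

/-! ### Fourth order cumulants and the variance of the quadratic form -/

section FourthMoments

variable {Ω : Type*} [MeasurableSpace Ω]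

/-- The joint fourth order cumulant of `u_{x_0}, …, u_{x_3}` for a process with mean zero. -/
noncomputable def cumulant (P : Measure Ω) (u : ℕ → Ω → ℝ) (x : Fin 4 → ℕ) : ℝ :=
  ∫ ω, ∏ k, u (x k) ω ∂P -
    ((∫ ω, u (x 0) ω * u (x 1) ω ∂P) * (∫ ω, u (x 2) ω * u (x 3) ω ∂P) +
     (∫ ω, u (x 0) ω * u (x 2) ω ∂P) * (∫ ω, u (x 1) ω * u (x 3) ω ∂P) +
     (∫ ω, u (x 0) ω * u (x 3) ω ∂P) * (∫ ω, u (x 1) ω * u (x 2) ω ∂P))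

lemma cumulant_comp_perm (P : Measure Ω) (u : ℕ → Ω → ℝ) (σ : Equiv.Perm (Fin 4)) :
    ∀ x : Fin 4 → ℕ, cumulant P u (x ∘ σ) = cumulant P u x := by
  induction σ using Equiv.Perm.swap_induction_on with
  | one => intro x; rfl
  | swap_mul f a b hab ih =>
    intro x
    have e : x ∘ ⇑(Equiv.swap a b * f) = (x ∘ Equiv.swap a b) ∘ f := rfl
    rw [e, ih]
    have h1 : ∀ ω, ∏ k, u ((x ∘ Equiv.swap a b) k) ω = ∏ k, u (x k) ω := fun ω =>
      Equiv.prod_comp (Equiv.swap a b) fun k => u (x k) ω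
    have hG : ∀ i j, ∫ ω, u i ω * u j ω ∂P = ∫ ω, u j ω * u i ω ∂P := fun i j => by
      simp only [mul_comm]
    unfold cumulant
    simp only [Function.comp_apply] at h1 ⊢
    simp only [h1]
    congr 1
    set G : ℕ → ℕ → ℝ := fun i j => ∫ ω, u i ω * u j ω ∂P with hGd
    change G _ _ * G _ _ + G _ _ * G _ _ + G _ _ * G _ _ =
      G _ _ * G _ _ + G _ _ * G _ _ + G _ _ * G _ _
    replace hG : ∀ i j, G i j = G j i := hG
    clear_value G
    have s10 := hG (x 1) (x 0)
    have s20 := hG (x 2) (x 0)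
    have s30 := hG (x 3) (x 0)
    have s21 := hG (x 2) (x 1)
    have s31 := hG (x 3) (x 1)
    have s32 := hG (x 3) (x 2)
    fin_cases a <;> fin_cases b <;>
      simp [Equiv.swap_apply_def, s10, s20, s30, s21, s31, s32] at hab ⊢ <;> ring

variable {P : Measure Ω} [IsProbabilityMeasure P] {p : ℕ} {X : ℕ → Ω → EuclideanSpace ℝ (Fin p)}

lemma abs_integral_mul_le_mixingCoeff (hX : ∀ t, Measurable (X t))
    {v : EuclideanSpace ℝ (Fin p) → ℝ} (hv : Measurable v) {c : ℝ} (hc : ∀ x, |v x| ≤ c)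
    (h0 : ∀ i, ∫ ω, v (X i ω) ∂P = 0) {i j g : ℕ} (h : i + g ≤ j) :
    |∫ ω, v (X i ω) * v (X j ω) ∂P| ≤ 4 * c ^ 2 * mixingCoeff X P g := by
  have := abs_cov_le_mixingCoeff (P := P) hX (n := i) (k := g) (f := fun ω => v (X i ω))
    (g := fun ω => v (X j ω)) (hv.comp (measurable_pastSigma le_rfl))
    (hv.comp (measurable_futureSigma h)) (fun ω => hc _) (fun ω => hc _)
  simp only [h0, mul_zero, sub_zero] at this
  calc _ ≤ _ := this
    _ = _ := by ring

/-- The cumulant of ordered indices is controlled by each of the three gaps: across the first or the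
last gap a single mean-zero factor decouples, across the middle gap a product of pairs. -/
lemma abs_cumulant_le (hX : ∀ t, Measurable (X t))
    {v : EuclideanSpace ℝ (Fin p) → ℝ} (hv : Measurable v) {c : ℝ} (hc : ∀ x, |v x| ≤ c)
    (h0 : ∀ i, ∫ ω, v (X i ω) ∂P = 0) {x : Fin 4 → ℕ} (hx : Monotone x) :
    |cumulant P (fun i ω => v (X i ω)) x| ≤
      16 * c ^ 4 * mixingCoeff X P (max (x 1 - x 0) (max (x 2 - x 1) (x 3 - x 2))) := by
  have x01 : x 0 ≤ x 1 := hx (by decide)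
  have x12 : x 1 ≤ x 2 := hx (by decide)
  have x23 : x 2 ≤ x 3 := hx (by decide)
  have hc0 : 0 ≤ c := (abs_nonneg _).trans (hc 0)
  have hb : ∀ i j, |∫ ω, v (X i ω) * v (X j ω) ∂P| ≤ c ^ 2 := by
    intro i j
    refine (abs_integral_le_integral_abs).trans ?_
    calc _ ≤ ∫ _, c ^ 2 ∂P := by
          refine integral_mono_of_nonneg (Eventually.of_forall fun _ => abs_nonneg _)
            (integrable_const _) (Eventually.of_forall fun ω => ?_)
          simp only [abs_mul, sq]
          exact mul_le_mul (hc _) (hc _) (abs_nonneg _) hc0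
      _ = c ^ 2 := by simp
  have hprod : ∀ {y z A B : ℝ}, |y| ≤ A → |z| ≤ B → |y * z| ≤ A * B := fun hy hz => by
    rw [abs_mul]; exact mul_le_mul hy hz (abs_nonneg _) ((abs_nonneg _).trans hy)
  have mp : ∀ {i n}, i ≤ n → Measurable[pastSigma X n] fun ω => v (X i ω) := fun h =>
    hv.comp (measurable_pastSigma h)
  have mf : ∀ {i n}, n ≤ i → Measurable[futureSigma X n] fun ω => v (X i ω) := fun h =>
    hv.comp (measurable_futureSigma h)
  have hc2 : ∀ i j ω, |v (X i ω) * v (X j ω)| ≤ c * c := fun i j ω => hprod (hc _) (hc _)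
  unfold cumulant
  simp only [Fin.prod_univ_four]
  set a := mixingCoeff X P
  have pair := fun {i j g : ℕ} (h : i + g ≤ j) =>
    abs_integral_mul_le_mixingCoeff (P := P) hX hv hc h0 h
  have tri : ∀ {A B C D α β γ δ : ℝ}, |A| ≤ α → |B| ≤ β → |C| ≤ γ → |D| ≤ δ →
      |A - (B + C + D)| ≤ α + β + γ + δ := by
    intro A B C D α β γ δ h1 h2 h3 h4
    have e1 := abs_sub A (B + C + D)
    have e2 := abs_add_le (B + C) D
    have e3 := abs_add_le B C
    linarith
  have k1 : |∫ ω, v (X (x 0) ω) * v (X (x 1) ω) * v (X (x 2) ω) * v (X (x 3) ω) ∂P| ≤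
      4 * c * (c * c * c) * a (x 1 - x 0) := by
    have := abs_cov_le_mixingCoeff (P := P) hX (n := x 0) (k := x 1 - x 0)
      (f := fun ω => v (X (x 0) ω)) (g := fun ω => v (X (x 1) ω) * v (X (x 2) ω) * v (X (x 3) ω))
      (mp le_rfl) (((mf (by omega)).mul (mf (by omega))).mul (mf (by omega))) (fun ω => hc _)
      (fun ω => hprod (hc2 _ _ _) (hc _))
    simp only [h0, zero_mul, sub_zero] at this
    simpa only [mul_assoc] using this
  have k3 : |∫ ω, v (X (x 0) ω) * v (X (x 1) ω) * v (X (x 2) ω) * v (X (x 3) ω) ∂P| ≤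
      4 * (c * c * c) * c * a (x 3 - x 2) := by
    have := abs_cov_le_mixingCoeff (P := P) hX (n := x 2) (k := x 3 - x 2)
      (f := fun ω => v (X (x 0) ω) * v (X (x 1) ω) * v (X (x 2) ω)) (g := fun ω => v (X (x 3) ω))
      (((mp (by omega)).mul (mp (by omega))).mul (mp (by omega))) (mf (by omega))
      (fun ω => hprod (hc2 _ _ _) (hc _)) (fun ω => hc _)
    simp only [h0, mul_zero, sub_zero] at this
    exact this
  have k2 : |∫ ω, v (X (x 0) ω) * v (X (x 1) ω) * v (X (x 2) ω) * v (X (x 3) ω) ∂P -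
      (∫ ω, v (X (x 0) ω) * v (X (x 1) ω) ∂P) * ∫ ω, v (X (x 2) ω) * v (X (x 3) ω) ∂P| ≤
      4 * (c * c) * (c * c) * a (x 2 - x 1) := by
    have := abs_cov_le_mixingCoeff (P := P) hX (n := x 1) (k := x 2 - x 1)
      (f := fun ω => v (X (x 0) ω) * v (X (x 1) ω)) (g := fun ω => v (X (x 2) ω) * v (X (x 3) ω))
      ((mp (by omega)).mul (mp (by omega))) ((mf (by omega)).mul (mf (by omega)))
      (fun ω => hc2 _ _ _) (fun ω => hc2 _ _ _)
    simpa only [mul_assoc] using this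
  have A1 : |cumulant P (fun i ω => v (X i ω)) x| ≤ 16 * c ^ 4 * a (x 1 - x 0) := by
    unfold cumulant
    simp only [Fin.prod_univ_four]
    refine (tri k1 (hprod (pair (g := x 1 - x 0) (by omega)) (hb _ _))
      (hprod (pair (g := x 1 - x 0) (by omega)) (hb _ _))
      (hprod (pair (g := x 1 - x 0) (by omega)) (hb _ _))).trans (le_of_eq ?_)
    ring
  have A3 : |cumulant P (fun i ω => v (X i ω)) x| ≤ 16 * c ^ 4 * a (x 3 - x 2) := by
    unfold cumulant
    simp only [Fin.prod_univ_four]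
    refine (tri k3 (hprod (hb _ _) (pair (g := x 3 - x 2) (by omega)))
      (hprod (hb _ _) (pair (g := x 3 - x 2) (by omega)))
      (hprod (pair (g := x 3 - x 2) (by omega)) (hb _ _))).trans (le_of_eq ?_)
    ring
  have A2 : |cumulant P (fun i ω => v (X i ω)) x| ≤ 16 * c ^ 4 * a (x 2 - x 1) := by
    unfold cumulant
    simp only [Fin.prod_univ_four]
    have := tri k2 (by simp : |(0 : ℝ)| ≤ 0)
      (hprod (pair (i := x 0) (j := x 2) (g := x 2 - x 1) (by omega)) (hb (x 1) (x 3)))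
      (hprod (pair (i := x 0) (j := x 3) (g := x 2 - x 1) (by omega)) (hb (x 1) (x 2)))
    have ha : 0 ≤ a (x 2 - x 1) := mixingCoeff_nonneg _
    rw [zero_add, sub_sub, ← add_assoc] at this
    refine this.trans ?_
    have : 0 ≤ c ^ 4 * a (x 2 - x 1) := by positivity
    nlinarith
  unfold cumulant at A1 A2 A3
  simp only [Fin.prod_univ_four] at A1 A2 A3
  rcases max_choice (x 1 - x 0) (max (x 2 - x 1) (x 3 - x 2)) with h | h
  · rw [h]; exact A1
  · rw [h]
    rcases max_choice (x 2 - x 1) (x 3 - x 2) with h' | h'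
    · rw [h']; exact A2
    · rw [h']; exact A3

/-- There are at most `3 (m + 1)²` triples of gaps with maximum `m`. -/
lemma sum_max_le {a : ℕ → ℝ} (ha : ∀ k, 0 ≤ a k)
    (hs : Summable fun k : ℕ => ((k : ℝ) + 1) ^ 2 * a k) (T : ℕ) :
    ∑ g₁ ∈ Finset.range T, ∑ g₂ ∈ Finset.range T, ∑ g₃ ∈ Finset.range T, a (max g₁ (max g₂ g₃)) ≤
      3 * ∑' k : ℕ, ((k : ℝ) + 1) ^ 2 * a k := by
  have h1 : ∀ m, ∑ i ∈ Finset.range T, ∑ j ∈ Finset.range T, (if i ≤ m ∧ j ≤ m then a m else 0) ≤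
      ((m : ℝ) + 1) ^ 2 * a m := by
    intro m
    have e : ∀ i j, (if i ≤ m ∧ j ≤ m then a m else 0) =
        (if i ≤ m then 1 else 0) * (if j ≤ m then 1 else 0) * a m := by
      intro i j; by_cases hi : i ≤ m <;> by_cases hj : j ≤ m <;> simp [hi, hj]
    simp only [e, ← Finset.sum_mul, ← Finset.sum_mul_sum]
    refine mul_le_mul_of_nonneg_right ?_ (ha m)
    have h2 : ∑ i ∈ Finset.range T, (if i ≤ m then (1 : ℝ) else 0) ≤ m + 1 := by
      rw [Finset.sum_boole]
      have : ((Finset.range T).filter fun i => i ≤ m).card ≤ m + 1 := by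
        rw [← Finset.card_range (m + 1)]
        refine Finset.card_le_card fun i hi => ?_
        have := (Finset.mem_filter.1 hi).2
        exact Finset.mem_range.2 (by omega)
      exact_mod_cast this
    rw [sq]
    exact mul_le_mul h2 h2 (Finset.sum_nonneg fun i _ => by split_ifs <;> norm_num) (by positivity)
  have h2 : ∑ m ∈ Finset.range T, ∑ i ∈ Finset.range T, ∑ j ∈ Finset.range T,
      (if i ≤ m ∧ j ≤ m then a m else 0) ≤ ∑' k : ℕ, ((k : ℝ) + 1) ^ 2 * a k :=
    (Finset.sum_le_sum fun m _ => h1 m).trans (hs.sum_le_tsum _ fun k _ =>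
      mul_nonneg (by positivity) (ha k))
  have h3 : ∑ g₁ ∈ Finset.range T, ∑ g₂ ∈ Finset.range T, ∑ g₃ ∈ Finset.range T,
      a (max g₁ (max g₂ g₃)) ≤
      ∑ g₁ ∈ Finset.range T, ∑ g₂ ∈ Finset.range T, ∑ g₃ ∈ Finset.range T,
      ((if g₂ ≤ g₁ ∧ g₃ ≤ g₁ then a g₁ else 0) + (if g₁ ≤ g₂ ∧ g₃ ≤ g₂ then a g₂ else 0) +
        (if g₁ ≤ g₃ ∧ g₂ ≤ g₃ then a g₃ else 0)) := by
    refine Finset.sum_le_sum fun i _ => Finset.sum_le_sum fun j _ => Finset.sum_le_sum fun k _ => ?_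
    have n1 : ∀ (Q : Prop) [Decidable Q] (m : ℕ), 0 ≤ if Q then a m else 0 := fun Q _ m => by
      split_ifs
      · exact ha m
      · exact le_rfl
    have a1 := n1 (j ≤ i ∧ k ≤ i) i
    have a2 := n1 (i ≤ j ∧ k ≤ j) j
    have a3 := n1 (i ≤ k ∧ j ≤ k) k
    rcases max_choice i (max j k) with h | h
    · rw [h, if_pos (⟨by omega, by omega⟩ : j ≤ i ∧ k ≤ i)]; linarith
    · rw [h]
      rcases max_choice j k with h' | h'
      · rw [h', if_pos (⟨by omega, by omega⟩ : i ≤ j ∧ k ≤ j)]; linarith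
      · rw [h', if_pos (⟨by omega, by omega⟩ : i ≤ k ∧ j ≤ k)]; linarith
  refine h3.trans ?_
  simp only [Finset.sum_add_distrib]
  have e2 : ∑ x ∈ Finset.range T, ∑ y ∈ Finset.range T, ∑ z ∈ Finset.range T,
      (if x ≤ y ∧ z ≤ y then a y else 0) = ∑ m ∈ Finset.range T, ∑ i ∈ Finset.range T,
      ∑ j ∈ Finset.range T, (if i ≤ m ∧ j ≤ m then a m else 0) := Finset.sum_comm
  have e3 : ∑ x ∈ Finset.range T, ∑ y ∈ Finset.range T, ∑ z ∈ Finset.range T,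
      (if x ≤ z ∧ y ≤ z then a z else 0) = ∑ m ∈ Finset.range T, ∑ i ∈ Finset.range T,
      ∑ j ∈ Finset.range T, (if i ≤ m ∧ j ≤ m then a m else 0) := by
    rw [Finset.sum_comm]
    calc _ = ∑ y ∈ Finset.range T, ∑ z ∈ Finset.range T, ∑ x ∈ Finset.range T,
          (if x ≤ z ∧ y ≤ z then a z else 0) := Finset.sum_congr rfl fun _ _ => Finset.sum_comm
      _ = ∑ z ∈ Finset.range T, ∑ y ∈ Finset.range T, ∑ x ∈ Finset.range T,
          (if x ≤ z ∧ y ≤ z then a z else 0) := Finset.sum_comm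
      _ = _ := Finset.sum_congr rfl fun _ _ => Finset.sum_comm
  rw [e2, e3]
  linarith

/-- The total of the absolute cumulants is of order `T`. The constant `1152 = 24 · 16 · 3` collects the
`4!` orderings of the indices, the cumulant bound and the number of gaps. -/
lemma sum_abs_cumulant_le (hX : ∀ t, Measurable (X t))
    (hs : Summable fun k : ℕ => ((k : ℝ) + 1) ^ 2 * mixingCoeff X P k)
    {v : EuclideanSpace ℝ (Fin p) → ℝ} (hv : Measurable v) {c : ℝ} (hc : ∀ x, |v x| ≤ c)
    (h0 : ∀ i, ∫ ω, v (X i ω) ∂P = 0) (T : ℕ) :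
    ∑ x ∈ Fintype.piFinset (fun _ : Fin 4 => Finset.range T),
      |cumulant P (fun i ω => v (X i ω)) x| ≤
      T * (1152 * c ^ 4 * ∑' k : ℕ, ((k : ℝ) + 1) ^ 2 * mixingCoeff X P k) := by
  classical
  set B := Fintype.piFinset (fun _ : Fin 4 => Finset.range T) with hB
  set F : (Fin 4 → ℕ) → ℝ := fun x => |cumulant P (fun i ω => v (X i ω)) x| with hF
  set a := mixingCoeff X P with ha
  have ha0 : ∀ k, 0 ≤ a k := fun k => mixingCoeff_nonneg k
  have hF0 : ∀ x, 0 ≤ F x := fun x => abs_nonneg _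
  -- every tuple is sorted by some permutation
  have h1 : ∑ x ∈ B, F x ≤ ∑ σ : Equiv.Perm (Fin 4), ∑ x ∈ B,
      (if Monotone (x ∘ σ) then F (x ∘ σ) else 0) := by
    rw [Finset.sum_comm]
    refine Finset.sum_le_sum fun x _ => ?_
    have h := Finset.single_le_sum (s := Finset.univ)
      (f := fun σ : Equiv.Perm (Fin 4) => if Monotone (x ∘ σ) then F (x ∘ σ) else 0)
      (fun σ _ => by
        show 0 ≤ if Monotone (x ∘ σ) then F (x ∘ σ) else 0
        split_ifs
        · exact hF0 _
        · exact le_rfl) (Finset.mem_univ (Tuple.sort x))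
    refine le_trans (le_of_eq ?_) h
    rw [if_pos (Tuple.monotone_sort x), hF]
    simp only [cumulant_comp_perm]
  have h2 : ∀ σ : Equiv.Perm (Fin 4), ∑ x ∈ B, (if Monotone (x ∘ σ) then F (x ∘ σ) else 0) =
      ∑ x ∈ B with Monotone x, F x := by
    intro σ
    rw [Finset.sum_filter]
    refine Finset.sum_nbij' (fun x => x ∘ σ) (fun x => x ∘ σ.symm) ?_ ?_ ?_ ?_ ?_
    · intro x hx; rw [hB, Fintype.mem_piFinset] at hx ⊢; exact fun k => hx _
    · intro x hx; rw [hB, Fintype.mem_piFinset] at hx ⊢; exact fun k => hx _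
    · intro x _; funext k; simp
    · intro x _; funext k; simp
    · intro x _; rfl
  have h3 : ∑ x ∈ B with Monotone x, F x ≤ T * (16 * c ^ 4 * (3 * ∑' k : ℕ, ((k : ℝ) + 1) ^ 2 * a k)) := by
    set H : ℕ × ℕ × ℕ × ℕ → ℝ := fun y => 16 * c ^ 4 * a (max y.2.1 (max y.2.2.1 y.2.2.2)) with hH
    set φ : (Fin 4 → ℕ) → ℕ × ℕ × ℕ × ℕ := fun x => (x 0, x 1 - x 0, x 2 - x 1, x 3 - x 2) with hφ
    have hc4 : 0 ≤ c ^ 4 := by positivity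
    have hinj : Set.InjOn φ (B.filter fun x => Monotone x) := by
      intro x hx y hy hxy
      have mx : Monotone x := (Finset.mem_filter.1 (Finset.mem_coe.1 hx)).2
      have my : Monotone y := (Finset.mem_filter.1 (Finset.mem_coe.1 hy)).2
      have x01 : x 0 ≤ x 1 := mx (by decide)
      have x12 : x 1 ≤ x 2 := mx (by decide)
      have x23 : x 2 ≤ x 3 := mx (by decide)
      have y01 : y 0 ≤ y 1 := my (by decide)
      have y12 : y 1 ≤ y 2 := my (by decide)
      have y23 : y 2 ≤ y 3 := my (by decide)
      simp only [hφ, Prod.mk.injEq] at hxy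
      obtain ⟨e0, e1, e2, e3⟩ := hxy
      funext k
      fin_cases k <;> simp <;> omega
    calc ∑ x ∈ B with Monotone x, F x ≤ ∑ x ∈ B with Monotone x, H (φ x) :=
          Finset.sum_le_sum fun x hx => abs_cumulant_le hX hv hc h0 (Finset.mem_filter.1 hx).2
      _ = ∑ y ∈ (B.filter fun x => Monotone x).image φ, H y := (Finset.sum_image hinj).symm
      _ ≤ ∑ y ∈ Finset.range T ×ˢ Finset.range T ×ˢ Finset.range T ×ˢ Finset.range T, H y := by
          refine Finset.sum_le_sum_of_subset_of_nonneg ?_ fun y _ _ =>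
            mul_nonneg (by positivity) (ha0 _)
          intro y hy
          obtain ⟨x, hx, rfl⟩ := Finset.mem_image.1 hy
          have hx' := (Finset.mem_filter.1 hx).1
          rw [hB, Fintype.mem_piFinset] at hx'
          have q0 := Finset.mem_range.1 (hx' 0)
          have q1 := Finset.mem_range.1 (hx' 1)
          have q2 := Finset.mem_range.1 (hx' 2)
          have q3 := Finset.mem_range.1 (hx' 3)
          simp only [hφ, Finset.mem_product, Finset.mem_range]
          omega
      _ = T * (16 * c ^ 4 * ∑ g₁ ∈ Finset.range T, ∑ g₂ ∈ Finset.range T, ∑ g₃ ∈ Finset.range T,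
            a (max g₁ (max g₂ g₃))) := by
          simp only [Finset.sum_product, hH, ← Finset.mul_sum, Finset.sum_const, Finset.card_range,
            nsmul_eq_mul]
          ring
      _ ≤ _ := by
          gcongr
          exact sum_max_le ha0 hs T
  refine h1.trans ?_
  simp only [h2, Finset.sum_const, Finset.card_univ, Fintype.card_perm, Fintype.card_fin,
    nsmul_eq_mul]
  have : ((Nat.factorial 4 : ℕ) : ℝ) = 24 := by norm_num [Nat.factorial]
  rw [this]
  linarith

/-- The variance of the quadratic form is `O(R / T)`, where `R` bounds the row sums of the kernel
matrix. -/
lemma integral_sq_quadForm_sub_le (hX : ∀ t, Measurable (X t))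
    (hs : Summable fun k : ℕ => ((k : ℝ) + 1) ^ 2 * mixingCoeff X P k)
    {v : EuclideanSpace ℝ (Fin p) → ℝ} (hv : Measurable v) {c : ℝ} (hc : ∀ x, |v x| ≤ c)
    (h0 : ∀ i, ∫ ω, v (X i ω) ∂P = 0) {β : ℕ → ℝ}
    (hβ : HasCovBound P (fun i ω => v (X i ω)) β) {κ : ℝ → ℝ} {K R b : ℝ} {T : ℕ}
    (hK : ∀ x, |κ x| ≤ K)
    (hrow : ∀ i < T, ∑ j ∈ Finset.range T, |κ (|(i : ℝ) - (j : ℝ)| / b)| ≤ R) :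
    ∫ ω, (quadForm κ b T (fun i => v (X i ω)) (fun i => v (X i ω)) -
      ∫ ω', quadForm κ b T (fun i => v (X i ω')) (fun i => v (X i ω')) ∂P) ^ 2 ∂P ≤
      (T : ℝ)⁻¹ * (K ^ 2 * (1152 * c ^ 4 * ∑' k : ℕ, ((k : ℝ) + 1) ^ 2 * mixingCoeff X P k) +
        2 * K * R * (2 * ∑' k, β k) ^ 2) := by
  rcases eq_or_ne T 0 with rfl | hT
  · simp [quadForm]
  have hT' : (T : ℝ) ≠ 0 := by exact_mod_cast hT
  set u : ℕ → Ω → ℝ := fun i ω => v (X i ω) with hu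
  set G : ℕ → ℕ → ℝ := fun i j => ∫ ω, u i ω * u j ω ∂P with hG
  set w : ℕ → ℕ → ℝ := fun i j => κ (|(i : ℝ) - (j : ℝ)| / b) with hw
  set Γ := 2 * ∑' k, β k with hΓ
  set S2 := ∑' k : ℕ, ((k : ℝ) + 1) ^ 2 * mixingCoeff X P k with hS2
  have hK0 : 0 ≤ K := (abs_nonneg _).trans (hK 0)
  have hc0 : 0 ≤ c := (abs_nonneg _).trans (hc 0)
  have hm : ∀ i, Measurable (u i) := fun i => hv.comp (hX i)
  have hGs : ∀ i j, G i j = G j i := fun i j => by simp only [hG, mul_comm]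
  have iu : ∀ i j, Integrable (fun ω => u i ω * u j ω) P := hβ.integrable_mul
  have iu4 : ∀ i j k l, Integrable (fun ω => (u i ω * u j ω) * (u k ω * u l ω)) P := by
    intro i j k l
    refine Integrable.of_bound (C := (c * c) * (c * c))
      (((hm i).mul (hm j)).mul ((hm k).mul (hm l))).aestronglyMeasurable
      (Eventually.of_forall fun ω => ?_)
    rw [Real.norm_eq_abs, abs_mul, abs_mul, abs_mul]
    have := fun i => hc (X i ω)
    have h' := fun i => abs_nonneg (u i ω)
    gcongr <;> exact this _
  set S := Finset.range T ×ˢ Finset.range T with hSdef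
  have hE : ∫ ω', quadForm κ b T (fun i => u i ω') (fun i => u i ω') ∂P =
      (T : ℝ)⁻¹ * ∑ q ∈ S, w q.1 q.2 * G q.1 q.2 := by
    unfold quadForm
    rw [integral_const_mul, integral_finsetSum _ fun i _ => integrable_finsetSum _ fun j _ =>
      (iu i j).mul_const _, hSdef, Finset.sum_product]
    congr 1
    refine Finset.sum_congr rfl fun i _ => ?_
    rw [integral_finsetSum _ fun j _ => (iu i j).mul_const _]
    refine Finset.sum_congr rfl fun j _ => ?_
    rw [integral_mul_const, mul_comm]
  have hQ : ∀ ω, quadForm κ b T (fun i => u i ω) (fun i => u i ω) -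
      ∫ ω', quadForm κ b T (fun i => u i ω') (fun i => u i ω') ∂P =
      (T : ℝ)⁻¹ * ∑ q ∈ S, w q.1 q.2 * (u q.1 ω * u q.2 ω - G q.1 q.2) := by
    intro ω
    rw [hE]
    simp only [mul_sub, Finset.sum_sub_distrib]
    congr 2
    unfold quadForm
    rw [hSdef, Finset.sum_product]
    exact congrArg _ (Finset.sum_congr rfl fun i _ => Finset.sum_congr rfl fun j _ =>
      mul_comm _ (w i j))
  have hcov : ∀ i j k l, ∫ ω, (u i ω * u j ω - G i j) * (u k ω * u l ω - G k l) ∂P =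
      cumulant P u ![i, j, k, l] + G i k * G j l + G i l * G j k := by
    intro i j k l
    have e1 : (fun ω => (u i ω * u j ω - G i j) * (u k ω * u l ω - G k l)) = fun ω =>
        (u i ω * u j ω) * (u k ω * u l ω) -
          (G k l * (u i ω * u j ω) + G i j * (u k ω * u l ω) - G i j * G k l) := by
      funext ω; ring
    have i1 : Integrable (fun ω => G k l * (u i ω * u j ω) + G i j * (u k ω * u l ω)) P :=
      ((iu i j).const_mul _).add ((iu k l).const_mul _)
    have i2 : Integrable (fun ω => G k l * (u i ω * u j ω) + G i j * (u k ω * u l ω) -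
      G i j * G k l) P := i1.sub (integrable_const _)
    rw [e1, integral_sub (iu4 i j k l) i2, integral_sub i1 (integrable_const _),
      integral_add ((iu i j).const_mul _) ((iu k l).const_mul _), integral_const_mul,
      integral_const_mul]
    simp only [cumulant, Fin.prod_univ_four, hG]
    simp [mul_assoc]
    ring
  have icov : ∀ q q' : ℕ × ℕ, Integrable (fun ω =>
      (u q.1 ω * u q.2 ω - G q.1 q.2) * (u q'.1 ω * u q'.2 ω - G q'.1 q'.2)) P := by
    intro q q'
    have e1 : (fun ω => (u q.1 ω * u q.2 ω - G q.1 q.2) * (u q'.1 ω * u q'.2 ω - G q'.1 q'.2)) =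
        fun ω => (u q.1 ω * u q.2 ω) * (u q'.1 ω * u q'.2 ω) -
          (G q'.1 q'.2 * (u q.1 ω * u q.2 ω) + G q.1 q.2 * (u q'.1 ω * u q'.2 ω) -
            G q.1 q.2 * G q'.1 q'.2) := by
      funext ω; ring
    rw [e1]
    exact (iu4 _ _ _ _).sub ((((iu _ _).const_mul _).add ((iu _ _).const_mul _)).sub
      (integrable_const _))
  have hsq : ∀ ω, ((T : ℝ)⁻¹ * ∑ q ∈ S, w q.1 q.2 * (u q.1 ω * u q.2 ω - G q.1 q.2)) ^ 2 =
      (T : ℝ)⁻¹ ^ 2 * ∑ q ∈ S, ∑ q' ∈ S, (w q.1 q.2 * w q'.1 q'.2) *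
        ((u q.1 ω * u q.2 ω - G q.1 q.2) * (u q'.1 ω * u q'.2 ω - G q'.1 q'.2)) := by
    intro ω
    rw [mul_pow, sq (∑ q ∈ S, _), Finset.sum_mul_sum]
    congr 1
    exact Finset.sum_congr rfl fun q _ => Finset.sum_congr rfl fun q' _ => by ring
  change ∫ ω, (quadForm κ b T (fun i => u i ω) (fun i => u i ω) -
      ∫ ω', quadForm κ b T (fun i => u i ω') (fun i => u i ω') ∂P) ^ 2 ∂P ≤ _
  simp only [hQ, hsq]
  rw [integral_const_mul, integral_finsetSum _ fun q _ => integrable_finsetSum _ fun q' _ =>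
    (icov q q').const_mul _]
  have hrowG : ∀ i < T, ∑ j ∈ Finset.range T, |G i j| ≤ Γ := fun i hi => hβ.sum_abs_row_le hi
  have hΓ0 : 0 ≤ Γ := by have := hβ.tsum_nonneg; rw [hΓ]; linarith
  -- a covariance of products is a cumulant plus two products of covariances; this bounds the latter
  have hgauss : ∀ q ∈ S, ∑ q' ∈ S, |w q'.1 q'.2| * (|G q.1 q'.1| * |G q.2 q'.2|) ≤ K * Γ ^ 2 := by
    intro q hq
    obtain ⟨h1, h2⟩ := Finset.mem_product.1 hq
    calc _ ≤ ∑ q' ∈ S, K * (|G q.1 q'.1| * |G q.2 q'.2|) :=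
          Finset.sum_le_sum fun q' _ => mul_le_mul_of_nonneg_right (hK _) (by positivity)
      _ = K * ((∑ k ∈ Finset.range T, |G q.1 k|) * ∑ l ∈ Finset.range T, |G q.2 l|) := by
          rw [← Finset.mul_sum, hSdef, Finset.sum_product, Finset.sum_mul_sum]
      _ ≤ K * (Γ * Γ) := by
          gcongr
          · exact hrowG _ (Finset.mem_range.1 h1)
          · exact hrowG _ (Finset.mem_range.1 h2)
      _ = _ := by ring
  have hwS : ∑ q ∈ S, |w q.1 q.2| ≤ T * R := by
    rw [hSdef, Finset.sum_product]
    calc _ ≤ ∑ i ∈ Finset.range T, R :=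
          Finset.sum_le_sum fun i hi => hrow i (Finset.mem_range.1 hi)
      _ = _ := by simp
  have hcum : ∑ q ∈ S, ∑ q' ∈ S, |cumulant P u ![q.1, q.2, q'.1, q'.2]| ≤ T * (1152 * c ^ 4 * S2) := by
    refine le_trans (le_of_eq ?_) (sum_abs_cumulant_le hX hs hv hc h0 T)
    rw [← Finset.sum_product']
    refine Finset.sum_nbij' (fun z => ![z.1.1, z.1.2, z.2.1, z.2.2])
      (fun x => ((x 0, x 1), (x 2, x 3))) ?_ ?_ ?_ ?_ ?_
    · intro z hz
      simp only [hSdef, Finset.mem_product] at hz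
      rw [Fintype.mem_piFinset]
      intro k
      fin_cases k
      · exact hz.1.1
      · exact hz.1.2
      · exact hz.2.1
      · exact hz.2.2
    · intro x hx
      rw [Fintype.mem_piFinset] at hx
      simp only [hSdef, Finset.mem_product]
      exact ⟨⟨hx 0, hx 1⟩, ⟨hx 2, hx 3⟩⟩
    · intro z _; rfl
    · intro x _; funext k; fin_cases k <;> rfl
    · intro z _; rfl
  have hgsum : ∑ q ∈ S, |w q.1 q.2| * (K * Γ ^ 2) ≤ T * R * (K * Γ ^ 2) := by
    rw [← Finset.sum_mul]; gcongr
  have main : ∑ q ∈ S, ∫ ω, ∑ q' ∈ S, (w q.1 q.2 * w q'.1 q'.2) *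
      ((u q.1 ω * u q.2 ω - G q.1 q.2) * (u q'.1 ω * u q'.2 ω - G q'.1 q'.2)) ∂P ≤
      K ^ 2 * (T * (1152 * c ^ 4 * S2)) + 2 * (T * R * (K * Γ ^ 2)) := by
    calc _ ≤ ∑ q ∈ S, ∑ q' ∈ S, (K ^ 2 * |cumulant P u ![q.1, q.2, q'.1, q'.2]| +
          |w q.1 q.2| * (|w q'.1 q'.2| * (|G q.1 q'.1| * |G q.2 q'.2|)) +
          |w q.1 q.2| * (|w q'.1 q'.2| * (|G q.1 q'.2| * |G q.2 q'.1|))) := by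
          refine Finset.sum_le_sum fun q _ => ?_
          rw [integral_finsetSum _ fun q' _ => (icov q q').const_mul _]
          refine Finset.sum_le_sum fun q' _ => ?_
          rw [integral_const_mul, hcov]
          refine (le_abs_self _).trans ?_
          rw [abs_mul, abs_mul]
          have t1 := abs_add_le (cumulant P u ![q.1, q.2, q'.1, q'.2] + G q.1 q'.1 * G q.2 q'.2)
            (G q.1 q'.2 * G q.2 q'.1)
          have t2 := abs_add_le (cumulant P u ![q.1, q.2, q'.1, q'.2]) (G q.1 q'.1 * G q.2 q'.2)
          rw [abs_mul (G q.1 q'.2)] at t1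
          rw [abs_mul (G q.1 q'.1)] at t2
          have t3 : |w q.1 q.2| * |w q'.1 q'.2| ≤ K ^ 2 := by
            rw [sq]; exact mul_le_mul (hK _) (hK _) (abs_nonneg _) hK0
          have t4 := mul_le_mul_of_nonneg_right t3
            (abs_nonneg (cumulant P u ![q.1, q.2, q'.1, q'.2]))
          have t5 := mul_le_mul_of_nonneg_left (t1.trans (add_le_add_left t2 _))
            (by positivity : 0 ≤ |w q.1 q.2| * |w q'.1 q'.2|)
          linarith
      _ = K ^ 2 * ∑ q ∈ S, ∑ q' ∈ S, |cumulant P u ![q.1, q.2, q'.1, q'.2]| +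
          ∑ q ∈ S, |w q.1 q.2| * ∑ q' ∈ S, |w q'.1 q'.2| * (|G q.1 q'.1| * |G q.2 q'.2|) +
          ∑ q ∈ S, |w q.1 q.2| * ∑ q' ∈ S, |w q'.1 q'.2| * (|G q.1 q'.2| * |G q.2 q'.1|) := by
          simp only [Finset.sum_add_distrib, Finset.mul_sum]
      _ ≤ K ^ 2 * (T * (1152 * c ^ 4 * S2)) + ∑ q ∈ S, |w q.1 q.2| * (K * Γ ^ 2) +
          ∑ q ∈ S, |w q.1 q.2| * (K * Γ ^ 2) := by
          refine add_le_add (add_le_add (by gcongr) ?_) ?_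
          · exact Finset.sum_le_sum fun q hq =>
              mul_le_mul_of_nonneg_left (hgauss q hq) (abs_nonneg _)
          · refine Finset.sum_le_sum fun q hq => mul_le_mul_of_nonneg_left ?_ (abs_nonneg _)
            refine le_trans (le_of_eq ?_) (hgauss (q.2, q.1) (Finset.mem_product.2
              ⟨(Finset.mem_product.1 hq).2, (Finset.mem_product.1 hq).1⟩))
            exact Finset.sum_congr rfl fun q' _ => by ring
      _ ≤ _ := by linarith
  calc _ ≤ (T : ℝ)⁻¹ ^ 2 * (K ^ 2 * (T * (1152 * c ^ 4 * S2)) + 2 * (T * R * (K * Γ ^ 2))) := by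
        gcongr
    _ = _ := by field_simp

end FourthMoments

/-! ### Spectral decomposition of the kernel -/

section Kernel

variable {k : ℝ → ℝ}

lemma continuous_cosKernel {g : ℝ → ℝ} (hg : Integrable g) : Continuous (cosKernel g) := by
  refine continuous_of_dominated (bound := fun ξ => |g ξ|)
    (fun x => (integrable_mul_cos hg x).aestronglyMeasurable) (fun x => ?_) hg.abs ?_
  · refine Eventually.of_forall fun ξ => ?_
    rw [Real.norm_eq_abs, abs_mul]
    exact mul_le_of_le_one_right (abs_nonneg _) (Real.abs_cos_le_one _)
  · exact Eventually.of_forall fun ξ => by fun_prop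

/-- Fourier inversion for an even kernel, in the cosine form. -/
lemma eq_cosKernel_of_continuousAt (hk : Integrable k)
    (hF : Integrable (𝓕 (fun x : ℝ => (k x : ℂ)))) (heven : ∀ x, k (-x) = k x) {x : ℝ}
    (hx : ContinuousAt k x) :
    k x = cosKernel (fun ξ => (𝓕 (fun x : ℝ => (k x : ℂ)) ξ).re) x := by
  set F := 𝓕 (fun x : ℝ => (k x : ℂ)) with hFd
  have hkc : Integrable fun x : ℝ => (k x : ℂ) := hk.ofReal
  have hsin : ∀ y : ℝ, Integrable fun ξ => (F ξ).im * Real.sin (2 * Real.pi * y * ξ) := fun y =>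
    hF.im.mul_bdd (c := 1) (by fun_prop)
      (Eventually.of_forall fun ξ => by simpa using Real.abs_sin_le_one _)
  have key : ∀ y, ContinuousAt k y → k y = ∫ ξ, ((F ξ).re * Real.cos (2 * Real.pi * y * ξ) -
      (F ξ).im * Real.sin (2 * Real.pi * y * ξ)) := by
    intro y hy
    have h := hkc.fourierInv_fourier_eq hF
      (v := y) (Complex.continuous_ofReal.continuousAt.comp hy)
    rw [Real.fourierInv_eq'] at h
    have h2 := congrArg Complex.re h
    rw [Complex.ofReal_re] at h2
    rw [← h2, ← RCLike.re_eq_complex_re, ← integral_re]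
    · refine integral_congr_ae (Eventually.of_forall fun ξ => ?_)
      simp only [RCLike.re_eq_complex_re, smul_eq_mul, Complex.mul_re, Complex.exp_ofReal_mul_I_re,
        Complex.exp_ofReal_mul_I_im, RCLike.inner_apply, conj_trivial]
      rw [show 2 * Real.pi * (y * ξ) = 2 * Real.pi * y * ξ by ring]
      ring
    · refine hF.bdd_mul (c := 1) (by fun_prop) (Eventually.of_forall fun ξ => ?_)
      rw [Complex.norm_exp_ofReal_mul_I]
  have hx' : ContinuousAt k (-x) := by
    have e : k = k ∘ Neg.neg := by funext y; exact (heven y).symm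
    rw [e]
    refine ContinuousAt.comp ?_ continuous_neg.continuousAt
    simpa using hx
  have h1 := key x hx
  have h2 := key (-x) hx'
  have hcos := fun y => integrable_mul_cos hF.re y
  simp only [RCLike.re_eq_complex_re] at hcos
  rw [integral_sub (hcos x) (hsin x)] at h1
  rw [heven, integral_sub (hcos (-x)) (hsin (-x))] at h2
  have e1 : ∀ ξ, -(2 * Real.pi * x) * ξ = -(2 * Real.pi * x * ξ) := fun ξ => by ring
  simp only [mul_neg] at h2
  simp only [e1, Real.cos_neg, Real.sin_neg, mul_neg, integral_neg] at h2
  unfold cosKernel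
  linarith

/-- The cosine transform of a smooth compactly supported function decays quadratically, being the
real part of the Fourier transform of a Schwartz function. -/
lemma exists_cosKernel_decay {g : ℝ → ℝ} (h1 : HasCompactSupport g)
    (h2 : ContDiff ℝ ((⊤ : ℕ∞) : WithTop ℕ∞) g) :
    ∃ C, 0 ≤ C ∧ ∀ x, |cosKernel g x| ≤ C / (1 + x ^ 2) := by
  set G : ℝ → ℂ := fun x => (g x : ℂ) with hG
  have hG1 : HasCompactSupport G := h1.comp_left (g := fun x : ℝ => (x : ℂ)) Complex.ofReal_zero
  have hG2 : ContDiff ℝ ((⊤ : ℕ∞) : WithTop ℕ∞) G := Complex.ofRealCLM.contDiff.comp h2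
  set S := hG1.toSchwartzMap hG2 with hS
  obtain ⟨C0, hC0p, hC0⟩ := (𝓕 S).decay 0 0
  obtain ⟨C2, hC2p, hC2⟩ := (𝓕 S).decay 2 0
  have hre : ∀ x, cosKernel g x = (𝓕 S x).re := by
    intro x
    have hcoe : ((𝓕 S : SchwartzMap ℝ ℂ) : ℝ → ℂ) = 𝓕 G := by rw [SchwartzMap.fourier_coe]; rfl
    rw [hcoe, Real.fourier_eq', ← RCLike.re_eq_complex_re,
      ← integral_re]
    · refine integral_congr_ae (Eventually.of_forall fun ξ => ?_)
      simp only [RCLike.re_eq_complex_re, smul_eq_mul, Complex.mul_re, Complex.exp_ofReal_mul_I_re,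
        RCLike.inner_apply, conj_trivial, hG, Complex.ofReal_re, Complex.ofReal_im]
      rw [show -2 * Real.pi * (x * ξ) = -(2 * Real.pi * x * ξ) by ring, Real.cos_neg]
      ring
    · have hGi : Integrable G := S.integrable
      refine hGi.bdd_mul (c := 1) (by fun_prop) (Eventually.of_forall fun ξ => ?_)
      rw [Complex.norm_exp_ofReal_mul_I]
  refine ⟨C0 + C2, by positivity, fun x => ?_⟩
  rw [le_div_iff₀ (by positivity), hre]
  have a0 := hC0 x
  have a2 := hC2 x
  rw [norm_iteratedFDeriv_zero] at a0 a2
  rw [Real.norm_eq_abs, sq_abs] at a2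
  have a3 := Complex.abs_re_le_norm (𝓕 S x)
  nlinarith [sq_nonneg x]

/-- The kernel splits into a part that decays quadratically and a part whose spectral density has
arbitrarily small `L¹` norm. The values at the discontinuities are absorbed into the first part. -/
lemma IsKernelBandwidth.exists_decomposition {b : ℕ → ℝ} (hk : IsKernelBandwidth k b) {ε : ℝ}
    (hε : 0 < ε) :
    ∃ (κ g : ℝ → ℝ) (C : ℝ), k = κ + cosKernel g ∧ Integrable g ∧ ∫ ξ, |g ξ| ≤ ε ∧ 0 ≤ C ∧
      (∀ x, |κ x| ≤ C / (1 + x ^ 2)) ∧ ContinuousAt κ 0 ∧ |κ 0 - 1| ≤ ε := by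
  set g₀ : ℝ → ℝ := fun ξ => (𝓕 (fun x : ℝ => (k x : ℂ)) ξ).re with hg₀
  have ig₀ : Integrable g₀ := hk.integrable_fourier.re
  obtain ⟨g₁, s₁, c₁, h₁⟩ := MemLp.exist_eLpNorm_sub_le (p := 1) (by simp) le_rfl
    (memLp_one_iff_integrable.2 ig₀) hε
  have ig₁ : Integrable g₁ := c₁.continuous.integrable_of_hasCompactSupport s₁
  obtain ⟨C₁, hC₁, hdec⟩ := exists_cosKernel_decay s₁ c₁
  set g := g₀ - g₁ with hg
  have ig : Integrable g := ig₀.sub ig₁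
  have hgε : ∫ ξ, |g ξ| ≤ ε := by
    have h := integral_norm_eq_lintegral_enorm ig.aestronglyMeasurable
    simp only [Real.norm_eq_abs] at h
    rw [h]
    refine ENNReal.toReal_le_of_le_ofReal hε.le ?_
    rwa [eLpNorm_one_eq_lintegral_enorm] at h₁
  set D := hk.finite_discontinuities.toFinset with hD
  have hDk : ∀ x, x ∉ D → k x = cosKernel g₀ x := fun x hx =>
    eq_cosKernel_of_continuousAt hk.integrable hk.integrable_fourier hk.even (by simpa [hD] using hx)
  have hcg : ∀ x, |cosKernel g x| ≤ ε := fun x => (abs_cosKernel_le g ig x).trans hgε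
  set A := ∑ y ∈ D, (1 + y ^ 2) with hA
  have hA0 : 0 ≤ A := Finset.sum_nonneg fun y _ => by positivity
  refine ⟨fun x => k x - cosKernel g x, g, C₁ + (1 + ε) * A, ?_, ig, hgε, by positivity, ?_, ?_, ?_⟩
  · funext x; simp
  · intro x
    by_cases hx : x ∈ D
    · rw [le_div_iff₀ (by positivity)]
      have h1 : |k x - cosKernel g x| ≤ 1 + ε :=
        (abs_sub _ _).trans (add_le_add (hk.abs_le_one x) (hcg x))
      have h2 : 1 + x ^ 2 ≤ A := Finset.single_le_sum (f := fun y : ℝ => 1 + y ^ 2)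
        (fun y _ => by positivity) hx
      have := mul_le_mul h1 h2 (by positivity) (by positivity)
      linarith
    · show |k x - cosKernel g x| ≤ _
      rw [hDk x hx, hg, cosKernel_sub ig₀ ig₁, sub_sub_cancel]
      refine (hdec x).trans ?_
      gcongr
      have : 0 ≤ (1 + ε) * A := by positivity
      linarith
  · exact hk.continuousAt_zero.sub (continuous_cosKernel ig).continuousAt
  · show |k 0 - cosKernel g 0 - 1| ≤ ε
    rw [hk.map_zero]
    simpa using hcg 0

lemma IsKernelBandwidth.tendsto_div {b : ℕ → ℝ} (hk : IsKernelBandwidth k b) :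
    Tendsto (fun T : ℕ => b T / T) atTop (𝓝 0) := by
  obtain ⟨ε, hε, h⟩ := hk.bandwidth_rate
  have h2 : Tendsto (fun T : ℕ => ((T : ℝ) ^ (-ε))) atTop (𝓝 0) :=
    (tendsto_rpow_neg_atTop hε).comp tendsto_natCast_atTop_atTop
  have h3 := h.mul h2
  rw [mul_zero] at h3
  refine h3.congr' ?_
  filter_upwards [eventually_gt_atTop 0] with T hT
  have hT' : (0 : ℝ) < T := by exact_mod_cast hT
  rw [div_mul_eq_mul_div, div_eq_div_iff (by positivity) (by positivity), mul_assoc]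
  congr 1
  rw [← Real.rpow_add_one hT'.ne']
  congr 1; ring

end Kernel

/-! ### Consistency of the kernel estimator for a bounded function of the sequence -/

section Consistency

/-- Summation of a function of the lag over a square, diagonal by diagonal. -/
lemma sum_dist_eq (F : ℕ → ℝ) (T : ℕ) :
    ∑ i ∈ Finset.range T, ∑ j ∈ Finset.range T, F (Nat.dist i j) =
      T * F 0 + 2 * ∑ h ∈ Finset.range T, ((T : ℝ) - (h + 1)) * F (h + 1) := by
  induction T with
  | zero => simp
  | succ n ih =>
    simp only [Finset.sum_range_succ, Finset.sum_add_distrib]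
    rw [ih]
    have h1 : ∑ j ∈ Finset.range n, F (Nat.dist n j) = ∑ h ∈ Finset.range n, F (h + 1) := by
      rw [← Finset.sum_range_reflect]
      refine Finset.sum_congr rfl fun j hj => ?_
      have hj' := Finset.mem_range.1 hj
      rw [Nat.dist_eq_sub_of_le_right (by omega)]
      congr 1; omega
    have h2 : ∑ i ∈ Finset.range n, F (Nat.dist i n) = ∑ h ∈ Finset.range n, F (h + 1) := by
      rw [← h1]; exact Finset.sum_congr rfl fun i _ => by rw [Nat.dist_comm]
    rw [h1, h2, Nat.dist_self]
    have h3 : ∑ h ∈ Finset.range n, (((n + 1 : ℕ) : ℝ) - (h + 1)) * F (h + 1) =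
        ∑ h ∈ Finset.range n, ((n : ℝ) - (h + 1)) * F (h + 1) + ∑ h ∈ Finset.range n, F (h + 1) := by
      rw [← Finset.sum_add_distrib]
      exact Finset.sum_congr rfl fun h _ => by push_cast; ring
    rw [h3]
    push_cast
    ring

/-- The Cesàro weights `1 - h / T` and the kernel weights `κ (h / b_T)` disappear in the limit. -/
lemma tendsto_weighted_sum {γ β : ℕ → ℝ} (hγ : ∀ h, |γ h| ≤ β h) (hβ : Summable β)
    {κ : ℝ → ℝ} {K : ℝ} (hK : ∀ x, |κ x| ≤ K) (hκ : ContinuousAt κ 0) {b : ℕ → ℝ}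
    (hb : Tendsto b atTop atTop) :
    Tendsto (fun T : ℕ => (T : ℝ)⁻¹ * ∑ i ∈ Finset.range T, ∑ j ∈ Finset.range T,
      γ (Nat.dist i j) * κ (|(i : ℝ) - (j : ℝ)| / b T)) atTop
      (𝓝 (κ 0 * (γ 0 + 2 * ∑' h, γ (h + 1)))) := by
  have hK0 : 0 ≤ K := (abs_nonneg _).trans (hK 0)
  have hκlim : ∀ h : ℕ, Tendsto (fun T => κ ((h : ℝ) / b T)) atTop (𝓝 (κ 0)) := fun h =>
    hκ.tendsto.comp (tendsto_const_nhds.div_atTop hb)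
  have htan : Tendsto (fun T : ℕ => ∑' h : ℕ, if h < T then
      (1 - ((h : ℝ) + 1) / T) * (γ (h + 1) * κ (((h + 1 : ℕ) : ℝ) / b T)) else 0) atTop
      (𝓝 (∑' h, γ (h + 1) * κ 0)) := by
    refine tendsto_tsum_of_dominated_convergence (bound := fun h => β (h + 1) * K)
      (((summable_nat_add_iff 1).2 hβ).mul_right K) (fun h => ?_) ?_
    · have h1 : Tendsto (fun T : ℕ => 1 - ((h : ℝ) + 1) / T) atTop (𝓝 (1 - 0)) :=
        tendsto_const_nhds.sub (tendsto_const_nhds.div_atTop tendsto_natCast_atTop_atTop)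
      have h2 := h1.mul ((hκlim (h + 1)).const_mul (γ (h + 1)))
      rw [sub_zero, one_mul] at h2
      refine h2.congr' ?_
      filter_upwards [eventually_gt_atTop h] with T hT
      rw [if_pos hT]
    · refine Eventually.of_forall fun T h => ?_
      have hb0 : 0 ≤ β (h + 1) := (abs_nonneg _).trans (hγ _)
      split_ifs with hT
      · have hT' : (0 : ℝ) < T := by exact_mod_cast (by omega : 0 < T)
        have h1 : ((h : ℝ) + 1) / T ≤ 1 := by
          rw [div_le_one hT']; exact_mod_cast hT
        have h2 : 0 ≤ ((h : ℝ) + 1) / T := by positivity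
        rw [Real.norm_eq_abs, abs_mul, abs_mul]
        calc _ ≤ 1 * (β (h + 1) * K) := by
              gcongr
              · rw [abs_le]; constructor <;> linarith
              · exact hγ _
              · exact hK _
          _ = _ := one_mul _
      · rw [norm_zero]; positivity
  have h0 : Tendsto (fun T : ℕ => γ 0 * κ 0 + 2 * ∑' h : ℕ, if h < T then
      (1 - ((h : ℝ) + 1) / T) * (γ (h + 1) * κ (((h + 1 : ℕ) : ℝ) / b T)) else 0) atTop
      (𝓝 (γ 0 * κ 0 + 2 * ∑' h, γ (h + 1) * κ 0)) := tendsto_const_nhds.add (htan.const_mul 2)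
  rw [tsum_mul_right] at h0
  have e : γ 0 * κ 0 + 2 * ((∑' h, γ (h + 1)) * κ 0) = κ 0 * (γ 0 + 2 * ∑' h, γ (h + 1)) := by ring
  rw [e] at h0
  refine h0.congr' ?_
  filter_upwards [eventually_gt_atTop 0] with T hT
  have hT' : (T : ℝ) ≠ 0 := by positivity
  have h1 := sum_dist_eq (fun h => γ h * κ ((h : ℝ) / b T)) T
  simp only [natCast_dist]
  rw [h1]
  have h2 : (∑' h : ℕ, if h < T then
      (1 - ((h : ℝ) + 1) / T) * (γ (h + 1) * κ (((h + 1 : ℕ) : ℝ) / b T)) else 0) =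
      ∑ h ∈ Finset.range T, if h < T then
      (1 - ((h : ℝ) + 1) / T) * (γ (h + 1) * κ (((h + 1 : ℕ) : ℝ) / b T)) else 0 :=
    tsum_eq_sum fun h hh => if_neg (by simpa using hh)
  rw [h2, mul_add, mul_left_comm _ (2 : ℝ)]
  rw [Finset.mul_sum (Finset.range T) (fun h : ℕ => _) (T : ℝ)⁻¹]
  refine congrArg₂ (· + ·) (by simp [hT']) (congrArg (fun x : ℝ => 2 * x) ?_)
  · refine Finset.sum_congr rfl fun h hh => ?_
    rw [if_pos (Finset.mem_range.1 hh)]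
    field_simp

variable {Ω : Type*} [MeasurableSpace Ω] {P : Measure Ω} {p : ℕ}
  {X : ℕ → Ω → EuclideanSpace ℝ (Fin p)}

/-- The autocovariance at lag `h` of the sequence `f(X_t)`. -/
noncomputable def scalarAutocov (X : ℕ → Ω → EuclideanSpace ℝ (Fin p)) (P : Measure Ω)
    (f : EuclideanSpace ℝ (Fin p) → ℝ) (h : ℕ) : ℝ :=
  ∫ ω, (f (X 0 ω) - ∫ ω', f (X 0 ω') ∂P) * (f (X h ω) - ∫ ω', f (X 0 ω') ∂P) ∂P

variable [IsProbabilityMeasure P]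

lemma summable_scalarAutocov (hX : ∀ t, Measurable (X t)) (hstat : IsStrictlyStationary X P)
    (hmix : Summable fun k : ℕ => (k : ℝ) ^ 2 * mixingCoeff X P k)
    {f : EuclideanSpace ℝ (Fin p) → ℝ} (hf : Measurable f) {c : ℝ} (hc : ∀ x, |f x| ≤ c) :
    Summable (scalarAutocov X P f) := by
  have h := hasCovBound_of_bounded hX hstat hmix hf hc le_rfl
  refine Summable.of_norm_bounded h.summable fun k => ?_
  have := h.abs_integral_le 0 k
  rwa [Nat.dist_eq_sub_of_le (Nat.zero_le _), Nat.sub_zero] at this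

lemma summable_succ_sq_mixingCoeff
    (hmix : Summable fun k : ℕ => (k : ℝ) ^ 2 * mixingCoeff X P k) :
    Summable fun k : ℕ => ((k : ℝ) + 1) ^ 2 * mixingCoeff X P k := by
  rw [← summable_nat_add_iff 1] at hmix ⊢
  refine (hmix.mul_left 4).of_nonneg_of_le
    (fun k => mul_nonneg (by positivity) (mixingCoeff_nonneg _)) fun k => ?_
  rw [← mul_assoc]
  refine mul_le_mul_of_nonneg_right ?_ (mixingCoeff_nonneg _)
  have : (0 : ℝ) ≤ k := k.cast_nonneg
  push_cast
  nlinarith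

/-- `L¹` consistency of the kernel estimator for a bounded function of the sequence. -/
theorem eventually_integral_abs_quadForm_sub_le (hX : ∀ t, Measurable (X t))
    (hstat : IsStrictlyStationary X P)
    (hmix : Summable fun k : ℕ => (k : ℝ) ^ 2 * mixingCoeff X P k)
    {f : EuclideanSpace ℝ (Fin p) → ℝ} (hf : Measurable f) {c : ℝ} (hc : ∀ x, |f x| ≤ c)
    {k : ℝ → ℝ} {b : ℕ → ℝ} (hk : IsKernelBandwidth k b) {ε : ℝ} (hε : 0 < ε) :
    ∀ᶠ T : ℕ in atTop, ∫ ω, |quadForm k (b T) T (center T fun i => f (X i ω))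
      (center T fun i => f (X i ω)) -
      (scalarAutocov X P f 0 + 2 * ∑' h, scalarAutocov X P f (h + 1))| ∂P ≤ ε := by
  set e := ∫ ω, f (X 0 ω) ∂P with he
  set γ := scalarAutocov X P f with hγ
  set L := γ 0 + 2 * ∑' h, γ (h + 1) with hL
  set v : EuclideanSpace ℝ (Fin p) → ℝ := fun x => f x - e with hv
  have hvm : Measurable v := hf.sub_const _
  have hcov := hasCovBound_of_bounded hX hstat hmix hf hc le_rfl
  set β : ℕ → ℝ := fun h => Real.sqrt (8 * c ^ 3 * ∫ ω, |f (X 0 ω)| ∂P) *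
    Real.sqrt (mixingCoeff X P h) with hβ
  have hu : HasCovBound P (fun i ω => v (X i ω)) β := hcov
  set B := ∑' h, β h with hB
  have hB0 : 0 ≤ B := hu.tsum_nonneg
  have hec : |e| ≤ c := by
    have := abs_integral_le_integral_abs (f := fun ω => f (X 0 ω)) (μ := P)
    refine this.trans ?_
    calc _ ≤ ∫ _, c ∂P := integral_mono_of_nonneg (Eventually.of_forall fun _ => abs_nonneg _)
          (integrable_const _) (Eventually.of_forall fun ω => hc _)
      _ = c := by simp
  have hvc : ∀ x, |v x| ≤ 2 * c := fun x => by
    have := abs_sub (f x) e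
    have := hc x
    simp only [hv]; linarith
  have hv0 : ∀ i, ∫ ω, v (X i ω) ∂P = 0 := by
    intro i
    simp only [hv]
    have i1 : Integrable (fun ω => f (X i ω)) P :=
      Integrable.of_bound (hf.comp (hX i)).aestronglyMeasurable c
        (Eventually.of_forall fun ω => by simpa using hc _)
    rw [integral_sub i1 (integrable_const _), integral_comp_eq hX hstat hf]
    simp [he]
  have hpair : ∀ i j, ∫ ω, v (X i ω) * v (X j ω) ∂P = γ (Nat.dist i j) := fun i j =>
    integral_mul_comp_eq hX hstat hvm i j
  have hγβ : ∀ h, |γ h| ≤ β h := fun h => by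
    have := hu.abs_integral_le 0 h
    rwa [Nat.dist_eq_sub_of_le (Nat.zero_le _), Nat.sub_zero] at this
  -- choose the accuracy of the spectral decomposition
  set ε₀ := ε / (2 * (8 * B + |L| + 1)) with hε₀
  have hden : 0 < 8 * B + |L| + 1 := by positivity
  have hε₀p : 0 < ε₀ := by positivity
  have hε₀2 : 8 * ε₀ * B + ε₀ * |L| ≤ ε / 2 := by
    have : ε₀ * (8 * B + |L| + 1) = ε / 2 := by rw [hε₀]; field_simp
    nlinarith
  obtain ⟨κ, g, C, hkκ, hg, hgε, hC0, hκC, hκ0, hκ1⟩ := hk.exists_decomposition hε₀p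
  have hκK : ∀ x, |κ x| ≤ C := fun x => (hκC x).trans (div_le_self hC0 (by nlinarith [sq_nonneg x]))
  set S2 := ∑' k : ℕ, ((k : ℝ) + 1) ^ 2 * mixingCoeff X P k
  set A := C ^ 2 * (1152 * (2 * c) ^ 4 * S2) with hA
  set s := ε / 12 with hs
  have hsp : 0 < s := by positivity
  -- the limits that are used
  have lim1 := tendsto_weighted_sum hγβ hu.summable hκK hκ0 hk.bandwidth_tendsto
  have lim2 : Tendsto (fun T : ℕ => 6 * B * (8 * (C + 1) * (b T / T))) atTop (𝓝 0) := by
    simpa using (hk.tendsto_div.const_mul (8 * (C + 1))).const_mul (6 * B)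
  have lim3 : Tendsto (fun T : ℕ => A * (T : ℝ)⁻¹ + 2 * C * (8 * (C + 1)) * (2 * B) ^ 2 * (b T / T))
      atTop (𝓝 0) := by
    simpa using ((tendsto_natCast_atTop_atTop (R := ℝ)).inv_tendsto_atTop.const_mul A).add
      (hk.tendsto_div.const_mul (2 * C * (8 * (C + 1)) * (2 * B) ^ 2))
  filter_upwards [eventually_gt_atTop 0, hk.bandwidth_tendsto.eventually_ge_atTop 2,
    (Metric.tendsto_nhds.1 lim1 s hsp), lim2.eventually_le_const hsp,
    lim3.eventually_le_const (by positivity : 0 < s ^ 2)] with T hT0 hbT h1 h2 h3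
  have hT : T ≠ 0 := hT0.ne'
  have hT' : (T : ℝ) ≠ 0 := by exact_mod_cast hT
  have hcen : ∀ ω, (center T fun i => f (X i ω)) = center T fun i => v (X i ω) := by
    intro ω
    rw [← center_add_const hT (fun i => v (X i ω)) e]
    simp [hv]
  have hrow : ∀ i < T, ∑ j ∈ Finset.range T, |κ (|(i : ℝ) - (j : ℝ)| / b T)| ≤
      8 * (C + 1) * b T := fun i hi =>
    (sum_kernel_le hC0 hκC hbT hi).trans (by nlinarith)
  have hRp : 0 < 8 * (C + 1) * b T := by positivity
  set m := ∫ ω, quadForm κ (b T) T (fun i => v (X i ω)) (fun i => v (X i ω)) ∂P with hm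
  set Qc : Ω → ℝ := fun ω => quadForm κ (b T) T (center T fun i => v (X i ω))
    (center T fun i => v (X i ω)) with hQc
  set Q : Ω → ℝ := fun ω => quadForm κ (b T) T (fun i => v (X i ω)) (fun i => v (X i ω)) with hQ
  set N : Ω → ℝ := fun ω => spectralEnergy g (b T) T (center T fun i => v (X i ω)) with hN
  have iQc : Integrable Qc P :=
    integrable_quadForm (measurable_center hu.measurable T) (measurable_center hu.measurable T)
      (bounded_center hu.bounded T) (bounded_center hu.bounded T) _ _ T
  have iQ : Integrable Q P :=
    integrable_quadForm hu.measurable hu.measurable hu.bounded hu.bounded _ _ T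
  have iN : Integrable N P :=
    integrable_quadForm (measurable_center hu.measurable T) (measurable_center hu.measurable T)
      (bounded_center hu.bounded T) (bounded_center hu.bounded T) _ _ T
  have iQ2 : Integrable (fun ω => (Q ω - m) ^ 2) P := by
    have hQm : Measurable Q := measurable_const.mul (Finset.measurable_sum _ fun i _ =>
      Finset.measurable_sum _ fun j _ => ((hu.measurable i).mul (hu.measurable j)).mul_const _)
    have hQb : ∀ ω, |Q ω| ≤ T * ((2 * c) * (2 * c) * C) := by
      intro ω
      have hc0 : 0 ≤ 2 * c := (abs_nonneg _).trans (hvc 0)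
      rw [hQ]; simp only [quadForm]
      rw [abs_mul, abs_of_nonneg (by positivity : (0 : ℝ) ≤ (T : ℝ)⁻¹)]
      have : |∑ i ∈ Finset.range T, ∑ j ∈ Finset.range T,
          v (X i ω) * v (X j ω) * κ (|(i : ℝ) - (j : ℝ)| / b T)| ≤
          ∑ i ∈ Finset.range T, ∑ j ∈ Finset.range T, (2 * c) * (2 * c) * C := by
        refine (Finset.abs_sum_le_sum_abs _ _).trans (Finset.sum_le_sum fun i _ =>
          (Finset.abs_sum_le_sum_abs _ _).trans (Finset.sum_le_sum fun j _ => ?_))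
        rw [abs_mul, abs_mul]
        gcongr
        · exact hvc _
        · exact hvc _
        · exact hκK _
      simp only [Finset.sum_const, Finset.card_range, nsmul_eq_mul] at this
      calc _ ≤ (T : ℝ)⁻¹ * (T * (T * ((2 * c) * (2 * c) * C))) := by gcongr
        _ = _ := by field_simp
    refine Integrable.of_bound (C := (T * ((2 * c) * (2 * c) * C) + |m|) ^ 2)
      ((hQm.sub_const m).pow_const 2).aestronglyMeasurable (Eventually.of_forall fun ω => ?_)
    rw [norm_pow, Real.norm_eq_abs]
    exact pow_le_pow_left₀ (abs_nonneg _) ((abs_sub _ _).trans (by gcongr; exact hQb ω)) 2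
  have b1 : ∫ ω, |Qc ω - Q ω| ∂P ≤ s := by
    refine (hu.integral_abs_quadForm_center_sub_le hRp hrow).trans (le_trans (le_of_eq ?_) h2)
    ring
  have b2 : ∫ ω, (Q ω - m) ^ 2 ∂P ≤ s ^ 2 := by
    refine (integral_sq_quadForm_sub_le hX (summable_succ_sq_mixingCoeff hmix) hvm hvc hv0 hu hκK
      hrow).trans (le_trans (le_of_eq ?_) h3)
    rw [hA]; ring
  have b3 : ∫ ω, N ω ∂P ≤ 8 * ε₀ * B :=
    (hu.integral_spectralEnergy_center_le hg (b T) hT).trans (by gcongr)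
  have b4 : |m - κ 0 * L| ≤ s := by
    refine le_of_eq_of_le ?_ h1.le
    rw [Real.dist_eq]
    congr 2
    rw [hm, hQ]; simp only [quadForm]
    rw [integral_const_mul, integral_finsetSum _ fun i _ => integrable_finsetSum _ fun j _ =>
      (hu.integrable_mul i j).mul_const _]
    congr 1
    refine Finset.sum_congr rfl fun i _ => ?_
    rw [integral_finsetSum _ fun j _ => (hu.integrable_mul i j).mul_const _]
    refine Finset.sum_congr rfl fun j _ => ?_
    rw [integral_mul_const, hpair]
  have b5 : |κ 0 * L - L| ≤ ε₀ * |L| := by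
    rw [show κ 0 * L - L = (κ 0 - 1) * L by ring, abs_mul]
    gcongr
  have hpt : ∀ ω, |quadForm k (b T) T (center T fun i => f (X i ω)) (center T fun i => f (X i ω)) -
      L| ≤ |Qc ω - Q ω| + s⁻¹ * (Q ω - m) ^ 2 + N ω + (3 * s + ε₀ * |L|) := by
    intro ω
    rw [hcen, hkκ, quadForm_add_kernel]
    have t1 := abs_quadForm_cosKernel_self_le (b := b T) (T := T) hg (center T fun i => v (X i ω))
    -- the variance bound enters through the square of `Q - m`
    have t2 : |Q ω - m| ≤ s + s⁻¹ * (Q ω - m) ^ 2 := by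
      have : 0 ≤ s⁻¹ * (|Q ω - m| - s) ^ 2 := by positivity
      have e1 : s⁻¹ * (|Q ω - m| - s) ^ 2 = s⁻¹ * |Q ω - m| ^ 2 - 2 * |Q ω - m| + s := by
        field_simp; ring
      rw [e1, sq_abs] at this
      have := abs_nonneg (Q ω - m)
      linarith
    change |Qc ω + quadForm (cosKernel g) (b T) T _ _ - L| ≤ _
    set z := quadForm (cosKernel g) (b T) T (center T fun i => v (X i ω))
      (center T fun i => v (X i ω))
    have e2 : Qc ω + z - L = (Qc ω - Q ω) + (Q ω - m) + z + (m - κ 0 * L) + (κ 0 * L - L) := by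
      ring
    rw [e2]
    have a1 := abs_add_le ((Qc ω - Q ω) + (Q ω - m) + z + (m - κ 0 * L)) (κ 0 * L - L)
    have a2 := abs_add_le ((Qc ω - Q ω) + (Q ω - m) + z) (m - κ 0 * L)
    have a3 := abs_add_le ((Qc ω - Q ω) + (Q ω - m)) z
    have a4 := abs_add_le (Qc ω - Q ω) (Q ω - m)
    change |z| ≤ N ω at t1
    linarith
  have i0 : Integrable (fun ω => |Qc ω - Q ω|) P := (iQc.sub iQ).abs
  have i1 : Integrable (fun ω => |Qc ω - Q ω| + s⁻¹ * (Q ω - m) ^ 2) P :=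
    i0.add (iQ2.const_mul _)
  have i2 : Integrable (fun ω => |Qc ω - Q ω| + s⁻¹ * (Q ω - m) ^ 2 + N ω) P := i1.add iN
  have i3 : Integrable (fun ω => |Qc ω - Q ω| + s⁻¹ * (Q ω - m) ^ 2 + N ω +
    (3 * s + ε₀ * |L|)) P := i2.add (integrable_const _)
  refine (integral_mono_of_nonneg (Eventually.of_forall fun _ => abs_nonneg _) i3
    (Eventually.of_forall hpt)).trans ?_
  rw [integral_add i2 (integrable_const _), integral_add i1 iN,
    integral_add i0 (iQ2.const_mul _), integral_const_mul, integral_const]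
  simp only [probReal_univ, one_smul]
  have b2' : s⁻¹ * ∫ ω, (Q ω - m) ^ 2 ∂P ≤ s := by
    calc _ ≤ s⁻¹ * s ^ 2 := by gcongr
      _ = s := by field_simp
  have : 6 * s = ε / 2 := by rw [hs]; ring
  linarith

end Consistency

/-! ### The modulus of continuity of the transformation under small perturbations -/

section Modulus

variable {p s : ℕ}

/-- A mean value inequality with countably many exceptional points. -/
lemma abs_sub_le_of_deriv_bound_off_countable {f : ℝ → ℝ} {D : ℝ} {N : Set ℝ} (hN : N.Countable)
    (hf : ContinuousOn f (Set.Icc 0 1))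
    (hd : ∀ t ∈ Set.Ioo (0 : ℝ) 1 \ N, DifferentiableAt ℝ f t ∧ |deriv f t| ≤ D) :
    |f 1 - f 0| ≤ D := by
  have hae : ∀ᵐ t : ℝ, t ∈ Set.uIoc (0 : ℝ) 1 → ‖deriv f t‖ ≤ D := by
    have h1 : ∀ᵐ t : ℝ, t ∉ N := hN.ae_notMem volume
    have h2 : ∀ᵐ t : ℝ, t ≠ 1 := by simp [ae_iff]
    filter_upwards [h1, h2] with t h1 h2 ht
    rw [Set.uIoc_of_le zero_le_one] at ht
    exact (hd t ⟨⟨ht.1, lt_of_le_of_ne ht.2 h2⟩, h1⟩).2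
  have hi : IntervalIntegrable (deriv f) volume 0 1 := by
    rw [intervalIntegrable_iff]
    refine Measure.integrableOn_of_bounded (M := D) (by simp)
      (measurable_deriv f).aestronglyMeasurable ?_
    rwa [ae_restrict_iff' measurableSet_uIoc]
  rw [← integral_eq_of_hasDerivAt_off_countable_of_le f (deriv f) zero_le_one hN hf
    (fun t ht => (hd t ht).1.hasDerivAt) hi]
  simpa using intervalIntegral.norm_integral_le_of_norm_le_const_ae hae

lemma abs_apply_le_norm (x : EuclideanSpace ℝ (Fin p)) (j : Fin p) : |x j| ≤ ‖x‖ :=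
  PiLp.norm_apply_le x j

lemma norm_le_sum_abs (x : EuclideanSpace ℝ (Fin p)) : ‖x‖ ≤ ∑ j, |x j| := by
  rw [EuclideanSpace.norm_eq]
  refine Real.sqrt_le_iff.2 ⟨Finset.sum_nonneg fun _ _ => abs_nonneg _, ?_⟩
  simp only [Real.norm_eq_abs]
  exact Finset.sum_sq_le_sq_sum_of_nonneg fun _ _ => abs_nonneg _

/-- The perturbations produced by a change of location and scale: the error in each coordinate is
small relative to `1 + |z'_j|`. -/
def IsRelClose (r : ℝ) (z z' : EuclideanSpace ℝ (Fin p)) : Prop :=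
  ∀ j, |z j - z' j| ≤ r * (1 + |z' j|)

namespace IsRelClose

variable {r : ℝ} {z z' : EuclideanSpace ℝ (Fin p)}

lemma segment (h : IsRelClose r z z') {t : ℝ} (h0 : 0 ≤ t) (h1 : t ≤ 1) :
    IsRelClose r (z' + t • (z - z')) z' := by
  intro j
  have : (z' + t • (z - z')) j - z' j = t * (z j - z' j) := by simp
  rw [this, abs_mul, abs_of_nonneg h0]
  exact (mul_le_of_le_one_left (abs_nonneg _) h1).trans (h j)

lemma norm_sub_le (h : IsRelClose r z z') (hr : 0 ≤ r) : ‖z - z'‖ ≤ r * p * (1 + ‖z'‖) := by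
  refine (norm_le_sum_abs _).trans ?_
  calc _ ≤ ∑ _j : Fin p, r * (1 + ‖z'‖) := by
        refine Finset.sum_le_sum fun j _ => (h j).trans ?_
        gcongr
        exact abs_apply_le_norm _ _
    _ = _ := by simp; ring

end IsRelClose

variable {Ψ : EuclideanSpace ℝ (Fin p) → Fin s → ℝ}

lemma abs_fderiv_apply_le_sum (x y : EuclideanSpace ℝ (Fin p)) (i : Fin s) :
    |fderiv ℝ Ψ x y i| ≤ ∑ j, |fderiv ℝ Ψ x (EuclideanSpace.single j 1) i| * |y j| := by
  have hy : y = ∑ j, y j • EuclideanSpace.single j (1 : ℝ) := by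
    simpa using ((EuclideanSpace.basisFun (Fin p) ℝ).sum_repr y).symm
  conv_lhs => rw [hy]
  rw [map_sum, Finset.sum_apply]
  refine (Finset.abs_sum_le_sum_abs _ _).trans (le_of_eq ?_)
  refine Finset.sum_congr rfl fun j _ => ?_
  rw [map_smul, Pi.smul_apply, smul_eq_mul, abs_mul, mul_comm]

/-- The mean value inequality along the segment from `z'` to `z`, in terms of partial derivatives. -/
lemma norm_sub_le_of_partial_bound {z z' : EuclideanSpace ℝ (Fin p)} {d : Fin p → ℝ}
    (hd0 : ∀ j, 0 ≤ d j) {N : Set ℝ} (hN : N.Countable)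
    (hc : ContinuousOn (fun t : ℝ => Ψ (z' + t • (z - z'))) (Set.Icc 0 1))
    (hd : ∀ t ∈ Set.Ioo (0 : ℝ) 1 \ N, DifferentiableAt ℝ Ψ (z' + t • (z - z')) ∧ ∀ i j,
      |fderiv ℝ Ψ (z' + t • (z - z')) (EuclideanSpace.single j 1) i| * |z j - z' j| ≤ d j) :
    ‖Ψ z - Ψ z'‖ ≤ ∑ j, d j := by
  rw [pi_norm_le_iff_of_nonneg (Finset.sum_nonneg fun j _ => hd0 j)]
  intro i
  have h := abs_sub_le_of_deriv_bound_off_countable (f := fun t => Ψ (z' + t • (z - z')) i)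
    (D := ∑ j, d j) hN ((continuous_apply i).comp_continuousOn hc) ?_
  · simpa using h
  intro t ht
  obtain ⟨h1, h2⟩ := hd t ht
  have hline : HasDerivAt (fun t : ℝ => z' + t • (z - z')) (z - z') t := by
    simpa using ((hasDerivAt_id t).smul_const (z - z')).const_add z'
  have h3 := h1.hasFDerivAt.comp_hasDerivAt t hline
  have h4 : HasDerivAt (fun t => Ψ (z' + t • (z - z')) i)
      (fderiv ℝ Ψ (z' + t • (z - z')) (z - z') i) t := (hasDerivAt_pi.1 h3) i
  refine ⟨h4.differentiableAt, ?_⟩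
  rw [h4.deriv]
  refine (abs_fderiv_apply_le_sum _ _ _).trans (Finset.sum_le_sum fun j _ => ?_)
  simpa using h2 i j

lemma abs_fderiv_single_le (x : EuclideanSpace ℝ (Fin p)) (i : Fin s) (j : Fin p) :
    |fderiv ℝ Ψ x (EuclideanSpace.single j 1) i| ≤ ‖fderiv ℝ Ψ x‖ := by
  refine (norm_le_pi_norm (fderiv ℝ Ψ x (EuclideanSpace.single j 1)) i).trans ?_
  simpa using (fderiv ℝ Ψ x).le_opNorm (EuclideanSpace.single j 1)

variable {S : Finset (EuclideanSpace ℝ (Fin p))} {ε : ℝ} {B : Set (EuclideanSpace ℝ (Fin p))}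
  {H E : Finset (Fin p × ℝ)}

/-- A Lipschitz transformation is uniformly Lipschitz with respect to relative perturbations: far out
the decay of `∂_jΨ` compensates the size of the perturbation. A segment in general position meets
the exceptional hyperplanes in finitely many points. -/
lemma RegularOff.exists_modulus_of_lipschitz (h : RegularOff Ψ S ε B H E) {L : ℝ≥0}
    (hL : LipschitzWith L Ψ) :
    ∃ C ≥ (0 : ℝ), ∃ r₀ > (0 : ℝ), ∀ r, 0 < r → r ≤ r₀ → ∀ z z', IsRelClose r z z' →
      ‖Ψ z - Ψ z'‖ ≤ C * r := by
  obtain ⟨C₁, hC₁, C₂, -, hder⟩ := h.deriv_bounds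
  obtain ⟨RB, hRB⟩ := h.bounded_B.exists_norm_le
  set R := |RB| + ∑ a ∈ S, ‖a‖ + ε with hR
  have hS0 : 0 ≤ ∑ a ∈ S, ‖a‖ := Finset.sum_nonneg fun _ _ => norm_nonneg _
  have hε := h.eps_pos
  have hR0 : 0 ≤ R := by rw [hR]; positivity
  clear_value R
  set r₁ : ℝ := 1 / (4 * ((p : ℝ) + 1)) with hr₁
  have hp : (0 : ℝ) ≤ p := p.cast_nonneg
  have hr₁p : 0 < r₁ := by positivity
  have hr₁4 : r₁ ≤ 1 / 4 := by
    rw [hr₁]; gcongr; linarith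
  have hr₁m : r₁ * p ≤ 1 / 4 := by
    rw [hr₁, div_mul_eq_mul_div, div_le_div_iff₀ (by positivity) (by norm_num)]; linarith
  set C := L * (p * (2 * R + 2)) + p * (2 * L + 4 * C₁) with hC
  have hL0 : (0 : ℝ) ≤ L := L.coe_nonneg
  have hC0 : 0 ≤ C := by rw [hC]; positivity
  have generic : ∀ r, 0 < r → r ≤ r₁ → ∀ z z', IsRelClose r z z' → (∀ j, z j ≠ z' j) →
      ‖Ψ z - Ψ z'‖ ≤ C * r := by
    intro r hr hrr z z' hz hne
    -- in a bounded region the perturbation is absolutely small and `Ψ` is Lipschitz; outside it the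
    -- segment avoids `B` and the balls, and the bound on `∂_jΨ(x) x_j` applies
    rcases le_or_gt ‖z'‖ (2 * R + 1) with hz' | hz'
    · have h1 := hL.dist_le_mul z z'
      rw [dist_eq_norm, dist_eq_norm] at h1
      have h2 := hz.norm_sub_le hr.le
      calc _ ≤ L * ‖z - z'‖ := h1
        _ ≤ L * (r * p * (1 + (2 * R + 1))) := by gcongr; exact h2.trans (by gcongr)
        _ = L * (p * (2 * R + 2)) * r := by ring
        _ ≤ C * r := by gcongr; rw [hC]; have : 0 ≤ (p : ℝ) * (2 * L + 4 * C₁) := by positivity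
                        linarith
    · have main : ‖Ψ z - Ψ z'‖ ≤ ∑ _j : Fin p, (2 * L + 4 * C₁) * r := by
        refine norm_sub_le_of_partial_bound
          (N := (fun q : Fin p × ℝ => (q.2 - z' q.1) / (z q.1 - z' q.1)) '' ((H ∪ E : Finset _) :
            Set (Fin p × ℝ))) (fun j => by positivity)
          ((Finset.finite_toSet _).image _).countable ?_ ?_
        · exact (hL.continuous.comp (by fun_prop)).continuousOn
        · intro t ht
          set x := z' + t • (z - z') with hx
          have hxc : IsRelClose r x z' := hz.segment ht.1.1.le ht.1.2.le
          have hxn : R < ‖x‖ := by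
            have h1 := hxc.norm_sub_le hr.le
            have h2 : r * p * (1 + ‖z'‖) ≤ 1 / 4 * (1 + ‖z'‖) := by
              gcongr
              exact (mul_le_mul_of_nonneg_right hrr hp).trans hr₁m
            have h3 : ‖z'‖ ≤ ‖x‖ + ‖x - z'‖ := by
              have := norm_sub_le x (x - z'); simpa using this
            linarith
          have hxB : x ∉ B := fun hb => by
            have := hRB x hb; have := le_abs_self RB; linarith
          have hxS' : ∀ a ∈ S, ε < ‖x - a‖ := by
            intro a ha
            have h1 : ‖a‖ ≤ ∑ a ∈ S, ‖a‖ := Finset.single_le_sum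
              (f := fun a => ‖a‖) (fun _ _ => norm_nonneg _) ha
            have h2 : ‖x‖ ≤ ‖x - a‖ + ‖a‖ := by simpa using norm_add_le (x - a) a
            have := abs_nonneg RB
            linarith
          have hxS : x ∉ (S : Set (EuclideanSpace ℝ (Fin p))) := fun ha => by
            have := hxS' x ha; simp at this; linarith
          have hplane : ∀ q ∈ H ∪ E, x q.1 ≠ q.2 := by
            intro q hq hxq
            refine ht.2 ⟨q, hq, ?_⟩
            have h1 : x q.1 = z' q.1 + t * (z q.1 - z' q.1) := by simp [hx]
            rw [div_eq_iff (sub_ne_zero.2 (hne q.1))]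
            linarith
          have hxH : x ∉ hyperplaneUnion H := by
            simp only [hyperplaneUnion, Set.mem_iUnion, not_exists]
            exact fun q hq hxq => hplane q (Finset.mem_union_left _ hq) hxq
          have hxE : x ∉ hyperplaneUnion E := by
            simp only [hyperplaneUnion, Set.mem_iUnion, not_exists]
            exact fun q hq hxq => hplane q (Finset.mem_union_right _ hq) hxq
          refine ⟨(h.smooth x hxS hxB hxH hxE).differentiableAt (by norm_num), fun i j => ?_⟩
          have hd1 := (hder x hxS' hxB hxH hxE).1 i j
          have hd2 : |fderiv ℝ Ψ x (EuclideanSpace.single j 1) i| ≤ L :=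
            (abs_fderiv_single_le x i j).trans (norm_fderiv_le_of_lipschitz ℝ hL)
          set w := fderiv ℝ Ψ x (EuclideanSpace.single j 1) i
          rcases le_or_gt |z' j| 1 with hj | hj
          · calc |w| * |z j - z' j| ≤ L * (r * (1 + 1)) := by
                  gcongr; exact (hz j).trans (by gcongr)
              _ ≤ (2 * L + 4 * C₁) * r := by
                  have := mul_nonneg hC₁.le hr.le
                  linarith
          · have hxj : |z' j| / 2 ≤ |x j| := by
              have h1 := hxc j
              have h2 : |z' j| ≤ |x j| + |x j - z' j| := by
                have := abs_sub (x j) (x j - z' j); simpa using this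
              have h4 : r * (1 + |z' j|) ≤ 1 / 4 * (|z' j| + |z' j|) := by gcongr; linarith
              linarith
            rw [abs_mul] at hd1
            have h3 : |z j - z' j| ≤ 4 * r * |x j| := by
              refine (hz j).trans ?_
              have h4 : r * (1 + |z' j|) ≤ r * (4 * |x j|) := by gcongr; linarith
              linarith
            calc |w| * |z j - z' j| ≤ |w| * (4 * r * |x j|) := by gcongr
              _ = 4 * r * (|w| * |x j|) := by ring
              _ ≤ 4 * r * C₁ := by gcongr
              _ ≤ (2 * L + 4 * C₁) * r := by
                  have := mul_nonneg hL0 hr.le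
                  linarith
      refine main.trans ?_
      rw [Finset.sum_const, Finset.card_univ, Fintype.card_fin, nsmul_eq_mul, ← mul_assoc]
      gcongr
      rw [hC]
      have : 0 ≤ (L : ℝ) * ((p : ℝ) * (2 * R + 2)) :=
        mul_nonneg hL0 (mul_nonneg hp (by linarith))
      linarith
  refine ⟨C, hC0, r₁ / 2, by positivity, fun r hr hrr z z' hz => ?_⟩
  -- move `z` along the diagonal into general position
  set o : EuclideanSpace ℝ (Fin p) := WithLp.toLp 2 fun _ => (1 : ℝ) with ho
  have hoj : ∀ j, o j = 1 := fun j => rfl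
  have lim1 : Tendsto (fun η : ℝ => ‖Ψ (z + η • o) - Ψ z'‖) (𝓝[>] 0) (𝓝 ‖Ψ z - Ψ z'‖) := by
    have : Continuous fun η : ℝ => ‖Ψ (z + η • o) - Ψ z'‖ := by
      have := hL.continuous
      fun_prop
    have h0 := this.tendsto 0
    simp only [zero_smul, add_zero] at h0
    exact h0.mono_left nhdsWithin_le_nhds
  have lim2 : Tendsto (fun η : ℝ => C * (r + η)) (𝓝[>] 0) (𝓝 (C * r)) := by
    have : Continuous fun η : ℝ => C * (r + η) := by fun_prop
    have h0 := this.tendsto 0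
    rw [add_zero] at h0
    exact h0.mono_left nhdsWithin_le_nhds
  refine le_of_tendsto_of_tendsto lim1 lim2 ?_
  have hfin : (Set.range fun j => z' j - z j).Finite := Set.finite_range _
  have ev1 : ∀ᶠ η : ℝ in 𝓝[>] 0, η ∉ Set.range fun j => z' j - z j := by
    have h1 : ∀ᶠ η : ℝ in 𝓝[≠] 0, η ∉ Set.range fun j => z' j - z j := by
      have h2 : ((Set.range fun j => z' j - z j) \ {0})ᶜ ∈ 𝓝 (0 : ℝ) :=
        (hfin.subset Set.sdiff_subset).isClosed.isOpen_compl.mem_nhds (by simp)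
      filter_upwards [mem_nhdsWithin_of_mem_nhds h2, self_mem_nhdsWithin] with η h3 h4 h5
      exact h3 ⟨h5, h4⟩
    exact h1.filter_mono (nhdsWithin_mono _ fun x hx => ne_of_gt hx)
  have ev2 : ∀ᶠ η : ℝ in 𝓝[>] 0, η < r₁ / 2 :=
    mem_nhdsWithin_of_mem_nhds (Iio_mem_nhds (by positivity))
  filter_upwards [ev1, ev2, self_mem_nhdsWithin] with η h1 h2 h3
  have h3' : 0 < η := h3
  refine generic (r + η) (by positivity) (by linarith) _ _ (fun j => ?_) fun j hj => ?_
  · have e : (z + η • o) j - z' j = (z j - z' j) + η := by simp [hoj]; ring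
    rw [e]
    refine (abs_add_le _ _).trans ?_
    rw [abs_of_pos h3']
    have := hz j
    have := abs_nonneg (z' j)
    nlinarith
  · refine h1 ⟨j, ?_⟩
    have e : (z + η • o) j = z j + η := by simp [hoj]
    show z' j - z j = η
    linarith

/-- If all discontinuities lie on the hyperplanes of `E` and the derivative vanishes elsewhere, `Ψ`
can change only across a hyperplane. -/
lemma RegularOff.exists_modulus_of_deriv_zero (h : RegularOff Ψ S ε B H E) (hE : E.Nonempty)
    {C₀ : ℝ} (hC₀ : ∀ x, ‖Ψ x‖ ≤ C₀) :
    ∃ C ≥ (0 : ℝ), ∀ r, 0 < r → r ≤ 1 / 4 → ∀ z z', IsRelClose r z z' →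
      ‖Ψ z - Ψ z'‖ ≤ C * ∑ q ∈ E, r / (r + |z' q.1 - q.2|) := by
  have hC₀p : 0 ≤ C₀ := (norm_nonneg _).trans (hC₀ 0)
  set A := ∑ q ∈ E, |q.2| with hA
  have hA0 : 0 ≤ A := Finset.sum_nonneg fun _ _ => abs_nonneg _
  refine ⟨2 * C₀ * (2 * A + 3), by positivity, fun r hr hr4 z z' hz => ?_⟩
  have hterm : ∀ q ∈ E, 0 ≤ r / (r + |z' q.1 - q.2|) := fun q _ => by positivity
  -- near a hyperplane boundedness suffices, elsewhere the segment meets no hyperplane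
  by_cases hex : ∃ q ∈ E, |z' q.1 - q.2| ≤ r * (1 + |z' q.1|)
  · obtain ⟨q, hq, hqr⟩ := hex
    have hqA : |q.2| ≤ A := Finset.single_le_sum (f := fun q : Fin p × ℝ => |q.2|)
      (fun _ _ => abs_nonneg _) hq
    have h1 : |z' q.1| ≤ 2 * A + 1 := by
      have : |z' q.1| ≤ |z' q.1 - q.2| + |q.2| := by
        simpa using abs_add_le (z' q.1 - q.2) q.2
      have := abs_nonneg (z' q.1)
      nlinarith
    have h2 : |z' q.1 - q.2| ≤ r * (2 * A + 2) := hqr.trans (by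
      have := mul_le_mul_of_nonneg_left h1 hr.le; linarith)
    have h3 : 1 / (2 * A + 3) ≤ r / (r + |z' q.1 - q.2|) := by
      rw [div_le_div_iff₀ (by positivity) (by positivity)]; linarith
    have h4 : 1 / (2 * A + 3) ≤ ∑ q ∈ E, r / (r + |z' q.1 - q.2|) :=
      h3.trans (Finset.single_le_sum hterm hq)
    calc ‖Ψ z - Ψ z'‖ ≤ 2 * C₀ := by
          have := norm_sub_le (Ψ z) (Ψ z'); have := hC₀ z; have := hC₀ z'; linarith
      _ = 2 * C₀ * (2 * A + 3) * (1 / (2 * A + 3)) := by field_simp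
      _ ≤ _ := by gcongr
  · push Not at hex
    have h0 : ‖Ψ z - Ψ z'‖ ≤ ∑ _j : Fin p, (0 : ℝ) := by
      have hoff : ∀ t ∈ Set.Icc (0 : ℝ) 1, z' + t • (z - z') ∉ hyperplaneUnion E := by
        intro t ht
        simp only [hyperplaneUnion, Set.mem_iUnion, not_exists]
        intro q hq hxq
        have h1 := hz.segment ht.1 ht.2 q.1
        have h2 : (z' + t • (z - z')) q.1 = q.2 := hxq
        rw [h2, abs_sub_comm] at h1
        exact absurd h1 (not_le.2 (hex q hq))
      refine norm_sub_le_of_partial_bound (N := ∅) (fun _ => le_rfl) Set.countable_empty ?_ ?_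
      · intro t ht
        refine ContinuousAt.continuousWithinAt ?_
        exact ContinuousAt.comp (f := fun t : ℝ => z' + t • (z - z'))
          (h.deriv_zero_of_E hE _ (hoff t ht)).continuousAt (by fun_prop)
      · intro t ht
        have hd := h.deriv_zero_of_E hE _ (hoff t ⟨ht.1.1.le, ht.1.2.le⟩)
        refine ⟨hd.differentiableAt, fun i j => ?_⟩
        rw [hd.fderiv]; simp
    rw [Finset.sum_const_zero] at h0
    exact h0.trans (mul_nonneg (by positivity) (Finset.sum_nonneg hterm))

end Modulus

section Singular

variable {p s : ℕ} {Ψ : EuclideanSpace ℝ (Fin p) → Fin s → ℝ}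
  {S : Finset (EuclideanSpace ℝ (Fin p))} {ε : ℝ}

/-- The growth bound at the singularities, with an exponent strictly between `0` and `p`. -/
lemma RegularOff.exists_singular_exponent {B : Set (EuclideanSpace ℝ (Fin p))}
    {H E : Finset (Fin p × ℝ)} (h : RegularOff Ψ S ε B H E) (hp : 1 ≤ p) :
    ∃ α : ℝ, 0 ≤ α ∧ α < p ∧ ∃ K ≥ (0 : ℝ), ∀ a ∈ S, ∀ x, ‖x - a‖ ≤ ε →
      x ∉ (S : Set (EuclideanSpace ℝ (Fin p))) → x ∉ B → x ∉ hyperplaneUnion H →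
      x ∉ hyperplaneUnion E → ‖fderiv ℝ Ψ x‖ ≤ K * ‖x - a‖ ^ (-α) := by
  obtain ⟨C₃, hC₃, δ, hδ, hs⟩ := h.singular
  have hp' : (1 : ℝ) ≤ p := by exact_mod_cast hp
  set δ' := min δ (1 / 2) with hδ'
  have h1 : 0 < δ' := lt_min hδ (by norm_num)
  have h2 : δ' ≤ δ := min_le_left _ _
  have h3 : δ' ≤ 1 / 2 := min_le_right _ _
  have hε := h.eps_pos
  refine ⟨p - δ', by linarith, by linarith, C₃ * ε ^ (δ - δ'), by positivity, ?_⟩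
  intro a ha x hxa hxS hxB hxH hxE
  have hpos : 0 < ‖x - a‖ := by
    rw [norm_pos_iff, sub_ne_zero]
    rintro rfl
    exact hxS ha
  refine (hs a ha x hxa hxS hxB hxH hxE).1.trans ?_
  have e : ‖x - a‖ ^ (-((p : ℝ) - δ)) = ‖x - a‖ ^ (δ - δ') * ‖x - a‖ ^ (-((p : ℝ) - δ')) := by
    rw [← Real.rpow_add hpos]; congr 1; ring
  rw [e, mul_assoc]
  gcongr

/-- The segment from `z'` to `z` stays away from a point which is far from `z'` compared to `r`. -/
lemma IsRelClose.half_norm_sub_le {r : ℝ} {z z' a : EuclideanSpace ℝ (Fin p)}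
    (hz : IsRelClose r z z') (hr : 0 ≤ r) (hrp : r * p ≤ 1 / 4) {A : ℝ} (hA : ‖a‖ ≤ A)
    (ha : r * (4 * p * (1 + A)) < ‖z' - a‖) {t : ℝ} (h0 : 0 ≤ t) (h1 : t ≤ 1) :
    ‖z' - a‖ / 2 ≤ ‖z' + t • (z - z') - a‖ := by
  have h2 := (hz.segment h0 h1).norm_sub_le hr
  set x := z' + t • (z - z')
  have h3 : ‖z'‖ ≤ A + ‖z' - a‖ := by
    have h3 := norm_add_le a (z' - a)
    rw [add_sub_cancel] at h3
    linarith
  have h6 : r * p * (1 + ‖z'‖) ≤ r * p * (1 + A) + r * p * ‖z' - a‖ := by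
    have := mul_le_mul_of_nonneg_left h3 (by positivity : 0 ≤ r * (p : ℝ))
    linarith
  have h8 : r * p * ‖z' - a‖ ≤ 1 / 4 * ‖z' - a‖ := by gcongr
  have h9 : ‖z' - a‖ ≤ ‖x - a‖ + ‖x - z'‖ := by
    have := _root_.norm_sub_le (x - a) (x - z'); simpa using this
  linarith

/-- The modulus of continuity in the presence of integrable singularities. Away from the
singularities only `∂_jΨ(x) x_j` is bounded, so that the coordinate hyperplanes `x_j = 0` contribute
as well. -/
lemma RegularOff.exists_modulus_of_singular (h : RegularOff Ψ S ε ∅ ∅ ∅) (hp : 1 ≤ p)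
    {C₀ : ℝ} (hC₀ : ∀ x, ‖Ψ x‖ ≤ C₀) :
    ∃ F : Finset (Fin p × ℝ), ∃ α : ℝ, 0 ≤ α ∧ α < p ∧ ∃ C ≥ (0 : ℝ), ∃ r₀ > (0 : ℝ),
      ∀ r, 0 < r → r ≤ r₀ → ∀ z z', IsRelClose r z z' →
      ‖Ψ z - Ψ z'‖ ≤ C * (r + ∑ q ∈ F, r / (r + |z' q.1 - q.2|) +
        ∑ a ∈ S, r * (r + ‖z' - a‖) ^ (-α)) := by
  classical
  obtain ⟨α, hα0, hαp, K, hK0, hK⟩ := h.exists_singular_exponent hp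
  obtain ⟨C₁, hC₁, C₂, -, hder⟩ := h.deriv_bounds
  have hε := h.eps_pos
  have hC₀p : 0 ≤ C₀ := (norm_nonneg _).trans (hC₀ 0)
  have hp' : (1 : ℝ) ≤ p := by exact_mod_cast hp
  set j₀ : Fin p := ⟨0, hp⟩
  set A := ∑ a ∈ S, ‖a‖ with hA
  have hA0 : 0 ≤ A := Finset.sum_nonneg fun _ _ => norm_nonneg _
  have hAS : ∀ a ∈ S, ‖a‖ ≤ A := fun a ha =>
    Finset.single_le_sum (f := fun a => ‖a‖) (fun _ _ => norm_nonneg _) ha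
  clear_value A
  set m : ℝ := 4 * p * (1 + A) with hm
  have hm4 : 4 ≤ m := by
    have : 0 ≤ ((p : ℝ) - 1) * (1 + A) := mul_nonneg (by linarith) (by linarith)
    rw [hm]; linarith
  have hm0 : 0 < m := by linarith
  clear_value m
  set F : Finset (Fin p × ℝ) := (Finset.univ.image fun j : Fin p => (j, (0 : ℝ))) ∪
    S.image (fun a => (j₀, a j₀)) with hF
  set M := (1 + A + 2 * ε) * K * 4 ^ α with hM
  have hM0 : 0 ≤ M := by rw [hM]; positivity
  set C := 2 * C₀ * (m + 1) + p * (4 * C₁ + M) with hC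
  have hC0 : 0 ≤ C := by rw [hC]; positivity
  have hCa : 2 * C₀ * (m + 1) ≤ C := by
    rw [hC]; have : 0 ≤ p * (4 * C₁ + M) := by positivity
    linarith
  have hCb : p * (4 * C₁ + M) ≤ C := by
    rw [hC]; have : 0 ≤ 2 * C₀ * (m + 1) := by positivity
    linarith
  clear_value C M
  refine ⟨F, α, hα0, hαp, C, hC0, 1 / (4 * (p : ℝ)), by positivity, fun r hr hrr z z' hz => ?_⟩
  have hrp : r * p ≤ 1 / 4 := by
    calc r * p ≤ 1 / (4 * (p : ℝ)) * p := by gcongr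
      _ = 1 / 4 := by field_simp
  have hr4 : r ≤ 1 / 4 := by nlinarith
  set sumF := ∑ q ∈ F, r / (r + |z' q.1 - q.2|) with hsumF
  set sumS := ∑ a ∈ S, r * (r + ‖z' - a‖) ^ (-α) with hsumS
  have hterm : ∀ q ∈ F, 0 ≤ r / (r + |z' q.1 - q.2|) := fun q _ => by positivity
  have htermS : ∀ a ∈ S, 0 ≤ r * (r + ‖z' - a‖) ^ (-α) := fun a _ => by positivity
  have hsumF0 : 0 ≤ sumF := Finset.sum_nonneg hterm
  have hsumS0 : 0 ≤ sumS := Finset.sum_nonneg htermS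
  -- close to one of the hyperplanes in `F` boundedness suffices
  have trivial_bound : ∀ q ∈ F, |z' q.1 - q.2| ≤ r * m → ‖Ψ z - Ψ z'‖ ≤ C * (r + sumF + sumS) := by
    intro q hq hqm
    have h3 : 1 / (m + 1) ≤ r / (r + |z' q.1 - q.2|) := by
      rw [div_le_div_iff₀ (by positivity) (by positivity)]; linarith
    have h4 : 1 / (m + 1) ≤ sumF := h3.trans (Finset.single_le_sum hterm hq)
    calc ‖Ψ z - Ψ z'‖ ≤ 2 * C₀ := by
          have := norm_sub_le (Ψ z) (Ψ z'); have := hC₀ z; have := hC₀ z'; linarith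
      _ = 2 * C₀ * (m + 1) * (1 / (m + 1)) := by field_simp
      _ ≤ C * (r + sumF + sumS) := by gcongr; linarith
  have memF : ∀ j : Fin p, (j, (0 : ℝ)) ∈ F := fun j =>
    Finset.mem_union_left _ (Finset.mem_image_of_mem _ (Finset.mem_univ j))
  by_cases hT1 : ∃ j, |z' j| ≤ r * m
  · obtain ⟨j, hj⟩ := hT1
    exact trivial_bound (j, 0) (memF j) (by simpa using hj)
  by_cases hT2 : ∃ a ∈ S, ‖z' - a‖ ≤ r * m
  · obtain ⟨a, ha, haz⟩ := hT2
    refine trivial_bound (j₀, a j₀) (Finset.mem_union_right _ (Finset.mem_image_of_mem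
      (fun a : EuclideanSpace ℝ (Fin p) => (j₀, a j₀)) ha)) ?_
    exact (abs_apply_le_norm (z' - a) j₀).trans haz
  push Not at hT1 hT2
  have hseg : ∀ t ∈ Set.Icc (0 : ℝ) 1, ∀ a ∈ S,
      ‖z' - a‖ / 2 ≤ ‖z' + t • (z - z') - a‖ := fun t ht a ha =>
    hz.half_norm_sub_le hr.le hrp (hAS a ha) (by rw [← hm]; exact hT2 a ha) ht.1 ht.2
  have hsegS : ∀ t ∈ Set.Icc (0 : ℝ) 1,
      z' + t • (z - z') ∉ (S : Set (EuclideanSpace ℝ (Fin p))) := by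
    intro t ht hxS
    have h1 := hseg t ht _ hxS
    rw [sub_self, norm_zero] at h1
    have h2 := hT2 _ hxS
    have : 0 < r * m := by positivity
    linarith
  have hempty : ∀ x : EuclideanSpace ℝ (Fin p), x ∉ hyperplaneUnion (∅ : Finset (Fin p × ℝ)) := by
    intro x; simp [hyperplaneUnion]
  have hsmooth : ∀ t ∈ Set.Icc (0 : ℝ) 1, DifferentiableAt ℝ Ψ (z' + t • (z - z')) := fun t ht =>
    (h.smooth _ (hsegS t ht) (Set.notMem_empty _) (hempty _) (hempty _)).differentiableAt
      (by norm_num)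
  have main : ‖Ψ z - Ψ z'‖ ≤ ∑ j : Fin p, (2 * C₁ * (r + 2 * (r / (r + |z' j|))) + M * sumS) := by
    refine norm_sub_le_of_partial_bound (N := ∅) (fun j => by positivity) Set.countable_empty ?_ ?_
    · intro t ht
      refine ContinuousAt.continuousWithinAt ?_
      exact ContinuousAt.comp (f := fun t : ℝ => z' + t • (z - z'))
        (hsmooth t ht).continuousAt (by fun_prop)
    · intro t ht
      have ht' : t ∈ Set.Icc (0 : ℝ) 1 := ⟨ht.1.1.le, ht.1.2.le⟩
      refine ⟨hsmooth t ht', fun i j => ?_⟩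
      have hxc := hz.segment ht'.1 ht'.2 j
      have hxS := hsegS t ht'
      have hxd := hseg t ht'
      set x := z' + t • (z - z') with hx
      have hw := abs_fderiv_single_le (Ψ := Ψ) x i j
      have n1 : 0 ≤ 2 * C₁ * (r + 2 * (r / (r + |z' j|))) := by positivity
      have n2 : 0 ≤ M * sumS := by positivity
      -- near a singularity its growth bound applies, elsewhere the bound on `∂_jΨ(x) x_j`
      by_cases hball : ∃ a ∈ S, ‖x - a‖ ≤ ε
      · obtain ⟨a, ha, hxa⟩ := hball
        have h1 := hK a ha x hxa hxS (Set.notMem_empty _) (hempty _) (hempty _)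
        have h2 := hxd a ha
        have h3 := hT2 a ha
        have h4 : (r + ‖z' - a‖) / 4 ≤ ‖x - a‖ := by
          have := mul_le_mul_of_nonneg_left hm4 hr.le
          linarith
        have h5 : ‖x - a‖ ^ (-α) ≤ 4 ^ α * (r + ‖z' - a‖) ^ (-α) := by
          have h6 := Real.rpow_le_rpow_of_nonpos (by positivity : 0 < (r + ‖z' - a‖) / 4) h4
            (by linarith : -α ≤ 0)
          refine h6.trans (le_of_eq ?_)
          rw [Real.div_rpow (by positivity) (by norm_num), Real.rpow_neg (by norm_num : (0:ℝ) ≤ 4),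
            div_inv_eq_mul, mul_comm]
        have h7 : |z' j| ≤ A + 2 * ε := by
          have h8 := abs_apply_le_norm z' j
          have h9 := norm_add_le a (z' - a)
          rw [add_sub_cancel] at h9
          have := hAS a ha
          linarith
        have h8 : r * (r + ‖z' - a‖) ^ (-α) ≤ sumS := Finset.single_le_sum htermS ha
        have h9 : |fderiv ℝ Ψ x (EuclideanSpace.single j 1) i| * |z j - z' j| ≤ M * sumS := by
          calc _ ≤ (K * (4 ^ α * (r + ‖z' - a‖) ^ (-α))) * (r * (1 + (A + 2 * ε))) := by
                gcongr
                · exact hw.trans (h1.trans (by gcongr))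
                · exact (hz j).trans (by gcongr)
            _ = M * (r * (r + ‖z' - a‖) ^ (-α)) := by rw [hM]; ring
            _ ≤ M * sumS := by gcongr
        linarith
      · push Not at hball
        have h1 := (hder x hball (Set.notMem_empty _) (hempty _) (hempty _)).1 i j
        set w := fderiv ℝ Ψ x (EuclideanSpace.single j 1) i
        have h2 := hT1 j
        have hz0 : 0 < |z' j| := lt_of_le_of_lt (by positivity) h2
        have hr1 : 4 * r ≤ |z' j| := by
          have := mul_le_mul_of_nonneg_left hm4 hr.le
          linarith
        have h3 : |z' j| / 2 ≤ |x j| := by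
          have h4 : |z' j| ≤ |x j| + |x j - z' j| := by
            have := abs_sub (x j) (x j - z' j); simpa using this
          have h5 : r * (1 + |z' j|) ≤ r + 1 / 4 * |z' j| := by
            rw [mul_add, mul_one]; gcongr
          linarith
        have h6 : |w| ≤ C₁ * (2 / |z' j|) := by
          rw [abs_mul] at h1
          have h7 : |w| * (|z' j| / 2) ≤ C₁ := (by gcongr : _ ≤ |w| * |x j|).trans h1
          calc |w| = |w| * (|z' j| / 2) * (2 / |z' j|) := by field_simp
            _ ≤ _ := by gcongr
        have h7 : r / |z' j| ≤ 2 * (r / (r + |z' j|)) := by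
          rw [← mul_div_assoc, div_le_div_iff₀ hz0 (by positivity)]
          have := mul_le_mul_of_nonneg_left (by linarith : r ≤ |z' j|) hr.le
          linarith
        calc |w| * |z j - z' j| ≤ (C₁ * (2 / |z' j|)) * (r * (1 + |z' j|)) := by
              gcongr; exact hz j
          _ = 2 * C₁ * (r + r / |z' j|) := by field_simp; ring
          _ ≤ 2 * C₁ * (r + 2 * (r / (r + |z' j|))) := by gcongr
          _ ≤ _ := by linarith
  refine main.trans ?_
  have hj : ∀ j : Fin p, r / (r + |z' j|) ≤ sumF := fun j => by
    have := Finset.single_le_sum hterm (memF j)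
    simpa using this
  calc _ ≤ ∑ _j : Fin p, (4 * C₁ + M) * (r + sumF + sumS) := by
        refine Finset.sum_le_sum fun j _ => ?_
        have h1 := mul_le_mul_of_nonneg_left (hj j) hC₁.le
        have h2 : 0 ≤ C₁ * r := by positivity
        have h3 : 0 ≤ C₁ * sumS := by positivity
        have h4 : 0 ≤ M * r := by positivity
        have h5 : 0 ≤ M * sumF := by positivity
        linarith
    _ = p * (4 * C₁ + M) * (r + sumF + sumS) := by simp; ring
    _ ≤ _ := by gcongr

/-- The modulus of continuity of an admissible transformation. Hyperplanes and point singularities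
appear only if the transformation is not Lipschitz. -/
lemma IsAdmissible.exists_modulus (h : IsAdmissible Ψ) :
    ∃ F : Finset (Fin p × ℝ), ∃ S : Finset (EuclideanSpace ℝ (Fin p)), ∃ α : ℝ, 0 ≤ α ∧
      (∀ a ∈ S, α < p) ∧ ((∃ L : ℝ≥0, LipschitzWith L Ψ) → F = ∅ ∧ S = ∅) ∧
      ∃ C ≥ (0 : ℝ), ∃ r₀ > (0 : ℝ), ∀ r, 0 < r → r ≤ r₀ → ∀ z z', IsRelClose r z z' →
      ‖Ψ z - Ψ z'‖ ≤ C * (r + ∑ q ∈ F, r / (r + |z' q.1 - q.2|) +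
        ∑ a ∈ S, r * (r + ‖z' - a‖) ^ (-α)) := by
  obtain ⟨C₀, hC₀⟩ := h.bounded
  obtain ⟨S, ε, B, H, E, hreg⟩ := h.regular
  by_cases hL : ∃ L : ℝ≥0, LipschitzWith L Ψ
  · obtain ⟨L, hL⟩ := hL
    obtain ⟨C, hC, r₀, hr₀, hmod⟩ := hreg.exists_modulus_of_lipschitz hL
    refine ⟨∅, ∅, 0, le_rfl, by simp, fun _ => ⟨rfl, rfl⟩, C, hC, r₀, hr₀, ?_⟩
    intro r hr hrr z z' hz
    simpa using hmod r hr hrr z z' hz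
  have hB : B = ∅ := by
    by_contra hne
    exact hL (hreg.lipschitz_of_B (Set.nonempty_iff_ne_empty.2 hne))
  have hH : H = ∅ := by
    by_contra hne
    exact hL (hreg.lipschitz_of_H (Finset.nonempty_iff_ne_empty.2 hne)).1
  subst hB hH
  rcases E.eq_empty_or_nonempty with rfl | hE
  · have hp : 1 ≤ p := by
      rcases Nat.eq_zero_or_pos p with rfl | hp
      · exact absurd ⟨0, LipschitzWith.of_dist_le_mul fun x y => by
          rw [Subsingleton.elim x y]; simp⟩ hL
      · exact hp
    obtain ⟨F, α, hα0, hαp, C, hC, r₀, hr₀, hmod⟩ :=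
      hreg.exists_modulus_of_singular hp fun x => (hC₀ x).le
    exact ⟨F, S, α, hα0, fun _ _ => hαp, fun h' => absurd h' hL, C, hC, r₀, hr₀, hmod⟩
  · obtain ⟨C, hC, hmod⟩ := hreg.exists_modulus_of_deriv_zero hE fun x => (hC₀ x).le
    refine ⟨E, ∅, 0, le_rfl, by simp, fun h' => absurd h' hL, C, hC, 1 / 4, by norm_num, ?_⟩
    intro r hr hrr z z' hz
    refine (hmod r hr hrr z z' hz).trans ?_
    gcongr
    simp [hr.le]

end Singular

/-! ### Expected oscillation under perturbations of location and scale -/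

section Density

open Module in
/-- Under a bounded density, negative powers of the distance to a point have bounded expectations,
uniformly in the point, as long as the exponent is below the dimension. -/
lemma exists_integral_rpow_le {V : Type*} [NormedAddCommGroup V] [NormedSpace ℝ V]
    [FiniteDimensional ℝ V] [MeasurableSpace V] [BorelSpace V] (vol : Measure V)
    [vol.IsAddHaarMeasure] {α : ℝ} (hα0 : 0 ≤ α) (hα : α < finrank ℝ V) (K : ℝ≥0) :
    ∃ I ≥ (0 : ℝ), ∀ ν : Measure V, IsProbabilityMeasure ν → ν ≤ K • vol → ∀ (a : V) (r : ℝ),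
      0 < r → ∫ x, (r + ‖x - a‖) ^ (-α) ∂ν ≤ I := by
  have hdim : 0 < finrank ℝ V := by
    have : (0 : ℝ) < finrank ℝ V := lt_of_le_of_lt hα0 hα
    exact_mod_cast this
  have : Nontrivial V := nontrivial_of_finrank_pos hdim
  set h : V → ℝ := (Metric.ball (0 : V) 1).indicator fun x => ‖x‖ ^ (-α) with hh
  have hint : Integrable h vol := by
    rw [hh, integrable_indicator_iff measurableSet_ball]
    rw [integrableOn_fun_norm_addHaar vol (f := fun y : ℝ => y ^ (-α))]
    have h1 : IntegrableOn (fun y : ℝ => y ^ ((finrank ℝ V : ℝ) - 1 - α)) (Set.Ioo 0 1) := by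
      rw [intervalIntegral.integrableOn_Ioo_rpow_iff one_pos]
      linarith
    refine h1.congr_fun (fun y hy => ?_) measurableSet_Ioo
    have hy0 : 0 < y := hy.1
    simp only [smul_eq_mul]
    rw [← Real.rpow_natCast, ← Real.rpow_add hy0]
    congr 1
    rw [Nat.cast_sub hdim]; push_cast; ring
  have hh0 : ∀ x, 0 ≤ h x := fun x => Set.indicator_nonneg (fun x _ => by positivity) x
  refine ⟨1 + K * ∫ x, h x ∂vol, ?_, fun ν hν hνK a r hr => ?_⟩
  · have := integral_nonneg (μ := vol) (f := h) hh0
    positivity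
  have hhK : Integrable (fun x => h (x - a)) (K • vol) :=
    (hint.comp_sub_right a).smul_measure_nnreal
  have hhν : Integrable (fun x => h (x - a)) ν := hhK.mono_measure hνK
  have hac : ν ≪ vol := (Measure.absolutelyContinuous_of_le hνK).trans
    (Measure.smul_absolutelyContinuous (c := (K : ENNReal)))
  have hne : ∀ᵐ x ∂ν, x ≠ a := hac.ae_le (compl_mem_ae_iff.2 (measure_singleton a))
  calc ∫ x, (r + ‖x - a‖) ^ (-α) ∂ν ≤ ∫ x, (1 + h (x - a)) ∂ν := by
        refine integral_mono_of_nonneg (Eventually.of_forall fun x => by positivity)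
          ((integrable_const _).add hhν) ?_
        filter_upwards [hne] with x hx
        have hx0 : 0 < ‖x - a‖ := norm_pos_iff.2 (sub_ne_zero.2 hx)
        by_cases hx1 : ‖x - a‖ < 1
        · have : h (x - a) = ‖x - a‖ ^ (-α) := Set.indicator_of_mem (by simpa using hx1) _
          rw [this]
          have := Real.rpow_le_rpow_of_nonpos hx0 (by linarith : ‖x - a‖ ≤ r + ‖x - a‖)
            (by linarith : -α ≤ 0)
          linarith
        · have h1 : (r + ‖x - a‖) ^ (-α) ≤ 1 :=
            Real.rpow_le_one_of_one_le_of_nonpos (by linarith) (by linarith)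
          have := hh0 (x - a)
          linarith
    _ = 1 + ∫ x, h (x - a) ∂ν := by
        rw [integral_add (integrable_const _) hhν]; simp
    _ ≤ 1 + ∫ x, h (x - a) ∂(K • vol) := by
        exact add_le_add le_rfl
          (integral_mono_measure hνK (Eventually.of_forall fun x => hh0 _) hhK)
    _ = 1 + K * ∫ x, h x ∂vol := by
        rw [integral_smul_nnreal_measure, integral_sub_right_eq_self]; rfl

end Density

section Bracket

variable {p s : ℕ}

lemma measurable_standardize (m v : EuclideanSpace ℝ (Fin p)) : Measurable (standardize m v) := by
  unfold standardize
  fun_prop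

lemma standardize_apply (m v x : EuclideanSpace ℝ (Fin p)) (j : Fin p) :
    standardize m v x j = (x j - m j) / v j := rfl

/-- Changing location and scale by at most `r` perturbs the standardized observation by at most
`r / l` relative to its size, where `l` bounds the scales from below. -/
lemma isRelClose_standardize {m v m' v' : EuclideanSpace ℝ (Fin p)} {r l : ℝ}
    (hl : 0 < l) (hv : ∀ j, l ≤ v j) (hv' : ∀ j, 0 < v' j) (hm : ∀ j, |m j - m' j| ≤ r)
    (hvr : ∀ j, |v j - v' j| ≤ r) (x : EuclideanSpace ℝ (Fin p)) :
    IsRelClose (r / l) (standardize m v x) (standardize m' v' x) := by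
  intro j
  rw [standardize_apply, standardize_apply]
  set y := (x j - m' j) / v' j with hy
  have hvj : 0 < v j := hl.trans_le (hv j)
  have hx : x j = v' j * y + m' j := by rw [hy]; field_simp [(hv' j).ne']; ring
  have e : (x j - m j) / v j - y = ((m' j - m j) + y * (v' j - v j)) / v j := by
    rw [hx]; field_simp; ring
  rw [e, abs_div, abs_of_pos hvj]
  have hr : 0 ≤ r := (abs_nonneg _).trans (hm j)
  have h1 : |(m' j - m j) + y * (v' j - v j)| ≤ r * (1 + |y|) := by
    refine (abs_add_le _ _).trans ?_
    rw [abs_mul, abs_sub_comm, abs_sub_comm (v' j)]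
    have := mul_le_mul_of_nonneg_left (hvr j) (abs_nonneg y)
    have := hm j
    linarith
  calc _ ≤ r * (1 + |y|) / l := div_le_div₀ (by positivity) h1 hl (hv j)
    _ = _ := by ring

/-- The coordinatewise term of the modulus, in the original coordinates; the factor
`ρ ^ τ ≤ (ρ + y) ^ τ` is traded for an integrable power. -/
lemma div_standardize_le {m v : EuclideanSpace ℝ (Fin p)} {V ρ τ : ℝ} (hv : ∀ j, 0 < v j)
    (hvV : ∀ j, v j ≤ V) (hV : 1 ≤ V) (hρ : 0 < ρ) (hτ : 0 < τ) (q : Fin p × ℝ)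
    (x : EuclideanSpace ℝ (Fin p)) :
    ρ / (ρ + |standardize m v x q.1 - q.2|) ≤
      ρ ^ (1 - τ) * (V * (ρ + |x q.1 - (m q.1 + v q.1 * q.2)|) ^ (-(1 - τ))) := by
  have e : x q.1 - (m q.1 + v q.1 * q.2) = v q.1 * (standardize m v x q.1 - q.2) := by
    rw [standardize_apply]; field_simp [(hv q.1).ne']; ring
  generalize x q.1 - (m q.1 + v q.1 * q.2) = d at e ⊢
  have hV0 : 0 < V := by linarith
  have hy0 : 0 ≤ |d| := abs_nonneg _
  have h1 : |d| / V ≤ |standardize m v x q.1 - q.2| := by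
    rw [e, abs_mul, abs_of_pos (hv _), div_le_iff₀ hV0, mul_comm]
    exact mul_le_mul_of_nonneg_left (hvV _) (abs_nonneg _)
  generalize |d| = y at hy0 h1 ⊢
  have h2 : (ρ + y) / V ≤ ρ + |standardize m v x q.1 - q.2| := by
    rw [add_div]
    exact add_le_add (div_le_self hρ.le hV) h1
  have hpos : 0 < (ρ + y) / V := by positivity
  have hρτ : ρ ^ (1 - τ) * ρ ^ τ = ρ := by
    rw [← Real.rpow_add hρ]; simp
  calc ρ / (ρ + |standardize m v x q.1 - q.2|) ≤ ρ / ((ρ + y) / V) :=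
        div_le_div_of_nonneg_left hρ.le hpos h2
    _ = ρ ^ (1 - τ) * (V * (ρ ^ τ * (ρ + y)⁻¹)) := by
        nth_rewrite 1 [← hρτ]; field_simp
    _ ≤ ρ ^ (1 - τ) * (V * ((ρ + y) ^ τ * (ρ + y)⁻¹)) := by
        have : ρ ^ τ ≤ (ρ + y) ^ τ := Real.rpow_le_rpow hρ.le (by linarith) hτ.le
        gcongr
    _ = ρ ^ (1 - τ) * (V * (ρ + y) ^ (-(1 - τ))) := by
        congr 2
        rw [← Real.rpow_neg_one, ← Real.rpow_add (by positivity)]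
        congr 1; ring

/-- The singular term of the modulus, in the original coordinates. -/
lemma rpow_standardize_le {m v : EuclideanSpace ℝ (Fin p)} {V ρ α : ℝ} (hv : ∀ j, 0 < v j)
    (hvV : ∀ j, v j ≤ V) (hV : 1 ≤ V) (hρ : 0 < ρ) (hα : 0 ≤ α)
    (a x : EuclideanSpace ℝ (Fin p)) :
    (ρ + ‖standardize m v x - a‖) ^ (-α) ≤
      V ^ α * (ρ + ‖x - WithLp.toLp 2 fun j => m j + v j * a j‖) ^ (-α) := by
  have hV0 : 0 < V := by linarith
  have h1 : ‖x - WithLp.toLp 2 fun j => m j + v j * a j‖ / V ≤ ‖standardize m v x - a‖ := by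
    rw [div_le_iff₀ hV0, EuclideanSpace.norm_eq, EuclideanSpace.norm_eq]
    refine Real.sqrt_le_iff.2 ⟨by positivity, ?_⟩
    rw [mul_pow, Real.sq_sqrt (Finset.sum_nonneg fun _ _ => by positivity), Finset.sum_mul]
    refine Finset.sum_le_sum fun j _ => ?_
    have e : (x - WithLp.toLp 2 fun j => m j + v j * a j) j =
        (standardize m v x - a) j * v j := by
      simp only [PiLp.sub_apply, standardize_apply]
      field_simp [(hv j).ne']; ring
    rw [e, norm_mul, mul_pow]
    have : ‖v j‖ ≤ V := by
      rw [Real.norm_eq_abs, abs_of_pos (hv j)]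
      exact hvV j
    gcongr
  have hy0 := norm_nonneg (x - WithLp.toLp 2 fun j => m j + v j * a j)
  generalize ‖x - WithLp.toLp 2 fun j => m j + v j * a j‖ = y at h1 hy0 ⊢
  have h2 : (ρ + y) / V ≤ ρ + ‖standardize m v x - a‖ := by
    rw [add_div]
    exact add_le_add (div_le_self hρ.le hV) h1
  have hpos : 0 < (ρ + y) / V := by positivity
  calc _ ≤ ((ρ + y) / V) ^ (-α) := Real.rpow_le_rpow_of_nonpos hpos h2 (by linarith)
    _ = _ := by
        rw [Real.div_rpow (by positivity) (by positivity), Real.rpow_neg hV0.le,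
          div_inv_eq_mul, mul_comm (V ^ α)]

variable {Ω : Type*} [MeasurableSpace Ω] {P : Measure Ω} [IsProbabilityMeasure P]
  {X₀ : Ω → EuclideanSpace ℝ (Fin p)} {Ψ : EuclideanSpace ℝ (Fin p) → Fin s → ℝ}

/-- Uniform bounds for the expectations of the negative powers in the modulus. -/
lemma exists_integral_modulus_le (hX₀ : Measurable X₀) {K : ℝ≥0}
    (hK : P.map X₀ ≤ K • (volume : Measure (EuclideanSpace ℝ (Fin p))))
    (hKj : ∀ j : Fin p, P.map (fun ω => X₀ ω j) ≤ K • (volume : Measure ℝ)) {τ α : ℝ}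
    (hτ0 : 0 < τ) (hτ1 : τ < 1) (hα0 : 0 ≤ α) {S : Finset (EuclideanSpace ℝ (Fin p))}
    (hαp : ∀ a ∈ S, α < p) :
    ∃ I ≥ (0 : ℝ), (∀ (j : Fin p) (c r : ℝ), 0 < r →
        ∫ ω, (r + |X₀ ω j - c|) ^ (-(1 - τ)) ∂P ≤ I) ∧
      (∀ a ∈ S, ∀ (c : EuclideanSpace ℝ (Fin p)) (r : ℝ), 0 < r →
        ∫ ω, (r + ‖X₀ ω - c‖) ^ (-α) ∂P ≤ I) := by
  obtain ⟨I₁, hI₁, h₁⟩ := exists_integral_rpow_le (volume : Measure ℝ) (α := 1 - τ) (by linarith)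
    (by simp; linarith) K
  have hcoord : ∀ j, Measurable fun ω => X₀ ω j := fun j => by fun_prop
  have hF : ∀ (j : Fin p) (c r : ℝ), 0 < r →
      ∫ ω, (r + |X₀ ω j - c|) ^ (-(1 - τ)) ∂P ≤ I₁ := by
    intro j c r hr
    have := h₁ _ (Measure.isProbabilityMeasure_map (hcoord j).aemeasurable) (hKj j) c r hr
    rwa [integral_map (hcoord j).aemeasurable
      (by fun_prop : Measurable fun x : ℝ => (r + ‖x - c‖) ^ (-(1 - τ))).aestronglyMeasurable]
      at this
  rcases S.eq_empty_or_nonempty with rfl | ⟨a₀, ha₀⟩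
  · exact ⟨I₁, hI₁, hF, by simp⟩
  obtain ⟨I₂, hI₂, h₂⟩ := exists_integral_rpow_le
    (volume : Measure (EuclideanSpace ℝ (Fin p))) hα0 (by simpa using hαp a₀ ha₀) K
  refine ⟨I₁ + I₂, by positivity, fun j c r hr => (hF j c r hr).trans (by linarith), ?_⟩
  intro a _ c r hr
  have := h₂ _ (Measure.isProbabilityMeasure_map hX₀.aemeasurable) hK c r hr
  rw [integral_map hX₀.aemeasurable (by fun_prop : Measurable
    fun x : EuclideanSpace ℝ (Fin p) => (r + ‖x - c‖) ^ (-α)).aestronglyMeasurable] at this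
  linarith

/-- The expectation of the modulus at radius `ρ` is of order `ρ ^ (1 - τ)`. -/
lemma integral_modulus_le (hX₀ : Measurable X₀) {m v : EuclideanSpace ℝ (Fin p)}
    {V ρ τ α I : ℝ} (hv : ∀ j, 0 < v j) (hvV : ∀ j, v j ≤ V) (hV : 1 ≤ V) (hρ : 0 < ρ)
    (hρ1 : ρ ≤ 1) (hτ : 0 < τ) (hτ1 : τ < 1) (hα : 0 ≤ α) {F : Finset (Fin p × ℝ)}
    {S : Finset (EuclideanSpace ℝ (Fin p))}
    (hIF : ∀ q ∈ F, ∀ c : ℝ, ∫ ω, (ρ + |X₀ ω q.1 - c|) ^ (-(1 - τ)) ∂P ≤ I)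
    (hIS : ∀ a ∈ S, ∀ c : EuclideanSpace ℝ (Fin p), ∫ ω, (ρ + ‖X₀ ω - c‖) ^ (-α) ∂P ≤ I)
    {f : EuclideanSpace ℝ (Fin p) → ℝ} (hf0 : ∀ z, 0 ≤ f z)
    {c : ℝ} (hc : 0 ≤ c) (hf : ∀ z, f z ≤
      c * (ρ + ∑ q ∈ F, ρ / (ρ + |z q.1 - q.2|) + ∑ a ∈ S, ρ * (ρ + ‖z - a‖) ^ (-α))) :
    ∫ ω, f (standardize m v (X₀ ω)) ∂P ≤
      c * (ρ ^ (1 - τ) * (1 + F.card * (V * I) + S.card * (V ^ α * I))) := by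
  have hV0 : 0 < V := by linarith
  have hsmall : ρ ≤ ρ ^ (1 - τ) := by
    calc ρ = ρ ^ (1 : ℝ) := (Real.rpow_one _).symm
      _ ≤ _ := Real.rpow_le_rpow_of_exponent_ge hρ hρ1 (by linarith)
  set A := ρ ^ (1 - τ) with hA
  have hA0 : 0 ≤ A := by rw [hA]; positivity
  clear_value A
  have iF : ∀ q : Fin p × ℝ, Integrable (fun ω => A *
      (V * (ρ + |X₀ ω q.1 - (m q.1 + v q.1 * q.2)|) ^ (-(1 - τ)))) P := by
    intro q
    refine Integrable.const_mul (Integrable.const_mul (Integrable.of_bound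
      (C := ρ ^ (-(1 - τ))) (Measurable.aestronglyMeasurable (by fun_prop))
      (Eventually.of_forall fun ω => ?_)) _) _
    rw [Real.norm_eq_abs, abs_of_nonneg (by positivity)]
    exact Real.rpow_le_rpow_of_nonpos hρ (by simp) (by linarith)
  have iS : ∀ a : EuclideanSpace ℝ (Fin p), Integrable (fun ω => A *
      (V ^ α * (ρ + ‖X₀ ω - WithLp.toLp 2 fun j => m j + v j * a j‖) ^ (-α))) P := by
    intro a
    refine Integrable.const_mul (Integrable.const_mul (Integrable.of_bound
      (C := ρ ^ (-α)) (Measurable.aestronglyMeasurable (by fun_prop))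
      (Eventually.of_forall fun ω => ?_)) _) _
    rw [Real.norm_eq_abs, abs_of_nonneg (by positivity)]
    exact Real.rpow_le_rpow_of_nonpos hρ (by simp) (by linarith)
  have isumF := integrable_finsetSum F fun q _ => iF q
  have isumS := integrable_finsetSum S fun a _ => iS a
  have i1 : Integrable (fun ω => A + ∑ q ∈ F, A *
      (V * (ρ + |X₀ ω q.1 - (m q.1 + v q.1 * q.2)|) ^ (-(1 - τ)))) P :=
    (integrable_const _).add isumF
  have i2 : Integrable (fun ω => A + ∑ q ∈ F, A *
      (V * (ρ + |X₀ ω q.1 - (m q.1 + v q.1 * q.2)|) ^ (-(1 - τ))) + ∑ a ∈ S, A *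
      (V ^ α * (ρ + ‖X₀ ω - WithLp.toLp 2 fun j => m j + v j * a j‖) ^ (-α))) P := i1.add isumS
  have hle : ∫ ω, f (standardize m v (X₀ ω)) ∂P ≤ ∫ ω, c * (A + ∑ q ∈ F, A *
      (V * (ρ + |X₀ ω q.1 - (m q.1 + v q.1 * q.2)|) ^ (-(1 - τ))) + ∑ a ∈ S, A *
      (V ^ α * (ρ + ‖X₀ ω - WithLp.toLp 2 fun j => m j + v j * a j‖) ^ (-α))) ∂P := by
    refine integral_mono_of_nonneg (Eventually.of_forall fun ω => hf0 _) (i2.const_mul c)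
      (Eventually.of_forall fun ω => (hf _).trans (mul_le_mul_of_nonneg_left ?_ hc))
    refine add_le_add (add_le_add hsmall (Finset.sum_le_sum fun q _ => ?_))
      (Finset.sum_le_sum fun a _ => ?_)
    · rw [hA]; exact div_standardize_le hv hvV hV hρ hτ q _
    · exact mul_le_mul hsmall (rpow_standardize_le hv hvV hV hρ hα a _) (by positivity) hA0
  refine hle.trans ?_
  rw [integral_const_mul]
  refine mul_le_mul_of_nonneg_left ?_ hc
  rw [integral_add i1 isumS, integral_add (integrable_const _) isumF,
    integral_finsetSum _ fun q _ => iF q, integral_finsetSum _ fun a _ => iS a]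
  simp only [integral_const_mul, integral_const, probReal_univ, one_smul]
  have b1 := Finset.sum_le_card_nsmul F (fun q => A * (V *
      ∫ ω, (ρ + |X₀ ω q.1 - (m q.1 + v q.1 * q.2)|) ^ (-(1 - τ)) ∂P)) (A * (V * I)) fun q hq =>
    mul_le_mul_of_nonneg_left (mul_le_mul_of_nonneg_left (hIF q hq _) hV0.le) hA0
  have b2 := Finset.sum_le_card_nsmul S (fun a => A * (V ^ α *
      ∫ ω, (ρ + ‖X₀ ω - WithLp.toLp 2 fun j => m j + v j * a j‖) ^ (-α) ∂P)) (A * (V ^ α * I))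
    fun a ha => mul_le_mul_of_nonneg_left
      (mul_le_mul_of_nonneg_left (hIS a ha _) (by positivity)) hA0
  rw [nsmul_eq_mul] at b1 b2
  linarith

/-- Near the population parameters, the oscillation of `Ψ` over parameters at distance at most `r` is
dominated by a bounded function whose expectation is `O(r^{1-τ})`, for every `τ > 0`. The loss of
`τ` makes the functions `|x|^{-(1-τ)}` integrable. -/
lemma exists_bracket (hX₀ : Measurable X₀) (hΨ : IsAdmissible Ψ)
    (hdens : (∃ L : ℝ≥0, LipschitzWith L Ψ) ∨
      ∃ K : ℝ≥0, P.map X₀ ≤ K • (volume : Measure (EuclideanSpace ℝ (Fin p))) ∧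
        ∀ j : Fin p, P.map (fun ω => X₀ ω j) ≤ K • (volume : Measure ℝ))
    (μ σ : EuclideanSpace ℝ (Fin p)) (hσ : ∀ j, 0 < σ j) {τ : ℝ} (hτ0 : 0 < τ) (hτ1 : τ < 1) :
    ∃ C ≥ (0 : ℝ), ∃ r₀ > (0 : ℝ), ∀ m' v' : EuclideanSpace ℝ (Fin p), (∀ j, |m' j - μ j| ≤ r₀) →
      (∀ j, |v' j - σ j| ≤ r₀) → ∀ r, 0 < r → r ≤ r₀ →
      ∃ g : EuclideanSpace ℝ (Fin p) → ℝ, Measurable g ∧ (∀ x, 0 ≤ g x) ∧ (∀ x, g x ≤ C) ∧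
        ∫ ω, g (X₀ ω) ∂P ≤ C * r ^ (1 - τ) ∧
        ∀ m v : EuclideanSpace ℝ (Fin p), (∀ j, |m j - m' j| ≤ r) → (∀ j, |v j - v' j| ≤ r) →
          ∀ x, ‖Ψ (standardize m v x) - Ψ (standardize m' v' x)‖ ≤ g x := by
  classical
  obtain ⟨C₀, hC₀⟩ := hΨ.bounded
  have hC₀p : 0 ≤ C₀ := (norm_nonneg _).trans (hC₀ 0).le
  obtain ⟨F, S, α, hα0, hαp, hLip, C₁, hC₁, r₁, hr₁, hmod⟩ := hΨ.exists_modulus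
  -- uniform expectation bounds for the terms of the modulus
  obtain ⟨I, hI0, hIF, hIS⟩ : ∃ I ≥ (0 : ℝ),
      (∀ q ∈ F, ∀ (c r : ℝ), 0 < r → ∫ ω, (r + |X₀ ω q.1 - c|) ^ (-(1 - τ)) ∂P ≤ I) ∧
      (∀ a ∈ S, ∀ (c : EuclideanSpace ℝ (Fin p)) (r : ℝ), 0 < r →
        ∫ ω, (r + ‖X₀ ω - c‖) ^ (-α) ∂P ≤ I) := by
    rcases hdens with hL | ⟨K, hK, hKj⟩
    · obtain ⟨rfl, rfl⟩ := hLip hL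
      exact ⟨0, le_rfl, by simp, by simp⟩
    obtain ⟨I, hI, hIF, hIS⟩ := exists_integral_modulus_le hX₀ hK hKj hτ0 hτ1 hα0 hαp
    exact ⟨I, hI, fun q _ => hIF q.1, hIS⟩
  -- bounds for the scale parameters
  set lo := (1 + ∑ j, (σ j)⁻¹)⁻¹ with hlo
  have hsum0 : 0 ≤ ∑ j, (σ j)⁻¹ := Finset.sum_nonneg fun j _ => (inv_pos.2 (hσ j)).le
  have hlo0 : 0 < lo := by rw [hlo]; positivity
  have hlo1 : lo ≤ 1 := inv_le_one_of_one_le₀ (by linarith)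
  have hloσ : ∀ j, lo ≤ σ j := by
    intro j
    rw [hlo, inv_le_comm₀ (by positivity) (hσ j)]
    have := Finset.single_le_sum (f := fun j => (σ j)⁻¹) (fun j _ => (inv_pos.2 (hσ j)).le)
      (Finset.mem_univ j)
    simp only at this
    linarith
  set V := 2 * (1 + ∑ j, σ j) with hV
  have hσV : ∀ j, σ j + 1 ≤ V := by
    intro j
    have := Finset.single_le_sum (f := fun j => σ j) (fun j _ => (hσ j).le) (Finset.mem_univ j)
    simp only at this
    have := (hσ j).le
    rw [hV]; linarith
  have hV1 : 1 ≤ V := by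
    have : 0 ≤ ∑ j, σ j := Finset.sum_nonneg fun j _ => (hσ j).le
    rw [hV]; linarith
  clear_value lo V
  set l := lo / 2 with hl
  have hl0 : 0 < l := by rw [hl]; positivity
  clear_value l
  set D := 1 + F.card * (V * I) + S.card * (V ^ α * I) with hD
  have hV0 : 0 ≤ V := by linarith
  have hD0 : 0 ≤ D := by rw [hD]; positivity
  clear_value D
  set C := 2 * C₀ + C₁ * (D * (1 / l) ^ (1 - τ)) with hC
  have hCb : 0 ≤ C₁ * (D * (1 / l) ^ (1 - τ)) := by positivity
  clear_value C
  refine ⟨C, by rw [hC]; positivity, min (lo / 4) (l * min r₁ 1), by positivity, ?_⟩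
  intro m' v' hm' hv' r hr hrr
  have hr4 : r ≤ lo / 4 := hrr.trans (min_le_left _ _)
  set ρ := r / l with hρ
  have hρ0 : 0 < ρ := by rw [hρ]; positivity
  clear_value ρ
  have hρm : ρ ≤ min r₁ 1 := by
    rw [hρ, div_le_iff₀ hl0, mul_comm]; exact hrr.trans (min_le_right _ _)
  have hρ1 : ρ ≤ 1 := hρm.trans (min_le_right _ _)
  have hv'lo : ∀ j, lo / 2 ≤ v' j := fun j => by
    have h1 := (abs_le.1 ((hv' j).trans (min_le_left _ _))).1
    have h2 := hloσ j
    linarith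
  have hv'0 : ∀ j, 0 < v' j := fun j => (half_pos hlo0).trans_le (hv'lo j)
  have hv'V : ∀ j, v' j ≤ V := fun j => by
    have h1 := (abs_le.1 ((hv' j).trans (min_le_left _ _))).2
    have h2 := hσV j
    linarith
  set W : EuclideanSpace ℝ (Fin p) → ℝ := fun z => ρ + ∑ q ∈ F, ρ / (ρ + |z q.1 - q.2|) +
    ∑ a ∈ S, ρ * (ρ + ‖z - a‖) ^ (-α) with hW
  have hW0 : ∀ z, 0 ≤ W z := fun z => by rw [hW]; positivity
  have hWm : Measurable W := by
    rw [hW]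
    refine (measurable_const.add (Finset.measurable_sum _ fun q _ => ?_)).add
      (Finset.measurable_sum _ fun a _ => ?_)
    · fun_prop
    · fun_prop
  clear_value W
  have hzm := measurable_standardize m' v'
  refine ⟨fun x => min (2 * C₀) (C₁ * W (standardize m' v' x)),
    measurable_const.min ((hWm.comp hzm).const_mul _),
    fun x => le_min (by positivity) (mul_nonneg hC₁ (hW0 _)),
    fun x => (min_le_left _ _).trans (by rw [hC]; linarith), ?_, ?_⟩
  · -- the expectation
    have hle : ∫ ω, min (2 * C₀) (C₁ * W (standardize m' v' (X₀ ω))) ∂P ≤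
        C₁ * (ρ ^ (1 - τ) * D) := by
      rw [hD]
      exact integral_modulus_le (f := fun z => min (2 * C₀) (C₁ * W z)) hX₀ hv'0 hv'V hV1 hρ0 hρ1
        hτ0 hτ1 hα0 (fun q hq c => hIF q hq c ρ hρ0) (fun a ha c => hIS a ha c ρ hρ0)
        (fun z => le_min (by positivity) (mul_nonneg hC₁ (hW0 z))) hC₁
        (fun z => by rw [hW]; exact min_le_right _ _)
    refine hle.trans ?_
    have e : C₁ * (ρ ^ (1 - τ) * D) = C₁ * (D * (1 / l) ^ (1 - τ)) * r ^ (1 - τ) := by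
      rw [hρ, div_eq_mul_one_div, Real.mul_rpow hr.le (by positivity)]; ring
    rw [e]
    gcongr
    rw [hC]; linarith
  · intro m v hm hv x
    have hvl : ∀ j, l ≤ v j := fun j => by
      have h1 := (abs_le.1 ((hv' j).trans (min_le_left _ _))).1
      have h2 := hloσ j
      have h3 := (abs_le.1 (hv j)).1
      rw [hl]; linarith
    refine le_min ?_ ?_
    · have := norm_sub_le (Ψ (standardize m v x)) (Ψ (standardize m' v' x))
      have := hC₀ (standardize m v x)
      have := hC₀ (standardize m' v' x)
      linarith
    · have hrel := isRelClose_standardize hl0 hvl hv'0 hm hv x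
      rw [← hρ] at hrel
      rw [hW]
      exact hmod ρ hρ0 (hρm.trans (min_le_left _ _)) _ _ hrel

end Bracket

/-! ### Perturbation of the kernel estimator -/

section Kernel

/-- The kernel is the cosine transform of an integrable function up to a jump part carried by the
finitely many discontinuities, which meets each row of the weight matrix in boundedly many places. -/
lemma IsKernelBandwidth.exists_cosKernel_add_jump {k : ℝ → ℝ} {b : ℕ → ℝ}
    (hk : IsKernelBandwidth k b) :
    ∃ (g J : ℝ → ℝ) (R : ℝ), k = cosKernel g + J ∧ Integrable g ∧ 0 ≤ R ∧
      ∀ β : ℝ, 0 < β → ∀ T i : ℕ, i < T →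
        ∑ j ∈ Finset.range T, |J (|(i : ℝ) - (j : ℝ)| / β)| ≤ R := by
  classical
  set g : ℝ → ℝ := fun ξ => (𝓕 (fun x : ℝ => (k x : ℂ)) ξ).re with hg
  have hgi : Integrable g := hk.integrable_fourier.re
  set J : ℝ → ℝ := k - cosKernel g with hJ
  set c := 1 + ∫ ξ, |g ξ| with hc
  have hc0 : 0 ≤ c := by
    have : 0 ≤ ∫ ξ, |g ξ| := integral_nonneg fun _ => abs_nonneg _
    linarith
  have hJc : ∀ x, |J x| ≤ c := fun x => by
    refine (abs_sub _ _).trans (add_le_add (hk.abs_le_one x) (abs_cosKernel_le g hgi x))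
  have hJ0 : ∀ x, ContinuousAt k x → J x = 0 := fun x hx => by
    rw [hJ, Pi.sub_apply, sub_eq_zero]
    exact eq_cosKernel_of_continuousAt hk.integrable hk.integrable_fourier hk.even hx
  set D := hk.finite_discontinuities.toFinset with hD
  refine ⟨g, J, 2 * (D.card * c), by rw [hJ]; simp, hgi, by positivity, fun β hβ T i hi => ?_⟩
  have h1 : ∑ j ∈ Finset.range T, |J (|(i : ℝ) - (j : ℝ)| / β)| ≤
      2 * ∑ h ∈ Finset.range T, |J ((h : ℝ) / β)| := by
    simp only [natCast_dist]
    exact sum_dist_le (β := fun h : ℕ => |J ((h : ℝ) / β)|) (fun _ => abs_nonneg _) hi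
  refine h1.trans (mul_le_mul_of_nonneg_left ?_ (by norm_num))
  have hinj : Function.Injective fun h : ℕ => (h : ℝ) / β := fun x y hxy => by
    have : (x : ℝ) = y := by
      simpa [div_left_inj' hβ.ne'] using hxy
    exact_mod_cast this
  calc ∑ h ∈ Finset.range T, |J ((h : ℝ) / β)|
      = ∑ x ∈ (Finset.range T).image fun h : ℕ => (h : ℝ) / β, |J x| :=
        (Finset.sum_image (f := fun x => |J x|) hinj.injOn).symm
    _ = ∑ x ∈ ((Finset.range T).image fun h : ℕ => (h : ℝ) / β).filter (· ∈ D), |J x| := by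
        refine (Finset.sum_filter_of_ne fun x _ hx => ?_).symm
        rw [hD, Set.Finite.mem_toFinset]
        intro hcont
        exact hx (by rw [hJ0 x hcont, abs_zero])
    _ ≤ ∑ x ∈ D, |J x| := Finset.sum_le_sum_of_subset_of_nonneg
        (fun x hx => (Finset.mem_filter.1 hx).2) fun _ _ _ => abs_nonneg _
    _ ≤ D.card * c := by
        rw [← nsmul_eq_mul]
        exact Finset.sum_le_card_nsmul _ _ _ fun x _ => hJc x

variable {g J : ℝ → ℝ} {b : ℝ} {T : ℕ}

/-- A quadratic form with bounded rows is controlled by the mean absolute size of one argument. -/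
lemma abs_quadForm_le_of_row {R c : ℝ} (hc : 0 ≤ c)
    (hJ : ∀ i < T, ∑ j ∈ Finset.range T, |J (|(i : ℝ) - (j : ℝ)| / b)| ≤ R) {u v : ℕ → ℝ}
    (hu : ∀ i, |u i| ≤ c) :
    |quadForm J b T v u| ≤ c * R * sampleMean T fun i => |v i| := by
  unfold quadForm sampleMean
  rw [abs_mul, abs_of_nonneg (by positivity : (0 : ℝ) ≤ (T : ℝ)⁻¹), mul_left_comm]
  refine mul_le_mul_of_nonneg_left ?_ (by positivity)
  rw [Finset.mul_sum]
  refine (Finset.abs_sum_le_sum_abs _ _).trans (Finset.sum_le_sum fun i hi => ?_)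
  refine (Finset.abs_sum_le_sum_abs _ _).trans ?_
  calc ∑ j ∈ Finset.range T, |v i * u j * J (|(i : ℝ) - (j : ℝ)| / b)|
      ≤ ∑ j ∈ Finset.range T, |v i| * c * |J (|(i : ℝ) - (j : ℝ)| / b)| := by
        refine Finset.sum_le_sum fun j _ => ?_
        rw [abs_mul, abs_mul]
        gcongr
        exact hu j
    _ = |v i| * c * ∑ j ∈ Finset.range T, |J (|(i : ℝ) - (j : ℝ)| / b)| := by
        rw [Finset.mul_sum]
    _ ≤ |v i| * c * R := by
        gcongr
        exact hJ i (Finset.mem_range.1 hi)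
    _ = c * R * |v i| := by ring

/-- Change of the estimator under a perturbation `w` of the sample `v`. The spectral part of the
kernel is handled by Cauchy–Schwarz for the spectral energy, with free weight `t`, and needs no bound
on the bandwidth; the jump part is handled by absolute values. -/
lemma abs_quadForm_center_add_sub_le (hg : Integrable g) {R c t : ℝ} (ht : 0 < t)
    (hJ : ∀ i < T, ∑ j ∈ Finset.range T, |J (|(i : ℝ) - (j : ℝ)| / b)| ≤ R) (hR : 0 ≤ R)
    {v w : ℕ → ℝ} (hv : ∀ i, |v i| ≤ c) (hw : ∀ i, |w i| ≤ c) :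
    |quadForm (cosKernel g + J) b T (center T (v + w)) (center T (v + w)) -
        quadForm (cosKernel g + J) b T (center T v) (center T v)| ≤
      t * spectralEnergy g b T (center T v) +
        (1 + t⁻¹ + 12 * c * R) *
          (spectralEnergy g b T (center T w) + sampleMean T fun i => |w i|) := by
  have hc : 0 ≤ c := (abs_nonneg _).trans (hv 0)
  have e : quadForm (cosKernel g + J) b T (center T (v + w)) (center T (v + w)) -
        quadForm (cosKernel g + J) b T (center T v) (center T v) =
      2 * quadForm (cosKernel g) b T (center T v) (center T w) +
        quadForm (cosKernel g) b T (center T w) (center T w) +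
        (2 * quadForm J b T (center T w) (center T v) +
          quadForm J b T (center T w) (center T w)) := by
    simp only [center_add, quadForm_add_left, quadForm_add_right, quadForm_add_kernel]
    rw [quadForm_symm (κ := cosKernel g) (center T w) (center T v),
      quadForm_symm (κ := J) (center T w) (center T v)]
    ring
  have h1 := abs_two_mul_quadForm_cosKernel_le (b := b) (T := T) hg (center T v) (center T w) ht
  have h2 := abs_quadForm_cosKernel_self_le (b := b) (T := T) hg (center T w)
  have h3 := abs_quadForm_le_of_row (c := 2 * c) (v := center T w) (by positivity) hJ
    (abs_center_le hv T)
  have h4 := abs_quadForm_le_of_row (c := 2 * c) (v := center T w) (by positivity) hJ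
    (abs_center_le hw T)
  have h5 : sampleMean T (fun i => |center T w i|) ≤ 2 * sampleMean T fun i => |w i| := by
    unfold sampleMean
    rw [mul_left_comm]
    exact mul_le_mul_of_nonneg_left (sum_abs_center_le w) (by positivity)
  have h6 := mul_le_mul_of_nonneg_left h5 (by positivity : 0 ≤ 2 * c * R)
  have h7 : 0 ≤ sampleMean T fun i => |w i| := by
    unfold sampleMean; positivity
  have h8 := spectralEnergy_nonneg (b := b) (T := T) hg (center T w)
  generalize spectralEnergy g b T (center T w) = E at h1 h2 h8 ⊢
  generalize sampleMean T (fun i => |w i|) = A at h6 h7 ⊢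
  rw [e]
  refine (abs_add_le _ _).trans ?_
  have h9 := abs_add_le (2 * quadForm (cosKernel g) b T (center T v) (center T w))
    (quadForm (cosKernel g) b T (center T w) (center T w))
  have h10 := abs_add_le (2 * quadForm J b T (center T w) (center T v))
    (quadForm J b T (center T w) (center T w))
  rw [abs_mul 2 (quadForm J b T _ _), abs_two] at h10
  have h11 : 0 ≤ (1 + t⁻¹) * A := by positivity
  have h12 : 0 ≤ 12 * c * R * E := by positivity
  nlinarith

end Kernel

section Net

variable {g : ℝ → ℝ} {b : ℝ} {T : ℕ}

/-- Spectral energy of a sequence `u` in a bracket around `f`: the width `e` of the bracket is split into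
a fluctuation around `m` and the constant `m`. -/
lemma spectralEnergy_center_le (hg : Integrable g) (hT : T ≠ 0) {u f e : ℕ → ℝ} {m : ℝ}
    (h : ∀ i, |u i - f i| ≤ e i) :
    spectralEnergy g b T (center T u) ≤ 2 * spectralEnergy g b T (center T f) +
      16 * (∫ ξ, |g ξ|) * (T * sampleMean T (fun i => e i - m) ^ 2) +
      16 * (∫ ξ, |g ξ|) * (T * m ^ 2) := by
  have hT0 : (0 : ℝ) < T := by exact_mod_cast Nat.pos_of_ne_zero hT
  set d : ℕ → ℝ := u - f with hd
  have hu : u = f + d := by rw [hd]; simp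
  have h1 := spectralEnergy_add_le (b := b) (T := T) hg (center T f) (center T d)
  rw [← center_add, ← hu] at h1
  have h2 := spectralEnergy_le_sq_sum (b := b) (T := T) hg (center T d)
  have hG : 0 ≤ ∫ ξ, |g ξ| := integral_nonneg fun _ => abs_nonneg _
  have h3 : ∑ i ∈ Finset.range T, |center T d i| ≤ 2 * ∑ i ∈ Finset.range T, e i :=
    (sum_abs_center_le d).trans
      (mul_le_mul_of_nonneg_left (Finset.sum_le_sum fun i _ => h i) (by norm_num))
  have h4 : (∑ i ∈ Finset.range T, |center T d i|) ^ 2 ≤ (2 * ∑ i ∈ Finset.range T, e i) ^ 2 :=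
    pow_le_pow_left₀ (Finset.sum_nonneg fun _ _ => abs_nonneg _) h3 2
  have e1 : ∑ i ∈ Finset.range T, e i = T * (sampleMean T (fun i => e i - m) + m) := by
    unfold sampleMean
    rw [Finset.sum_sub_distrib, Finset.sum_const, Finset.card_range, nsmul_eq_mul]
    field_simp; ring
  rw [e1] at h4
  generalize sampleMean T (fun i => e i - m) = a at h4 ⊢
  have h5 : (T : ℝ)⁻¹ * (∑ i ∈ Finset.range T, |center T d i|) ^ 2 ≤ T * (8 * a ^ 2 + 8 * m ^ 2) := by
    calc (T : ℝ)⁻¹ * (∑ i ∈ Finset.range T, |center T d i|) ^ 2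
        ≤ (T : ℝ)⁻¹ * (2 * (T * (a + m))) ^ 2 := by gcongr
      _ = T * (4 * (a + m) ^ 2) := by field_simp; ring
      _ ≤ T * (8 * a ^ 2 + 8 * m ^ 2) := by
          gcongr; nlinarith [sq_nonneg (a - m)]
  have h6 := mul_le_mul_of_nonneg_left h5 hG
  linarith

variable {Ω : Type*} [MeasurableSpace Ω] {P : Measure Ω} [IsProbabilityMeasure P] {p : ℕ}
  {X : ℕ → Ω → EuclideanSpace ℝ (Fin p)}

/-- Uniform control of the spectral energy and of the mean absolute value over all sequences that
are, up to a bracket `e j`, one of finitely many sequences `f j (X_t)`. The squared bias of the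
brackets enters only once and not once per element of the net. -/
lemma exists_net_majorant (hX : ∀ t, Measurable (X t)) (hstat : IsStrictlyStationary X P)
    (hmix : Summable fun k : ℕ => (k : ℝ) ^ 2 * mixingCoeff X P k) (hg : Integrable g) (b : ℝ)
    (hT : T ≠ 0) {ι : Type*} (N : Finset ι) {f e : ι → EuclideanSpace ℝ (Fin p) → ℝ}
    (hf : ∀ j ∈ N, Measurable (f j)) (he : ∀ j ∈ N, Measurable (e j)) {c q q₁ : ℝ}
    (hfc : ∀ j ∈ N, ∀ x, |f j x| ≤ c) (he0 : ∀ j ∈ N, ∀ x, 0 ≤ e j x)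
    (hec : ∀ j ∈ N, ∀ x, e j x ≤ c) (hfq : ∀ j ∈ N, ∫ ω, |f j (X 0 ω)| ∂P ≤ q)
    (heq : ∀ j ∈ N, ∫ ω, e j (X 0 ω) ∂P ≤ q) (heq₁ : ∀ j ∈ N, ∫ ω, e j (X 0 ω) ∂P ≤ q₁) :
    ∃ R : Ω → ℝ, Integrable R P ∧ (∀ ω, 0 ≤ R ω) ∧
      ∫ ω, R ω ∂P ≤ N.card * (48 * (∫ ξ, |g ξ|) * (√(8 * c ^ 3 * q) * ∑' h, √(mixingCoeff X P h)) +
        2 * q) ∧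
      ∀ (ω : Ω) (u : ℕ → ℝ), (∃ j ∈ N, ∀ i, |u i - f j (X i ω)| ≤ e j (X i ω)) →
        spectralEnergy g b T (center T u) + sampleMean T (fun i => |u i|) ≤
          R ω + 16 * (∫ ξ, |g ξ|) * (T * q₁ ^ 2) := by
  have hG : 0 ≤ ∫ ξ, |g ξ| := integral_nonneg fun _ => abs_nonneg _
  set G := ∫ ξ, |g ξ| with hGdef
  set S := √(8 * c ^ 3 * q) * ∑' h, √(mixingCoeff X P h) with hS
  set E₁ : ι → Ω → ℝ := fun j ω => spectralEnergy g b T (center T fun i => f j (X i ω)) with hE₁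
  set E₂ : ι → Ω → ℝ := fun j ω =>
    sampleMean T (fun i => e j (X i ω) - ∫ ω, e j (X 0 ω) ∂P) ^ 2 with hE₂
  set E₃ : ι → Ω → ℝ := fun j ω => sampleMean T fun i => |f j (X i ω)| + e j (X i ω) with hE₃
  have cf : ∀ j ∈ N, HasCovBound P (fun i ω => f j (X i ω) - ∫ ω, f j (X 0 ω) ∂P)
      (fun h => √(8 * c ^ 3 * q) * √(mixingCoeff X P h)) := fun j hj =>
    hasCovBound_of_bounded hX hstat hmix (hf j hj) (hfc j hj) (hfq j hj)
  have ce : ∀ j ∈ N, HasCovBound P (fun i ω => e j (X i ω) - ∫ ω, e j (X 0 ω) ∂P)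
      (fun h => √(8 * c ^ 3 * q) * √(mixingCoeff X P h)) := fun j hj =>
    hasCovBound_of_bounded hX hstat hmix (he j hj)
      (fun x => by rw [abs_of_nonneg (he0 j hj x)]; exact hec j hj x)
      (by simpa only [abs_of_nonneg (he0 j hj _)] using heq j hj)
  have i1 : ∀ j ∈ N, Integrable (E₁ j) P := fun j hj => by
    have hm := measurable_center (fun i => (hf j hj).comp (hX i)) T
    exact integrable_quadForm hm hm
      (bounded_center ⟨c, fun i ω => hfc j hj _⟩ T)
      (bounded_center ⟨c, fun i ω => hfc j hj _⟩ T) _ b T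
  have b1 : ∀ j ∈ N, ∫ ω, E₁ j ω ∂P ≤ 8 * G * S := fun j hj => by
    have := (cf j hj).integral_spectralEnergy_center_le hg b hT
    rw [tsum_mul_left] at this
    have e1 : ∀ ω, center T (fun i => f j (X i ω) - ∫ ω, f j (X 0 ω) ∂P) =
        center T fun i => f j (X i ω) := fun ω => by
      simpa only [sub_eq_add_neg] using center_add_const hT (fun i => f j (X i ω)) _
    simpa only [e1] using this
  have hem : ∀ j ∈ N, ∀ i, Measurable fun ω => e j (X i ω) := fun j hj i => (he j hj).comp (hX i)
  have hfm : ∀ j ∈ N, ∀ i, Measurable fun ω => f j (X i ω) := fun j hj i => (hf j hj).comp (hX i)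
  have i2 : ∀ j ∈ N, Integrable (E₂ j) P := fun j hj => by
    obtain ⟨c', hc'⟩ := (ce j hj).bounded
    refine Integrable.of_bound (C := c' ^ 2) (Measurable.aestronglyMeasurable ?_)
      (Eventually.of_forall fun ω => ?_)
    · simp only [hE₂, sampleMean]
      exact ((Finset.measurable_sum _ fun i _ => (hem j hj i).sub_const _).const_mul _).pow_const 2
    · rw [Real.norm_eq_abs, hE₂, abs_pow]
      exact pow_le_pow_left₀ (abs_nonneg _) (abs_sampleMean_le (fun i => hc' i ω) T) 2
  have b2 : ∀ j ∈ N, T * ∫ ω, E₂ j ω ∂P ≤ 2 * S := fun j hj => by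
    have := (ce j hj).integral_sq_sampleMean_le hT
    rwa [tsum_mul_left] at this
  have iabs : ∀ j ∈ N, ∀ i, Integrable (fun ω => |f j (X i ω)|) P := fun j hj i =>
    Integrable.of_bound (C := c) (hfm j hj i).abs.aestronglyMeasurable
      (Eventually.of_forall fun ω => by simpa using hfc j hj (X i ω))
  have ie : ∀ j ∈ N, ∀ i, Integrable (fun ω => e j (X i ω)) P := fun j hj i =>
    Integrable.of_bound (C := c) (hem j hj i).aestronglyMeasurable
      (Eventually.of_forall fun ω => by
        rw [Real.norm_eq_abs, abs_of_nonneg (he0 j hj _)]; exact hec j hj (X i ω))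
  have i3 : ∀ j ∈ N, Integrable (E₃ j) P := fun j hj => by
    simp only [hE₃, sampleMean]
    exact (integrable_finsetSum _ fun i _ => (iabs j hj i).add (ie j hj i)).const_mul _
  have b3 : ∀ j ∈ N, ∫ ω, E₃ j ω ∂P ≤ 2 * q := fun j hj => by
    simp only [hE₃, sampleMean]
    have hadd : ∀ i, Integrable (fun ω => |f j (X i ω)| + e j (X i ω)) P := fun i =>
      (iabs j hj i).add (ie j hj i)
    rw [integral_const_mul, integral_finsetSum _ fun i _ => hadd i]
    have : ∀ i ∈ Finset.range T, ∫ ω, (|f j (X i ω)| + e j (X i ω)) ∂P ≤ 2 * q := fun i _ => by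
      rw [integral_add (iabs j hj i) (ie j hj i),
        integral_comp_eq hX hstat (f := fun x => |f j x|) (hf j hj).abs i,
        integral_comp_eq hX hstat (he j hj) i]
      have := hfq j hj
      have := heq j hj
      linarith
    have hs := Finset.sum_le_card_nsmul _ _ _ this
    rw [Finset.card_range, nsmul_eq_mul] at hs
    have hT0 : (0 : ℝ) < T := by exact_mod_cast Nat.pos_of_ne_zero hT
    rw [inv_mul_le_iff₀ hT0]
    exact hs
  have n1 : ∀ j ω, 0 ≤ E₁ j ω := fun j ω => spectralEnergy_nonneg hg _
  have n2 : ∀ j ω, 0 ≤ E₂ j ω := fun j ω => sq_nonneg _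
  have n3 : ∀ j ∈ N, ∀ ω, 0 ≤ E₃ j ω := fun j hj ω =>
    mul_nonneg (by positivity) (Finset.sum_nonneg fun i _ => add_nonneg (abs_nonneg _) (he0 j hj _))
  have iR : ∀ j ∈ N, Integrable (fun ω => 2 * E₁ j ω + 16 * G * (T * E₂ j ω) + E₃ j ω) P :=
    fun j hj => (((i1 j hj).const_mul 2).add (((i2 j hj).const_mul _).const_mul _)).add (i3 j hj)
  have nR : ∀ j ∈ N, ∀ ω, 0 ≤ 2 * E₁ j ω + 16 * G * (T * E₂ j ω) + E₃ j ω := fun j hj ω => by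
    have := n1 j ω
    have := n2 j ω
    have := n3 j hj ω
    positivity
  refine ⟨fun ω => ∑ j ∈ N, (2 * E₁ j ω + 16 * G * (T * E₂ j ω) + E₃ j ω),
    integrable_finsetSum _ iR, fun ω => Finset.sum_nonneg fun j hj => nR j hj ω, ?_, ?_⟩
  · rw [integral_finsetSum _ iR, ← nsmul_eq_mul]
    refine Finset.sum_le_card_nsmul _ _ _ fun j hj => ?_
    have j12 : Integrable (fun ω => 2 * E₁ j ω + 16 * G * (T * E₂ j ω)) P :=
      ((i1 j hj).const_mul 2).add (((i2 j hj).const_mul _).const_mul _)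
    rw [integral_add j12 (i3 j hj), integral_add ((i1 j hj).const_mul 2)
      (((i2 j hj).const_mul _).const_mul _), integral_const_mul, integral_const_mul,
      integral_const_mul]
    have h1 := b1 j hj
    have h2 := mul_le_mul_of_nonneg_left (b2 j hj) (by positivity : 0 ≤ 16 * G)
    have h3 := b3 j hj
    linarith
  · rintro ω u ⟨j, hj, hu⟩
    have h1 := spectralEnergy_center_le (b := b) (m := ∫ ω, e j (X 0 ω) ∂P) hg hT hu
    have h2 : sampleMean T (fun i => |u i|) ≤ E₃ j ω := by
      simp only [hE₃, sampleMean]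
      refine mul_le_mul_of_nonneg_left (Finset.sum_le_sum fun i _ => ?_) (by positivity)
      have := abs_sub_abs_le_abs_sub (u i) (f j (X i ω))
      linarith [hu i]
    have h3 : (∫ ω, e j (X 0 ω) ∂P) ^ 2 ≤ q₁ ^ 2 :=
      pow_le_pow_left₀ (integral_nonneg fun ω => he0 j hj _) (heq₁ j hj) 2
    have h4 : 16 * G * (T * (∫ ω, e j (X 0 ω) ∂P) ^ 2) ≤ 16 * G * (T * q₁ ^ 2) := by gcongr
    have h5 := Finset.single_le_sum
      (f := fun j => 2 * E₁ j ω + 16 * G * (T * E₂ j ω) + E₃ j ω) (fun j hj => nR j hj ω) hj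
    simp only [hE₁, hE₂] at h5 ⊢
    linarith

end Net

/-! ### Estimated location and scale are asymptotically negligible -/

section Grid

variable {p : ℕ}

/-- The point of the cubic grid of mesh `r` around `m` with integer coordinates `z`. -/
noncomputable def gridPoint (m : EuclideanSpace ℝ (Fin p)) (r : ℝ) (z : Fin p → ℤ) :
    EuclideanSpace ℝ (Fin p) := WithLp.toLp 2 fun j => m j + r * z j

/-- The integer coordinates of the grid points in a cube of half-width `N`. -/
noncomputable def gridIndex (p N : ℕ) : Finset (Fin p → ℤ) :=
  Fintype.piFinset fun _ => Finset.Icc (-(N : ℤ)) N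

lemma card_gridIndex (p N : ℕ) : (gridIndex p N).card = (2 * N + 1) ^ p := by
  rw [gridIndex, Fintype.card_piFinset]
  simp only [Int.card_Icc, Finset.prod_const, Finset.card_univ, Fintype.card_fin]
  congr 1
  omega

lemma abs_gridPoint_sub_le {m : EuclideanSpace ℝ (Fin p)} {r : ℝ} (hr : 0 ≤ r) {N : ℕ}
    {z : Fin p → ℤ} (hz : z ∈ gridIndex p N) (j : Fin p) : |gridPoint m r z j - m j| ≤ r * N := by
  have h := Finset.mem_Icc.1 (Fintype.mem_piFinset.1 hz j)
  have e : gridPoint m r z j - m j = r * z j := by simp [gridPoint]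
  rw [e, abs_mul, abs_of_nonneg hr]
  refine mul_le_mul_of_nonneg_left ?_ hr
  rw [abs_le]
  have h1 : ((-(N : ℤ) : ℤ) : ℝ) ≤ (z j : ℝ) := Int.cast_le.2 h.1
  have h2 : (z j : ℝ) ≤ ((N : ℤ) : ℝ) := Int.cast_le.2 h.2
  push_cast at h1 h2
  exact ⟨h1, h2⟩

lemma exists_gridPoint {m : EuclideanSpace ℝ (Fin p)} {r : ℝ} (hr : 0 < r) {N : ℕ}
    {x : EuclideanSpace ℝ (Fin p)} (hx : ∀ j, |x j - m j| ≤ r * N) :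
    ∃ z ∈ gridIndex p N, ∀ j, |x j - gridPoint m r z j| ≤ r := by
  refine ⟨fun j => ⌊(x j - m j) / r⌋, Fintype.mem_piFinset.2 fun j => Finset.mem_Icc.2 ⟨?_, ?_⟩,
    fun j => ?_⟩
  · rw [Int.le_floor, le_div_iff₀ hr]
    push_cast
    linarith [(abs_le.1 (hx j)).1]
  · have h : (x j - m j) / r ≤ N := by
      rw [div_le_iff₀ hr]
      linarith [(abs_le.1 (hx j)).2]
    have h' : ((⌊(x j - m j) / r⌋ : ℤ) : ℝ) ≤ ((N : ℤ) : ℝ) := by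
      push_cast
      exact (Int.floor_le _).trans h
    exact Int.cast_le.1 h'
  · have h1 := Int.floor_le ((x j - m j) / r)
    have h2 := (Int.lt_floor_add_one ((x j - m j) / r)).le
    rw [le_div_iff₀ hr] at h1
    rw [div_le_iff₀ hr] at h2
    simp only [gridPoint]
    rw [abs_le]
    constructor <;> linarith

end Grid

section Brackets

variable {Ω : Type*} [MeasurableSpace Ω] {P : Measure Ω} [IsProbabilityMeasure P] {p s : ℕ}

/-- Near `(μ, σ)`, the oscillation of `ψ` over standardizations whose parameters differ by at most `r`
is dominated by a bounded function of the observation with expectation of order `r ^ (1 - τ)`. -/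
def HasBrackets (P : Measure Ω) (X₀ : Ω → EuclideanSpace ℝ (Fin p))
    (ψ : EuclideanSpace ℝ (Fin p) → ℝ) (μ σ : EuclideanSpace ℝ (Fin p)) (τ : ℝ) : Prop :=
  ∃ C ≥ (0 : ℝ), ∃ r₀ > (0 : ℝ), ∀ m' v' : EuclideanSpace ℝ (Fin p), (∀ j, |m' j - μ j| ≤ r₀) →
    (∀ j, |v' j - σ j| ≤ r₀) → ∀ r, 0 < r → r ≤ r₀ →
    ∃ g : EuclideanSpace ℝ (Fin p) → ℝ, Measurable g ∧ (∀ x, 0 ≤ g x) ∧ (∀ x, g x ≤ C) ∧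
      ∫ ω, g (X₀ ω) ∂P ≤ C * r ^ (1 - τ) ∧
      ∀ m v : EuclideanSpace ℝ (Fin p), (∀ j, |m j - m' j| ≤ r) → (∀ j, |v j - v' j| ≤ r) →
        ∀ x, |ψ (standardize m v x) - ψ (standardize m' v' x)| ≤ g x

lemma IsAdmissible.hasBrackets {X₀ : Ω → EuclideanSpace ℝ (Fin p)}
    {Ψ : EuclideanSpace ℝ (Fin p) → Fin s → ℝ} (hX₀ : Measurable X₀) (hΨ : IsAdmissible Ψ)
    (hdens : (∃ L : ℝ≥0, LipschitzWith L Ψ) ∨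
      ∃ K : ℝ≥0, P.map X₀ ≤ K • (volume : Measure (EuclideanSpace ℝ (Fin p))) ∧
        ∀ j : Fin p, P.map (fun ω => X₀ ω j) ≤ K • (volume : Measure ℝ))
    {μ σ : EuclideanSpace ℝ (Fin p)} (hσ : ∀ j, 0 < σ j) {τ : ℝ} (hτ0 : 0 < τ) (hτ1 : τ < 1)
    {ψ : EuclideanSpace ℝ (Fin p) → ℝ} (hψ : ∀ x y, |ψ x - ψ y| ≤ 2 * ‖Ψ x - Ψ y‖) :
    HasBrackets P X₀ ψ μ σ τ := by
  obtain ⟨C, hC, r₀, hr₀, h⟩ := exists_bracket hX₀ hΨ hdens μ σ hσ hτ0 hτ1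
  refine ⟨2 * C, by positivity, r₀, hr₀, fun m' v' hm' hv' r hr hrr => ?_⟩
  obtain ⟨g, hgm, hg0, hgC, hgi, hgb⟩ := h m' v' hm' hv' r hr hrr
  refine ⟨fun x => 2 * g x, hgm.const_mul 2, fun x => mul_nonneg two_pos.le (hg0 x),
    fun x => mul_le_mul_of_nonneg_left (hgC x) two_pos.le, ?_, fun m v hm hv x => ?_⟩
  · rw [integral_const_mul, mul_assoc]
    exact mul_le_mul_of_nonneg_left hgi two_pos.le
  · exact (hψ _ _).trans (mul_le_mul_of_nonneg_left (hgb m v hm hv x) two_pos.le)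

variable {X : ℕ → Ω → EuclideanSpace ℝ (Fin p)} {g : ℝ → ℝ}

/-- The exponent by which the mesh of the parameter grid is finer than `T ^ (-1/2)`. It is small enough
for the number of grid points to be at most of order `T ^ (1/8)`. -/
noncomputable def meshExponent (p : ℕ) : ℝ := 1 / (16 * (p + 1))

lemma meshExponent_pos (p : ℕ) : 0 < meshExponent p := by unfold meshExponent; positivity

lemma meshExponent_le (p : ℕ) : meshExponent p ≤ 1 / 16 := by
  unfold meshExponent
  rw [div_le_div_iff₀ (by positivity) (by positivity)]
  have : (0 : ℝ) ≤ p := by positivity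
  linarith

lemma two_mul_meshExponent_le (p : ℕ) : meshExponent p * (2 * p) ≤ 1 / 8 := by
  unfold meshExponent
  rw [div_mul_eq_mul_div, div_le_div_iff₀ (by positivity) (by positivity)]
  linarith

/-- Grid sizes: a mesh `T ^ (-1/2 - η)` covers the cube of half-width `M T ^ (-1/2)` by at most
`O(T ^ (1/8))` pairs of grid points, all of them at distance `O(T ^ (-1/2))`. -/
lemma exists_gridSize (p : ℕ) {M : ℝ} (hM : 0 ≤ M) {T : ℕ} (hT : T ≠ 0) :
    ∃ N : ℕ, M * (T : ℝ) ^ (-(1 / 2) : ℝ) ≤ (T : ℝ) ^ (-(1 / 2) - meshExponent p) * N ∧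
      (T : ℝ) ^ (-(1 / 2) - meshExponent p) * N ≤ (M + 1) * (T : ℝ) ^ (-(1 / 2) : ℝ) ∧
      ((2 * N + 1 : ℕ) : ℝ) ^ (2 * p) ≤ (2 * M + 3) ^ (2 * p) * (T : ℝ) ^ (1 / 8 : ℝ) := by
  have hT1 : (1 : ℝ) ≤ T := by exact_mod_cast Nat.one_le_iff_ne_zero.2 hT
  have hη := meshExponent_pos p
  have hη2 := two_mul_meshExponent_le p
  generalize meshExponent p = η at hη hη2 ⊢
  generalize (T : ℝ) = x at hT1
  have hx : 0 < x := by linarith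
  have e : x ^ (-(1 / 2) - η) * x ^ η = x ^ (-(1 / 2) : ℝ) := by
    rw [← Real.rpow_add hx]; congr 1; ring
  have hη1 : 1 ≤ x ^ η := Real.one_le_rpow hT1 hη.le
  have hr : 0 < x ^ (-(1 / 2) - η) := Real.rpow_pos_of_pos hx _
  have h1 := Nat.le_ceil (M * x ^ η)
  have h2 := (Nat.ceil_lt_add_one (by positivity : 0 ≤ M * x ^ η)).le
  refine ⟨⌈M * x ^ η⌉₊, ?_, ?_, ?_⟩
  · calc M * x ^ (-(1 / 2) : ℝ) = x ^ (-(1 / 2) - η) * (M * x ^ η) := by rw [← e]; ring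
      _ ≤ _ := mul_le_mul_of_nonneg_left h1 hr.le
  · calc _ ≤ x ^ (-(1 / 2) - η) * ((M + 1) * x ^ η) := by
          refine mul_le_mul_of_nonneg_left ?_ hr.le
          linarith
      _ = _ := by rw [← e]; ring
  · calc ((2 * ⌈M * x ^ η⌉₊ + 1 : ℕ) : ℝ) ^ (2 * p) ≤ ((2 * M + 3) * x ^ η) ^ (2 * p) := by
          refine pow_le_pow_left₀ (by positivity) ?_ _
          push_cast
          linarith
      _ = (2 * M + 3) ^ (2 * p) * x ^ (η * (2 * p)) := by
          rw [mul_pow, ← Real.rpow_natCast (x ^ η), ← Real.rpow_mul hx.le]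
          push_cast
          rfl
      _ ≤ _ := by
          refine mul_le_mul_of_nonneg_left (Real.rpow_le_rpow_of_exponent_le hT1 hη2)
            (by positivity)

/-- Uniformly over parameters in a cube of half-width `M T ^ (-1/2)` around the population parameters,
the spectral energy and the mean absolute size of the perturbation `ψ(Ẑ_t) - ψ(Z_t)` are dominated
by a random variable that tends to zero in `L¹`, plus a null sequence. -/
lemma exists_perturbation_majorant (hX : ∀ t, Measurable (X t)) (hstat : IsStrictlyStationary X P)
    (hmix : Summable fun k : ℕ => (k : ℝ) ^ 2 * mixingCoeff X P k) (hg : Integrable g) (b : ℕ → ℝ)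
    {ψ : EuclideanSpace ℝ (Fin p) → ℝ} (hψm : Measurable ψ) {c : ℝ} (hψc : ∀ x, |ψ x| ≤ c)
    {μ σ : EuclideanSpace ℝ (Fin p)} (hB : HasBrackets P (X 0) ψ μ σ (meshExponent p)) {M : ℝ}
    (hM : 0 ≤ M) :
    ∃ K ≥ (0 : ℝ), ∀ᶠ T : ℕ in atTop, ∃ R : Ω → ℝ, Integrable R P ∧ (∀ ω, 0 ≤ R ω) ∧
      ∫ ω, R ω ∂P ≤ K * (T : ℝ) ^ (-(1 / 16) : ℝ) ∧
      ∀ (ω : Ω) (m v : EuclideanSpace ℝ (Fin p)), (∀ j, |m j - μ j| ≤ M * (T : ℝ) ^ (-(1 / 2) : ℝ)) →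
        (∀ j, |v j - σ j| ≤ M * (T : ℝ) ^ (-(1 / 2) : ℝ)) →
        spectralEnergy g (b T) T (center T fun i =>
            ψ (standardize m v (X i ω)) - ψ (standardize μ σ (X i ω))) +
          sampleMean T (fun i => |ψ (standardize m v (X i ω)) - ψ (standardize μ σ (X i ω))|) ≤
          R ω + K * (T : ℝ) ^ (-(meshExponent p * (1 - 2 * meshExponent p))) := by
  obtain ⟨C, hC, r₀, hr₀, hbr⟩ := hB
  set G := ∫ ξ, |g ξ| with hG
  have hG0 : 0 ≤ G := integral_nonneg fun _ => abs_nonneg _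
  have hc0 : 0 ≤ c := (abs_nonneg _).trans (hψc 0)
  set A := ∑' h, √(mixingCoeff X P h) with hA
  have hA0 : 0 ≤ A := tsum_nonneg fun _ => Real.sqrt_nonneg _
  set Q := C * (M + 1) with hQ
  have hQ0 : 0 ≤ Q := by positivity
  set B := 48 * G * (√(8 * (2 * c + C) ^ 3 * Q) * A) + 2 * Q with hBdef
  have hB0 : 0 ≤ B := by positivity
  clear_value A
  have hη := meshExponent_pos p
  have hη16 := meshExponent_le p
  refine ⟨(2 * M + 3) ^ (2 * p) * B + 16 * G * C ^ 2, by positivity, ?_⟩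
  have hlim : Tendsto (fun T : ℕ => (M + 1) * (T : ℝ) ^ (-(1 / 2) : ℝ)) atTop (𝓝 0) := by
    have := ((tendsto_rpow_neg_atTop (by norm_num : (0 : ℝ) < 1 / 2)).comp
      tendsto_natCast_atTop_atTop).const_mul (M + 1)
    simpa using this
  filter_upwards [hlim.eventually (eventually_le_nhds hr₀), eventually_ne_atTop 0] with T hTr hT
  have hT1 : (1 : ℝ) ≤ T := by exact_mod_cast Nat.one_le_iff_ne_zero.2 hT
  have hT0 : (0 : ℝ) < T := by linarith
  obtain ⟨N, hN1, hN2, hN3⟩ := exists_gridSize p hM hT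
  set η := meshExponent p with hηdef
  clear_value η
  set r := (T : ℝ) ^ (-(1 / 2) - η) with hr
  set ρ := (M + 1) * (T : ℝ) ^ (-(1 / 2) : ℝ) with hρ
  have hr0 : 0 < r := Real.rpow_pos_of_pos hT0 _
  have hρ0 : 0 < ρ := mul_pos (by linarith) (Real.rpow_pos_of_pos hT0 _)
  have hrρ : r ≤ ρ := by
    have h1 : r ≤ (T : ℝ) ^ (-(1 / 2) : ℝ) :=
      Real.rpow_le_rpow_of_exponent_le hT1 (by linarith)
    have h2 : 0 ≤ M * (T : ℝ) ^ (-(1 / 2) : ℝ) := by positivity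
    rw [hρ]; linarith
  -- both brackets have expectations of order `T ^ (-3/8)`
  have hpow : (T : ℝ) ^ (-(1 / 2) * (1 - η)) ≤ (T : ℝ) ^ (-(3 / 8) : ℝ) :=
    Real.rpow_le_rpow_of_exponent_le hT1 (by linarith)
  have hqρ : C * ρ ^ (1 - η) ≤ Q * (T : ℝ) ^ (-(3 / 8) : ℝ) := by
    rw [hρ, Real.mul_rpow (by linarith) (by positivity), ← Real.rpow_mul hT0.le, hQ, mul_assoc]
    have : (M + 1) ^ (1 - η) ≤ M + 1 := by
      conv_rhs => rw [← Real.rpow_one (M + 1)]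
      exact Real.rpow_le_rpow_of_exponent_le (by linarith) (by linarith)
    gcongr
  have hqr : C * r ^ (1 - η) ≤ Q * (T : ℝ) ^ (-(3 / 8) : ℝ) :=
    (mul_le_mul_of_nonneg_left (Real.rpow_le_rpow hr0.le hrρ (by linarith)) hC).trans hqρ
  -- the centre bracket and the brackets at the grid points
  obtain ⟨g₀, hg₀m, hg₀0, hg₀C, hg₀i, hg₀b⟩ := hbr μ σ (fun j => by simpa using hr₀.le)
    (fun j => by simpa using hr₀.le) ρ hρ0 hTr
  have hgrid : ∀ z ∈ gridIndex p N, ∀ (m : EuclideanSpace ℝ (Fin p)) (j : Fin p),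
      |gridPoint m r z j - m j| ≤ ρ := fun z hz m j => (abs_gridPoint_sub_le hr0.le hz j).trans hN2
  have hbz : ∀ z ∈ gridIndex p N ×ˢ gridIndex p N, ∃ e : EuclideanSpace ℝ (Fin p) → ℝ,
      Measurable e ∧ (∀ x, 0 ≤ e x) ∧ (∀ x, e x ≤ C) ∧ ∫ ω, e (X 0 ω) ∂P ≤ C * r ^ (1 - η) ∧
      ∀ m v : EuclideanSpace ℝ (Fin p), (∀ j, |m j - gridPoint μ r z.1 j| ≤ r) →
        (∀ j, |v j - gridPoint σ r z.2 j| ≤ r) → ∀ x,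
        |ψ (standardize m v x) - ψ (standardize (gridPoint μ r z.1) (gridPoint σ r z.2) x)| ≤
          e x := fun z hz => by
    have hz' := Finset.mem_product.1 hz
    exact hbr _ _ (fun j => (hgrid _ hz'.1 _ j).trans hTr) (fun j => (hgrid _ hz'.2 _ j).trans hTr)
      r hr0 (hrρ.trans hTr)
  choose! e hem he0 heC hei heb using hbz
  have hmeas : ∀ m v : EuclideanSpace ℝ (Fin p), Measurable fun x => ψ (standardize m v x) :=
    fun m v => hψm.comp (measurable_standardize m v)
  have hfb : ∀ z ∈ gridIndex p N ×ˢ gridIndex p N, ∀ x,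
      |ψ (standardize (gridPoint μ r z.1) (gridPoint σ r z.2) x) - ψ (standardize μ σ x)| ≤ g₀ x :=
    fun z hz x => by
      have hz' := Finset.mem_product.1 hz
      exact hg₀b _ _ (hgrid _ hz'.1 _) (hgrid _ hz'.2 _) x
  have ig₀ : Integrable (fun ω => g₀ (X 0 ω)) P :=
    Integrable.of_bound (C := C) (hg₀m.comp (hX 0)).aestronglyMeasurable
      (Eventually.of_forall fun ω => by
        rw [Real.norm_eq_abs, abs_of_nonneg (hg₀0 _)]; exact hg₀C _)
  obtain ⟨R, hRi, hR0, hRint, hRb⟩ := exists_net_majorant (c := 2 * c + C)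
    (q := Q * (T : ℝ) ^ (-(3 / 8) : ℝ)) (q₁ := C * r ^ (1 - η)) hX hstat hmix hg (b T) hT
    (gridIndex p N ×ˢ gridIndex p N)
    (f := fun z x => ψ (standardize (gridPoint μ r z.1) (gridPoint σ r z.2) x) -
      ψ (standardize μ σ x)) (e := e) (fun z _ => (hmeas _ _).sub (hmeas _ _)) hem
    (fun z _ x => (abs_sub _ _).trans (by
      have := hψc (standardize (gridPoint μ r z.1) (gridPoint σ r z.2) x)
      have := hψc (standardize μ σ x)
      linarith)) he0 (fun z hz x => (heC z hz x).trans (by linarith))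
    (fun z hz => (integral_mono_of_nonneg (Eventually.of_forall fun _ => abs_nonneg _) ig₀
      (Eventually.of_forall fun ω => hfb z hz _)).trans (hg₀i.trans hqρ))
    (fun z hz => (hei z hz).trans hqr) hei
  refine ⟨R, hRi, hR0, hRint.trans ?_, fun ω m v hm hv => ?_⟩
  · have hcard : ((gridIndex p N ×ˢ gridIndex p N).card : ℝ) ≤
        (2 * M + 3) ^ (2 * p) * (T : ℝ) ^ (1 / 8 : ℝ) := by
      refine le_trans (le_of_eq ?_) hN3
      rw [Finset.card_product, card_gridIndex, two_mul p, pow_add]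
      push_cast
      ring
    have hsq : √(8 * (2 * c + C) ^ 3 * (Q * (T : ℝ) ^ (-(3 / 8) : ℝ))) =
        √(8 * (2 * c + C) ^ 3 * Q) * (T : ℝ) ^ (-(3 / 16) : ℝ) := by
      rw [← mul_assoc, Real.sqrt_mul (by positivity), Real.sqrt_eq_rpow ((T : ℝ) ^ _),
        ← Real.rpow_mul hT0.le]
      norm_num
    have h38 : (T : ℝ) ^ (-(3 / 8) : ℝ) ≤ (T : ℝ) ^ (-(3 / 16) : ℝ) :=
      Real.rpow_le_rpow_of_exponent_le hT1 (by norm_num)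
    have h1 : 48 * G * (√(8 * (2 * c + C) ^ 3 * (Q * (T : ℝ) ^ (-(3 / 8) : ℝ))) * A) +
        2 * (Q * (T : ℝ) ^ (-(3 / 8) : ℝ)) ≤ B * (T : ℝ) ^ (-(3 / 16) : ℝ) := by
      rw [hsq, hBdef]
      have := mul_le_mul_of_nonneg_left h38 hQ0
      linarith
    have e2 : (T : ℝ) ^ (1 / 8 : ℝ) * (T : ℝ) ^ (-(3 / 16) : ℝ) = (T : ℝ) ^ (-(1 / 16) : ℝ) := by
      rw [← Real.rpow_add hT0]; norm_num
    have hM0 : 0 ≤ (2 * M + 3) ^ (2 * p) := by positivity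
    rw [← hG, ← hA]
    calc _ ≤ ((2 * M + 3) ^ (2 * p) * (T : ℝ) ^ (1 / 8 : ℝ)) *
          (B * (T : ℝ) ^ (-(3 / 16) : ℝ)) :=
          mul_le_mul hcard h1 (by positivity) (by positivity)
      _ = (2 * M + 3) ^ (2 * p) * B * (T : ℝ) ^ (-(1 / 16) : ℝ) := by rw [← e2]; ring
      _ ≤ ((2 * M + 3) ^ (2 * p) * B + 16 * G * C ^ 2) * (T : ℝ) ^ (-(1 / 16) : ℝ) := by
          refine mul_le_mul_of_nonneg_right ?_ (by positivity)
          have : 0 ≤ 16 * G * C ^ 2 := by positivity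
          linarith
  · obtain ⟨z₁, hz₁, hz₁b⟩ := exists_gridPoint hr0 fun j => (hm j).trans hN1
    obtain ⟨z₂, hz₂, hz₂b⟩ := exists_gridPoint hr0 fun j => (hv j).trans hN1
    have hz : (z₁, z₂) ∈ gridIndex p N ×ˢ gridIndex p N := Finset.mk_mem_product hz₁ hz₂
    refine (hRb ω _ ⟨(z₁, z₂), hz, fun i => ?_⟩).trans ?_
    · have := heb _ hz m v hz₁b hz₂b (X i ω)
      simpa only [sub_sub_sub_cancel_right] using this
    · -- the squared mean of the brackets beats the sample size by the excess fineness of the mesh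
      have e3 : (T : ℝ) * (C * r ^ (1 - η)) ^ 2 = C ^ 2 * (T : ℝ) ^ (-(η * (1 - 2 * η))) := by
        rw [mul_pow, hr, ← Real.rpow_mul hT0.le, ← Real.rpow_natCast ((T : ℝ) ^ _) 2,
          ← Real.rpow_mul hT0.le, mul_left_comm]
        congr 1
        nth_rewrite 1 [← Real.rpow_one (T : ℝ)]
        rw [← Real.rpow_add hT0]
        congr 1
        push_cast
        ring
      rw [e3]
      have h4 : 0 ≤ (2 * M + 3) ^ (2 * p) * B * (T : ℝ) ^ (-(η * (1 - 2 * η))) := by positivity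
      linarith

end Brackets

section Negligibility

variable {Ω : Type*} [MeasurableSpace Ω] {P : Measure Ω} [IsProbabilityMeasure P] {p : ℕ}
  {X : ℕ → Ω → EuclideanSpace ℝ (Fin p)}

/-- Root-consistency, coordinatewise. -/
lemma IsRootConsistent.exists_forall_abs_le {Z : ℕ → Ω → EuclideanSpace ℝ (Fin p)}
    (hZ : IsRootConsistent Z P) {η : ℝ} (hη : 0 < η) :
    ∃ M : ℝ, ∀ M' ≥ M, ∀ᶠ T : ℕ in atTop,
      P.real {ω | ¬ ∀ j, |Z T ω j| ≤ M' * (T : ℝ) ^ (-(1 / 2) : ℝ)} ≤ η := by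
  obtain ⟨M, hM⟩ := hZ η hη
  refine ⟨M, fun M' hM' => ?_⟩
  filter_upwards [hM, eventually_ne_atTop 0] with T hT hT0
  refine (measureReal_mono (fun ω hω => ?_)).trans hT
  by_contra hle
  refine hω fun j => ?_
  have hTp : (0 : ℝ) < T := by exact_mod_cast Nat.pos_of_ne_zero hT0
  have h1 : √(T : ℝ) * ‖Z T ω‖ ≤ M := not_lt.1 hle
  have h2 : |Z T ω j| ≤ ‖Z T ω‖ := by
    simpa only [Real.norm_eq_abs] using PiLp.norm_apply_le (Z T ω) j
  rw [Real.rpow_neg hTp.le, ← Real.sqrt_eq_rpow, ← div_eq_mul_inv,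
    le_div_iff₀ (Real.sqrt_pos.2 hTp), mul_comm]
  exact ((mul_le_mul_of_nonneg_left h2 (Real.sqrt_nonneg _)).trans h1).trans hM'

/-- The estimator computed from estimated location and scale and the estimator computed from the
population parameters differ by a term that tends to zero in probability. -/
theorem eventually_measureReal_quadForm_sub_le (hX : ∀ t, Measurable (X t))
    (hstat : IsStrictlyStationary X P)
    (hmix : Summable fun k : ℕ => (k : ℝ) ^ 2 * mixingCoeff X P k)
    {ψ : EuclideanSpace ℝ (Fin p) → ℝ} (hψm : Measurable ψ) {c : ℝ} (hψc : ∀ x, |ψ x| ≤ c)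
    {μ σ : EuclideanSpace ℝ (Fin p)} (hB : HasBrackets P (X 0) ψ μ σ (meshExponent p))
    {μhat σhat : ℕ → Ω → EuclideanSpace ℝ (Fin p)}
    (hμ : IsRootConsistent (fun T ω => μhat T ω - μ) P)
    (hσ : IsRootConsistent (fun T ω => σhat T ω - σ) P)
    {k : ℝ → ℝ} {b : ℕ → ℝ} (hk : IsKernelBandwidth k b) {ε η : ℝ} (hε : 0 < ε) (hη : 0 < η) :
    ∀ᶠ T : ℕ in atTop, P.real {ω | ε ≤ |quadForm k (b T) T
        (center T fun i => ψ (standardize (μhat T ω) (σhat T ω) (X i ω)))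
        (center T fun i => ψ (standardize (μhat T ω) (σhat T ω) (X i ω))) -
      quadForm k (b T) T (center T fun i => ψ (standardize μ σ (X i ω)))
        (center T fun i => ψ (standardize μ σ (X i ω)))|} ≤ η := by
  obtain ⟨g, J, ρ, hkgJ, hg, hρ, hJ⟩ := hk.exists_cosKernel_add_jump
  obtain ⟨M₁, hM₁⟩ := hμ.exists_forall_abs_le (η := η / 4) (by positivity)
  obtain ⟨M₂, hM₂⟩ := hσ.exists_forall_abs_le (η := η / 4) (by positivity)
  set M := max 0 (max M₁ M₂) with hM
  have hM0 : 0 ≤ M := le_max_left _ _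
  obtain ⟨K, hK, hmaj⟩ := exists_perturbation_majorant hX hstat hmix hg b hψm hψc hB hM0
  have hc0 : 0 ≤ c := (abs_nonneg _).trans (hψc 0)
  have hfm : Measurable fun x => ψ (standardize μ σ x) := hψm.comp (measurable_standardize μ σ)
  have hcov := hasCovBound_of_bounded hX hstat hmix hfm (c := c) (fun x => hψc _) le_rfl
  set D := 8 * (∫ ξ, |g ξ|) *
    ∑' h, √(8 * c ^ 3 * ∫ ω, |ψ (standardize μ σ (X 0 ω))| ∂P) * √(mixingCoeff X P h) with hD
  have hD0 : 0 ≤ D :=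
    mul_nonneg (mul_nonneg (by norm_num) (integral_nonneg fun _ => abs_nonneg _)) hcov.tsum_nonneg
  -- the weight of Cauchy–Schwarz makes the contribution of the limit variance small
  set t := ε * (η / 4) / (D + 1) with ht
  have ht0 : 0 < t := by rw [ht]; positivity
  have htD : t * D ≤ ε * (η / 4) := by
    rw [ht, div_mul_eq_mul_div, div_le_iff₀ (by linarith)]
    have : 0 < ε * (η / 4) := by positivity
    nlinarith
  set L := 1 + t⁻¹ + 12 * (2 * c) * ρ with hL
  have hL0 : 0 ≤ L := by rw [hL]; positivity
  clear_value t D L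
  set κ := meshExponent p * (1 - 2 * meshExponent p) with hκ
  have hκ0 : 0 < κ := mul_pos (meshExponent_pos p) (by linarith [meshExponent_le p])
  have hlim : Tendsto (fun T : ℕ => L * (K * (T : ℝ) ^ (-(1 / 16) : ℝ) + K * (T : ℝ) ^ (-κ))) atTop
      (𝓝 0) := by
    have h1 := ((tendsto_rpow_neg_atTop (by norm_num : (0 : ℝ) < 1 / 16)).comp
      tendsto_natCast_atTop_atTop).const_mul K
    have h2 := ((tendsto_rpow_neg_atTop hκ0).comp tendsto_natCast_atTop_atTop).const_mul K
    simpa using (h1.add h2).const_mul L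
  filter_upwards [hmaj, hM₁ M ((le_max_left _ _).trans (le_max_right _ _)),
    hM₂ M ((le_max_right _ _).trans (le_max_right _ _)), eventually_ne_atTop 0,
    hk.bandwidth_tendsto.eventually_gt_atTop 0,
    hlim.eventually (eventually_le_nhds (by positivity : 0 < ε * (η / 4)))]
    with T ⟨R, hRi, hR0, hRint, hRb⟩ hT₁ hT₂ hT hbT hTl
  set E : Ω → ℝ := fun ω => spectralEnergy g (b T) T
    (center T fun i => ψ (standardize μ σ (X i ω))) with hE
  have iE : Integrable E P := by
    have hm := measurable_center (fun i => hfm.comp (hX i)) T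
    exact integrable_quadForm hm hm (bounded_center ⟨c, fun i ω => hψc _⟩ T)
      (bounded_center ⟨c, fun i ω => hψc _⟩ T) _ (b T) T
  have bE : ∫ ω, E ω ∂P ≤ D := by
    have h1 := hcov.integral_spectralEnergy_center_le hg (b T) hT
    have e1 : ∀ ω, center T (fun i => ψ (standardize μ σ (X i ω)) -
        ∫ ω, ψ (standardize μ σ (X 0 ω)) ∂P) =
        center T fun i => ψ (standardize μ σ (X i ω)) := fun ω => by
      simpa only [sub_eq_add_neg] using
        center_add_const hT (fun i => ψ (standardize μ σ (X i ω))) _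
    rw [hD]
    simpa only [e1] using h1
  set W : Ω → ℝ := fun ω => t * E ω + L * (R ω + K * (T : ℝ) ^ (-κ)) with hW
  have iRK : Integrable (fun ω => L * (R ω + K * (T : ℝ) ^ (-κ))) P :=
    (hRi.add (integrable_const _)).const_mul L
  have iW : Integrable W P := (iE.const_mul t).add iRK
  have W0 : ∀ ω, 0 ≤ W ω := fun ω => by
    have := hR0 ω
    have : 0 ≤ E ω := spectralEnergy_nonneg hg _
    simp only [hW]
    positivity
  have bW : ∫ ω, W ω ∂P ≤ ε * (η / 2) := by
    have e1 : ∫ ω, W ω ∂P = t * ∫ ω, E ω ∂P + L * (∫ ω, R ω ∂P + K * (T : ℝ) ^ (-κ)) := by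
      simp only [hW]
      rw [integral_add (iE.const_mul t) iRK, integral_const_mul, integral_const_mul,
        integral_add hRi (integrable_const _)]
      simp
    have h1 := mul_le_mul_of_nonneg_left bE ht0.le
    have h2 := mul_le_mul_of_nonneg_left (add_le_add_left hRint (K * (T : ℝ) ^ (-κ))) hL0
    rw [e1]
    linarith
  -- the random majorant works on the event that the parameters are well estimated
  have hsub : {ω | ε ≤ |quadForm k (b T) T
        (center T fun i => ψ (standardize (μhat T ω) (σhat T ω) (X i ω)))
        (center T fun i => ψ (standardize (μhat T ω) (σhat T ω) (X i ω))) -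
      quadForm k (b T) T (center T fun i => ψ (standardize μ σ (X i ω)))
        (center T fun i => ψ (standardize μ σ (X i ω)))|} ⊆
      ({ω | ¬ ∀ j, |(μhat T ω - μ) j| ≤ M * (T : ℝ) ^ (-(1 / 2) : ℝ)} ∪
        {ω | ¬ ∀ j, |(σhat T ω - σ) j| ≤ M * (T : ℝ) ^ (-(1 / 2) : ℝ)}) ∪ {ω | ε ≤ W ω} := by
    intro ω hω
    by_contra hnot
    rw [Set.mem_union, Set.mem_union, not_or, not_or] at hnot
    obtain ⟨⟨h1, h2⟩, h3⟩ := hnot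
    have h1' : ∀ j, |μhat T ω j - μ j| ≤ M * (T : ℝ) ^ (-(1 / 2) : ℝ) := not_not.1 h1
    have h2' : ∀ j, |σhat T ω j - σ j| ≤ M * (T : ℝ) ^ (-(1 / 2) : ℝ) := not_not.1 h2
    refine h3 (le_trans (Set.mem_ofPred_eq ▸ hω) ?_)
    have hmajω := hRb ω _ _ h1' h2'
    set v : ℕ → ℝ := fun i => ψ (standardize μ σ (X i ω)) with hv
    set w : ℕ → ℝ := fun i => ψ (standardize (μhat T ω) (σhat T ω) (X i ω)) -
      ψ (standardize μ σ (X i ω)) with hw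
    have hvw : (fun i => ψ (standardize (μhat T ω) (σhat T ω) (X i ω))) = v + w := by
      ext i; simp [hv, hw]
    have hvc : ∀ i, |v i| ≤ 2 * c := fun i => (hψc _).trans (by linarith)
    have hwc : ∀ i, |w i| ≤ 2 * c := fun i => (abs_sub _ _).trans (by
      have := hψc (standardize (μhat T ω) (σhat T ω) (X i ω))
      have := hψc (standardize μ σ (X i ω))
      linarith)
    have hpert := abs_quadForm_center_add_sub_le hg ht0 (hJ (b T) hbT T) hρ hvc hwc
    rw [hvw, hkgJ]
    refine hpert.trans ?_
    rw [← hL]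
    exact add_le_add le_rfl (mul_le_mul_of_nonneg_left hmajω hL0)
  have hmarkov : P.real {ω | ε ≤ W ω} ≤ η / 2 := by
    have h1 := mul_meas_ge_le_integral_of_nonneg (Eventually.of_forall W0) iW ε
    have h2 : ε * P.real {ω | ε ≤ W ω} ≤ ε * (η / 2) := h1.trans bW
    exact le_of_mul_le_mul_left h2 hε
  calc _ ≤ P.real _ := measureReal_mono hsub
    _ ≤ _ + _ := measureReal_union_le _ _
    _ ≤ (_ + _) + _ := add_le_add (measureReal_union_le _ _) le_rfl
    _ ≤ (η / 4 + η / 4) + η / 2 := add_le_add (add_le_add hT₁ hT₂) hmarkov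
    _ = η := by ring

end Negligibility

/-! ### From scalar transformations to matrices -/

section Matrix

variable {Ω : Type*} [MeasurableSpace Ω] {P : Measure Ω} {p s : ℕ}

lemma kernelEstimator_eq_quadForm (k : ℝ → ℝ) (b : ℝ) (T : ℕ) (y : ℕ → Fin s → ℝ) (l m : Fin s) :
    kernelEstimator k b T y l m =
      quadForm k b T (center T fun i => y i l) (center T fun i => y i m) := rfl

/-- The entries of the matrix estimator by polarization. -/
lemma kernelEstimator_polarization (k : ℝ → ℝ) (b : ℝ) (T : ℕ) (y : ℕ → Fin s → ℝ) (l m : Fin s) :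
    kernelEstimator k b T y l m =
      (quadForm k b T (center T fun i => y i l + y i m) (center T fun i => y i l + y i m) -
        quadForm k b T (center T fun i => y i l - y i m)
          (center T fun i => y i l - y i m)) / 4 := by
  rw [kernelEstimator_eq_quadForm, quadForm_center_polarization]
  congr 2
  have : (fun i => y i l) + (-1 : ℝ) • (fun i => y i m) = fun i => y i l - y i m := by
    ext i; simp [sub_eq_add_neg]
  rw [this]

end Matrix

section Convergence

variable {Ω : Type*} [MeasurableSpace Ω] {P : Measure Ω}

lemma tendstoInMeasure_of_abs_sub_le [IsFiniteMeasure P] {f u v : ℕ → Ω → ℝ} {g : Ω → ℝ}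
    (hu : TendstoInMeasure P u atTop fun _ => (0 : ℝ))
    (hv : TendstoInMeasure P v atTop fun _ => (0 : ℝ))
    (h : ∀ T ω, |f T ω - g ω| ≤ |u T ω| + |v T ω|) : TendstoInMeasure P f atTop g := by
  rw [tendstoInMeasure_iff_measureReal_norm] at hu hv ⊢
  intro ε hε
  have hlim := (hu (ε / 2) (half_pos hε)).add (hv (ε / 2) (half_pos hε))
  rw [add_zero] at hlim
  refine squeeze_zero (fun _ => measureReal_nonneg) (fun T => ?_) hlim
  refine (measureReal_mono (fun ω hω => ?_)).trans (measureReal_union_le _ _)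
  by_contra hnot
  rw [Set.mem_union, not_or] at hnot
  have h1 : |u T ω - 0| < ε / 2 := not_le.1 hnot.1
  have h2 : |v T ω - 0| < ε / 2 := not_le.1 hnot.2
  have h3 : ε ≤ |f T ω - g ω| := hω
  rw [sub_zero] at h1 h2
  linarith [h T ω]

lemma tendstoInMeasure_zero_of_eventually [IsFiniteMeasure P] {f : ℕ → Ω → ℝ}
    (h : ∀ ε > (0 : ℝ), ∀ η > (0 : ℝ), ∀ᶠ T : ℕ in atTop, P.real {ω | ε ≤ |f T ω|} ≤ η) :
    TendstoInMeasure P f atTop fun _ => (0 : ℝ) := by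
  rw [tendstoInMeasure_iff_measureReal_norm]
  intro ε hε
  rw [Metric.tendsto_nhds]
  intro η hη
  filter_upwards [h ε hε (η / 2) (half_pos hη)] with T hT
  simp only [sub_zero, Real.norm_eq_abs, Real.dist_eq]
  rw [abs_of_nonneg measureReal_nonneg]
  linarith

lemma tendstoInMeasure_zero_of_integral_abs [IsFiniteMeasure P] {f : ℕ → Ω → ℝ}
    (hf : ∀ T, Integrable (f T) P)
    (h : ∀ ε > (0 : ℝ), ∀ᶠ T : ℕ in atTop, ∫ ω, |f T ω| ∂P ≤ ε) :
    TendstoInMeasure P f atTop fun _ => (0 : ℝ) := by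
  refine tendstoInMeasure_zero_of_eventually fun ε hε η hη => ?_
  filter_upwards [h (ε * η) (by positivity)] with T hT
  have h1 := mul_meas_ge_le_integral_of_nonneg (Eventually.of_forall fun ω => abs_nonneg (f T ω))
    (hf T).abs ε
  exact le_of_mul_le_mul_left (h1.trans hT) hε

end Convergence

section LongRun

variable {Ω : Type*} [MeasurableSpace Ω] {P : Measure Ω} {p s : ℕ}
  {X : ℕ → Ω → EuclideanSpace ℝ (Fin p)} {f₁ f₂ : EuclideanSpace ℝ (Fin p) → ℝ} {c : ℝ}

lemma scalarAutocov_eq_covariance (hX : ∀ t, Measurable (X t)) (hstat : IsStrictlyStationary X P)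
    (hf : Measurable f₁) (h : ℕ) :
    scalarAutocov X P f₁ h = cov[fun ω => f₁ (X 0 ω), fun ω => f₁ (X h ω); P] := by
  rw [covariance, integral_comp_eq hX hstat hf h, scalarAutocov]

variable [IsProbabilityMeasure P]

lemma memLp_comp (hX : ∀ t, Measurable (X t)) (hf : Measurable f₁) (hc : ∀ x, |f₁ x| ≤ c) (h : ℕ) :
    MemLp (fun ω => f₁ (X h ω)) 2 P :=
  MemLp.of_bound (hf.comp (hX h)).aestronglyMeasurable c (Eventually.of_forall fun ω => by
    simpa using hc _)

lemma summable_covariance (hX : ∀ t, Measurable (X t))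
    (hmix : Summable fun k : ℕ => (k : ℝ) ^ 2 * mixingCoeff X P k)
    (hf₁ : Measurable f₁) (hf₂ : Measurable f₂) (hc₁ : ∀ x, |f₁ x| ≤ c) (hc₂ : ∀ x, |f₂ x| ≤ c) :
    Summable fun h : ℕ => cov[fun ω => f₁ (X 0 ω), fun ω => f₂ (X h ω); P] := by
  refine Summable.of_norm_bounded ((summable_mixingCoeff hmix).mul_left (4 * c * c)) fun h => ?_
  rw [covariance_eq_sub (memLp_comp hX hf₁ hc₁ 0) (memLp_comp hX hf₂ hc₂ h), Real.norm_eq_abs]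
  refine abs_cov_le_mixingCoeff (n := 0) hX (hf₁.comp (measurable_pastSigma le_rfl))
    (hf₂.comp (measurable_futureSigma (by omega))) (fun ω => hc₁ _) fun ω => hc₂ _

/-- Polarization of the autocovariances. -/
lemma scalarAutocov_polarization (hX : ∀ t, Measurable (X t)) (hstat : IsStrictlyStationary X P)
    (hf₁ : Measurable f₁) (hf₂ : Measurable f₂) (hc₁ : ∀ x, |f₁ x| ≤ c) (hc₂ : ∀ x, |f₂ x| ≤ c)
    (h : ℕ) :
    scalarAutocov X P (fun x => f₁ x + f₂ x) h - scalarAutocov X P (fun x => f₁ x - f₂ x) h =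
      2 * (cov[fun ω => f₁ (X 0 ω), fun ω => f₂ (X h ω); P] +
        cov[fun ω => f₂ (X 0 ω), fun ω => f₁ (X h ω); P]) := by
  have m₁ := memLp_comp (P := P) hX hf₁ hc₁
  have m₂ := memLp_comp (P := P) hX hf₂ hc₂
  have e1 : cov[fun ω => f₁ (X 0 ω) + f₂ (X 0 ω), fun ω => f₁ (X h ω) + f₂ (X h ω); P] =
      cov[fun ω => f₁ (X 0 ω), fun ω => f₁ (X h ω); P] +
        cov[fun ω => f₁ (X 0 ω), fun ω => f₂ (X h ω); P] +
      (cov[fun ω => f₂ (X 0 ω), fun ω => f₁ (X h ω); P] +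
        cov[fun ω => f₂ (X 0 ω), fun ω => f₂ (X h ω); P]) := by
    rw [← covariance_add_right (m₁ 0) (m₁ h) (m₂ h), ← covariance_add_right (m₂ 0) (m₁ h) (m₂ h),
      ← covariance_add_left (m₁ 0) (m₂ 0) ((m₁ h).add (m₂ h))]
    rfl
  have hadd : Measurable fun x => f₁ x + f₂ x := hf₁.add hf₂
  have hsub : Measurable fun x => f₁ x - f₂ x := hf₁.sub hf₂
  rw [scalarAutocov_eq_covariance hX hstat hadd, scalarAutocov_eq_covariance hX hstat hsub, e1,
    covariance_fun_sub_fun_sub (m₁ 0) (m₂ 0) (m₁ h) (m₂ h)]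
  ring

lemma longRunCov_polarization (hX : ∀ t, Measurable (X t)) (hstat : IsStrictlyStationary X P)
    (hmix : Summable fun k : ℕ => (k : ℝ) ^ 2 * mixingCoeff X P k)
    {F : EuclideanSpace ℝ (Fin p) → Fin s → ℝ} (hF : ∀ l, Measurable fun x => F x l)
    (hc : ∀ l x, |F x l| ≤ c) (l m : Fin s) :
    longRunCov (fun t ω => F (X t ω)) P l m =
      (scalarAutocov X P (fun x => F x l + F x m) 0 +
          2 * ∑' h, scalarAutocov X P (fun x => F x l + F x m) (h + 1) -
        (scalarAutocov X P (fun x => F x l - F x m) 0 +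
          2 * ∑' h, scalarAutocov X P (fun x => F x l - F x m) (h + 1))) / 4 := by
  have hadd : Measurable fun x => F x l + F x m := (hF l).add (hF m)
  have hsub : Measurable fun x => F x l - F x m := (hF l).sub (hF m)
  have s1 := (summable_nat_add_iff 1).2 (summable_scalarAutocov hX hstat hmix hadd
    (c := c + c) fun x => (abs_add_le _ _).trans (add_le_add (hc l x) (hc m x)))
  have s2 := (summable_nat_add_iff 1).2 (summable_scalarAutocov hX hstat hmix hsub
    (c := c + c) fun x => (abs_sub _ _).trans (add_le_add (hc l x) (hc m x)))
  have hpol := scalarAutocov_polarization hX hstat (hF l) (hF m) (hc l) (hc m)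
  have h0 := hpol 0
  rw [covariance_comm (fun ω => F (X 0 ω) m)] at h0
  have hsum : ∑' h, scalarAutocov X P (fun x => F x l + F x m) (h + 1) -
      ∑' h, scalarAutocov X P (fun x => F x l - F x m) (h + 1) =
      2 * ∑' h : ℕ, (cov[fun ω => F (X 0 ω) l, fun ω => F (X (h + 1) ω) m; P] +
        cov[fun ω => F (X 0 ω) m, fun ω => F (X (h + 1) ω) l; P]) := by
    rw [← s1.tsum_sub s2, ← tsum_mul_left]
    exact tsum_congr fun h => hpol (h + 1)
  simp only [longRunCov, autocov, Matrix.of_apply]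
  linarith

/-- Consistency of the matrix estimator computed from the stationary sequence `F(X_t)` itself. -/
theorem tendstoInMeasure_kernelEstimator_sub (hX : ∀ t, Measurable (X t))
    (hstat : IsStrictlyStationary X P)
    (hmix : Summable fun k : ℕ => (k : ℝ) ^ 2 * mixingCoeff X P k)
    {F : EuclideanSpace ℝ (Fin p) → Fin s → ℝ} (hF : ∀ l, Measurable fun x => F x l)
    (hc : ∀ l x, |F x l| ≤ c) {k : ℝ → ℝ} {b : ℕ → ℝ} (hk : IsKernelBandwidth k b) (l m : Fin s) :
    TendstoInMeasure P (fun (T : ℕ) ω => kernelEstimator k (b T) T (fun t => F (X t ω)) l m -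
      longRunCov (fun t ω => F (X t ω)) P l m) atTop fun _ => (0 : ℝ) := by
  have hcons : ∀ f : EuclideanSpace ℝ (Fin p) → ℝ, Measurable f → (∀ x, |f x| ≤ c + c) →
      TendstoInMeasure P (fun (T : ℕ) ω => quadForm k (b T) T
          (center T fun i => f (X i ω)) (center T fun i => f (X i ω)) -
        (scalarAutocov X P f 0 + 2 * ∑' h, scalarAutocov X P f (h + 1)))
        atTop fun _ => (0 : ℝ) := by
    intro f hf hfc
    refine tendstoInMeasure_zero_of_integral_abs (fun T => ?_) fun ε hε =>
      eventually_integral_abs_quadForm_sub_le hX hstat hmix hf hfc hk hε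
    have hm := measurable_center (fun i => hf.comp (hX i)) T
    have hb := bounded_center (u := fun i ω => f (X i ω)) ⟨c + c, fun i ω => hfc _⟩ T
    exact (integrable_quadForm hm hm hb hb k (b T) T).sub (integrable_const _)
  have h1 := hcons (fun x => F x l + F x m) ((hF l).add (hF m))
    (fun x => (abs_add_le _ _).trans (add_le_add (hc l x) (hc m x)))
  have h2 := hcons (fun x => F x l - F x m) ((hF l).sub (hF m))
    (fun x => (abs_sub _ _).trans (add_le_add (hc l x) (hc m x)))
  refine tendstoInMeasure_of_abs_sub_le h1 h2 fun T ω => ?_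
  rw [kernelEstimator_polarization, longRunCov_polarization hX hstat hmix hF hc, sub_zero,
    ← sub_div, abs_div, sub_sub_sub_comm]
  exact (div_le_self (abs_nonneg _) (by norm_num)).trans (abs_sub _ _)

end LongRun

section Estimated

variable {Ω : Type*} [MeasurableSpace Ω] {P : Measure Ω} [IsProbabilityMeasure P] {p s : ℕ}
  {X : ℕ → Ω → EuclideanSpace ℝ (Fin p)}

/-- The matrix estimators computed from estimated and from population parameters differ by a term
that tends to zero in probability. -/
theorem tendstoInMeasure_kernelEstimator_standardize_sub (hX : ∀ t, Measurable (X t))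
    (hstat : IsStrictlyStationary X P)
    (hmix : Summable fun k : ℕ => (k : ℝ) ^ 2 * mixingCoeff X P k)
    {Ψ : EuclideanSpace ℝ (Fin p) → Fin s → ℝ} (hΨ : IsAdmissible Ψ)
    (hdens : (∃ L : ℝ≥0, LipschitzWith L Ψ) ∨
      ∃ K : ℝ≥0, P.map (X 0) ≤ K • (volume : Measure (EuclideanSpace ℝ (Fin p))) ∧
        ∀ j : Fin p, P.map (fun ω => X 0 ω j) ≤ K • (volume : Measure ℝ))
    {μ σ : EuclideanSpace ℝ (Fin p)} (hσ : ∀ j, 0 < σ j)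
    {μhat σhat : ℕ → Ω → EuclideanSpace ℝ (Fin p)}
    (hμ : IsRootConsistent (fun T ω => μhat T ω - μ) P)
    (hσc : IsRootConsistent (fun T ω => σhat T ω - σ) P)
    {k : ℝ → ℝ} {b : ℕ → ℝ} (hk : IsKernelBandwidth k b) (l m : Fin s) :
    TendstoInMeasure P (fun (T : ℕ) ω =>
      kernelEstimator k (b T) T (fun t => Ψ (standardize (μhat T ω) (σhat T ω) (X t ω))) l m -
      kernelEstimator k (b T) T (fun t => Ψ (standardize μ σ (X t ω))) l m)
      atTop fun _ => (0 : ℝ) := by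
  obtain ⟨C, hC⟩ := hΨ.bounded
  have hΨl : ∀ l, Measurable fun x => Ψ x l := fun l => (measurable_pi_apply l).comp hΨ.measurable
  have hΨc : ∀ l x, |Ψ x l| ≤ C := fun l x => by
    simpa using (norm_le_pi_norm (Ψ x) l).trans (hC x).le
  have hsub : ∀ l x y, |Ψ x l - Ψ y l| ≤ ‖Ψ x - Ψ y‖ := fun l x y => by
    simpa using norm_le_pi_norm (Ψ x - Ψ y) l
  have hη1 : meshExponent p < 1 := by linarith [meshExponent_le p]
  have hneg : ∀ ψ : EuclideanSpace ℝ (Fin p) → ℝ, Measurable ψ →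
      (∀ x, |ψ x| ≤ C + C) → (∀ x y, |ψ x - ψ y| ≤ |Ψ x l - Ψ y l| + |Ψ x m - Ψ y m|) →
      TendstoInMeasure P (fun (T : ℕ) ω => quadForm k (b T) T
          (center T fun i => ψ (standardize (μhat T ω) (σhat T ω) (X i ω)))
          (center T fun i => ψ (standardize (μhat T ω) (σhat T ω) (X i ω))) -
        quadForm k (b T) T (center T fun i => ψ (standardize μ σ (X i ω)))
          (center T fun i => ψ (standardize μ σ (X i ω)))) atTop fun _ => (0 : ℝ) := by
    intro ψ hψm hψc hψd
    have hB : HasBrackets P (X 0) ψ μ σ (meshExponent p) :=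
      hΨ.hasBrackets (hX 0) hdens hσ (meshExponent_pos p) hη1 fun x y =>
        (hψd x y).trans (by linarith [hsub l x y, hsub m x y])
    exact tendstoInMeasure_zero_of_eventually fun ε hε η hη =>
      eventually_measureReal_quadForm_sub_le hX hstat hmix hψm hψc hB hμ hσc hk hε hη
  have h1 := hneg (fun x => Ψ x l + Ψ x m) ((hΨl l).add (hΨl m))
    (fun x => (abs_add_le _ _).trans (add_le_add (hΨc l x) (hΨc m x)))
    (fun x y => by rw [add_sub_add_comm]; exact abs_add_le _ _)
  have h2 := hneg (fun x => Ψ x l - Ψ x m) ((hΨl l).sub (hΨl m))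
    (fun x => (abs_sub _ _).trans (add_le_add (hΨc l x) (hΨc m x)))
    (fun x y => by rw [sub_sub_sub_comm]; exact abs_sub _ _)
  refine tendstoInMeasure_of_abs_sub_le h1 h2 fun T ω => ?_
  rw [kernelEstimator_polarization, kernelEstimator_polarization, sub_zero, ← sub_div, abs_div,
    sub_sub_sub_comm]
  exact (div_le_self (abs_nonneg _) (by norm_num)).trans (abs_sub _ _)

end Estimated

end RobustCusum

theorem proposition3 {Ω : Type*} [MeasurableSpace Ω] (P : Measure Ω) [IsProbabilityMeasure P]
    {p s : ℕ} (X : ℕ → Ω → EuclideanSpace ℝ (Fin p)) (hX : ∀ t, Measurable (X t))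
    -- stationarity and strong mixing with `∑ k² a_k < ∞`
    (hstat : RobustCusum.IsStrictlyStationary X P)
    (hmix : Summable fun k : ℕ => (k : ℝ) ^ 2 * RobustCusum.mixingCoeff X P k)
    -- the transformation
    (Ψ : EuclideanSpace ℝ (Fin p) → Fin s → ℝ) (hΨ : RobustCusum.IsAdmissible Ψ)
    -- unless `Ψ` is Lipschitz: bounded densities of `X_0` and of its coordinates
    (hdens : (∃ L : ℝ≥0, LipschitzWith L Ψ) ∨
      ∃ K : ℝ≥0, P.map (X 0) ≤ K • (volume : Measure (EuclideanSpace ℝ (Fin p))) ∧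
        ∀ j : Fin p, P.map (fun ω => X 0 ω j) ≤ K • (volume : Measure ℝ))
    -- population location and scale, and a nondegenerate long run covariance matrix
    (μ σ : EuclideanSpace ℝ (Fin p)) (hσ : ∀ j, 0 < σ j)
    (hdet : 0 < (RobustCusum.longRunCov
      (fun t ω => Ψ (RobustCusum.standardize μ σ (X t ω))) P).det)
    -- root-`T` consistent estimators of location and scale
    (μhat σhat : ℕ → Ω → EuclideanSpace ℝ (Fin p))
    (hμm : ∀ T, Measurable (μhat T)) (hσm : ∀ T, Measurable (σhat T))
    (hμ : RobustCusum.IsRootConsistent (fun T ω => μhat T ω - μ) P)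
    (hσc : RobustCusum.IsRootConsistent (fun T ω => σhat T ω - σ) P)
    -- kernel and bandwidth
    (k : ℝ → ℝ) (b : ℕ → ℝ) (hk : RobustCusum.IsKernelBandwidth k b) :
    -- the series defining the long run covariance matrix `U` converges absolutely
    (∀ l m : Fin s, Summable fun h : ℕ => RobustCusum.autocov
      (fun t ω => Ψ (RobustCusum.standardize μ σ (X t ω))) P h l m) ∧
    -- the estimator converges to `U` in probability
    (∀ l m : Fin s, TendstoInMeasure P
      (fun (T : ℕ) ω => RobustCusum.kernelEstimator k (b T) T
        (fun t => Ψ (RobustCusum.standardize (μhat T ω) (σhat T ω) (X t ω))) l m)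
      atTop
      (fun _ => RobustCusum.longRunCov
        (fun t ω => Ψ (RobustCusum.standardize μ σ (X t ω))) P l m)) ∧
    -- the estimation of location and scale is asymptotically negligible
    (∀ l m : Fin s, TendstoInMeasure P
      (fun (T : ℕ) ω =>
        RobustCusum.kernelEstimator k (b T) T
          (fun t => Ψ (RobustCusum.standardize (μhat T ω) (σhat T ω) (X t ω))) l m -
        RobustCusum.kernelEstimator k (b T) T
          (fun t => Ψ (RobustCusum.standardize μ σ (X t ω))) l m)
      atTop (fun _ => (0 : ℝ))) := by
  obtain ⟨C, hC⟩ := hΨ.bounded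
  have hstd := RobustCusum.measurable_standardize μ σ
  have hFl : ∀ l, Measurable fun x => Ψ (RobustCusum.standardize μ σ x) l := fun l =>
    ((measurable_pi_apply l).comp hΨ.measurable).comp hstd
  have hFc : ∀ l x, |Ψ (RobustCusum.standardize μ σ x) l| ≤ C := fun l x => by
    simpa using (norm_le_pi_norm (Ψ (RobustCusum.standardize μ σ x)) l).trans (hC _).le
  have hneg := RobustCusum.tendstoInMeasure_kernelEstimator_standardize_sub hX hstat hmix hΨ hdens
    hσ hμ hσc hk
  refine ⟨fun l m => ?_, fun l m => ?_, fun l m => hneg l m⟩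
  · exact RobustCusum.summable_covariance (f₁ := fun x => Ψ (RobustCusum.standardize μ σ x) l)
      (f₂ := fun x => Ψ (RobustCusum.standardize μ σ x) m) hX hmix (hFl l) (hFl m) (hFc l) (hFc m)
  have hpop := RobustCusum.tendstoInMeasure_kernelEstimator_sub hX hstat hmix
    (F := fun x => Ψ (RobustCusum.standardize μ σ x)) hFl hFc hk l m
  refine RobustCusum.tendstoInMeasure_of_abs_sub_le (hneg l m) hpop fun T ω => ?_
  refine le_trans (le_of_eq ?_) (abs_add_le _ _)
  rw [sub_add_sub_cancel]
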